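/- Let $s,v>0$. For each $n$ let $h_n$ be a Hermitian $n\times n$ matrix whose normalized counting measure of eigenvalues $\nu_0^{(n)}$ converges weakly to a probability measure $\nu_0$ on $\mathbb{R}$, and let $w_n$, $n\ge1$, be random Hermitian $n\times n$ matrices defined on one probability space (with arbitrary joint law), each a GUE matrix: the entries $w_{jk}$, $j\le k$, are independent centered Gaussians, with $\langle w_{jj}^2\rangle=1$, and for $j<k$ the real and imaginary parts are independent, each of variance $1/2$. Put $$H^{(n)}=s\,\sigma^z\otimes \mathbf 1_n+\mathbf 1_2\otimes h_n+\frac{v}{\sqrt n}\,\sigma^x\otimes w_n \quad\text{on } \mathbb{C}^2\otimes\mathbb{C}^n ,$$ with the Pauli matrices $\sigma^x=\begin{pmatrix}0&1\\1&0\end{pmatrix}$, $\sigma^z=\begin{pmatrix}1&0\\0&-1\end{pmatrix}$, and define the $2\times2$ matrix measure $$\nu^{(n)}_{\alpha\gamma}(\Delta)=\frac1n\sum_{j=1}^n \chi_\Delta(H^{(n)})_{\alpha j,\gamma j},\qquad \alpha,\gamma=\pm,$$ where $\chi_\Delta$ is the indicator of $\Delta$. Then there are non-random measures $\nu_+,\nu_-$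 on $\mathbb{R}$ such that: (i) with probability 1, $\nu^{(n)}$ converges weakly to $\mathrm{diag}(\nu_+,\nu_-)$, i.e. $\int\varphi\,d\nu^{(n)}_{\alpha\gamma}\to\delta_{\alpha\gamma}\int\varphi\,d\nu_\alpha$ for all bounded continuous $\varphi:\mathbb{R}\to\mathbb{R}$ and all $\alpha,\gamma$; (ii) the Stieltjes transforms $f_\alpha(z)=\int\frac{\nu_\alpha(d\lambda)}{\lambda-z}$, $\Im z\ne0$, form the unique solution of $$f_\alpha(z)=\int_{\mathbb{R}}\frac{\nu_0(dE)}{E+\alpha s-z-v^2f_{-\alpha}(z)},\qquad \alpha=\pm,\ \Im z\neq 0,$$ in the class of pairs of functions that are analytic for $\Im z\ne0$ and satisfy $\Im f_\alpha(z)\cdot\Im z>0$ there; (iii) $\nu_+$ and $\nu_-$ are probability measures, and if $\nu_0$ is absolutely continuous with (essentially) bounded density $\nu_0'$, then $\nu_\alpha$ is absolutely continuous and $\nu_\alpha'(\lambda)\le \sup_\mu \nu_0'(\mu)$ for almost every $\lambda$, $\alpha=\pm$; (iv) (microcanonical) for $\varepsilon>0$ and $\lambda\in\mathbb{R}$ put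 $\overline\nu^{(n)}_{\alpha\gamma}(\lambda)=(2\varepsilon n)^{-1}\sum_{j}\chi_{(-\varepsilon,\varepsilon)}(\lambda-H^{(n)})_{\alpha j,\gamma j}$ and $\overline\nu_\alpha(\lambda)=(2\varepsilon)^{-1}\nu_\alpha((\lambda-\varepsilon,\lambda+\varepsilon))$. If $\sum_\delta\overline\nu_\delta(\lambda)>0$, then with probability 1 $$\frac{\overline\nu^{(n)}_{\alpha\gamma}(\lambda)}{\sum_{\delta}\overline\nu^{(n)}_{\delta\delta}(\lambda)}\longrightarrow \delta_{\alpha\gamma}\frac{\overline\nu_\alpha(\lambda)}{\sum_\delta\overline\nu_\delta(\lambda)},\qquad \alpha,\gamma=\pm;$$ (canonical) if $\beta\in\mathbb{R}$ is such that $\int e^{-\beta E}\nu_0(dE)<\infty$ and $\int e^{-\beta E}\nu_0^{(n)}(dE)\to\int e^{-\beta E}\nu_0(dE)$, then $\int e^{-\beta\lambda}\nu_\alpha(d\lambda)<\infty$ for $\alpha=\pm$, and with probability 1 $$\frac{\int e^{-\beta\lambda}\nu^{(n)}_{\alpha\gamma}(d\lambda)}{\sum_\delta\int e^{-\beta\lambda}\nu^{(n)}_{\delta\delta}(d\lambda)}\longrightarrow\delta_{\alpha\gamma}\frac{\int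 e^{-\beta\lambda}\nu_\alpha(d\lambda)}{\sum_\delta\int e^{-\beta\lambda}\nu_\delta(d\lambda)},\qquad \alpha,\gamma=\pm .$$ -/

import Mathlib

open MeasureTheory ProbabilityTheory Filter Topology
open scoped ENNReal BoundedContinuousFunction Kronecker

noncomputable section

namespace SpinReservoir

/-- The Pauli matrix `σˣ`. The index `0 : Fin 2` stands for `+`, and `1 : Fin 2` for `-`. -/
def pauliX : Matrix (Fin 2) (Fin 2) ℂ := !![0, 1; 1, 0]

/-- The Pauli matrix `σᶻ`. -/
def pauliZ : Matrix (Fin 2) (Fin 2) ℂ := !![1, 0; 0, -1]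

/-- The sign `α = ±` as a real number: `0 ↦ 1`, `1 ↦ -1`. -/
def sgn (α : Fin 2) : ℝ := if α = 0 then 1 else -1

/-- The opposite sign `-α`. -/
def opp (α : Fin 2) : Fin 2 := if α = 0 then 1 else 0

variable {n : ℕ}

/-- The Hamiltonian `s σᶻ ⊗ 1 + 1 ⊗ h + v σˣ ⊗ w / √n` on `ℂ² ⊗ ℂⁿ`. -/
def hamiltonian (s v : ℝ) (h w : Matrix (Fin n) (Fin n) ℂ) :
    Matrix (Fin 2 × Fin n) (Fin 2 × Fin n) ℂ :=
  (s : ℂ) • (pauliZ ⊗ₖ (1 : Matrix (Fin n) (Fin n) ℂ)) + (1 : Matrix (Fin 2) (Fin 2) ℂ) ⊗ₖ h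
    + ((v / √(n : ℝ) : ℝ) : ℂ) • (pauliX ⊗ₖ w)

/-- The normalized counting measure of the eigenvalues of a Hermitian `n × n` matrix. -/
def countingMeasure {h : Matrix (Fin n) (Fin n) ℂ} (hh : h.IsHermitian) : Measure ℝ :=
  (n : ℝ≥0∞)⁻¹ • ∑ j, Measure.dirac (hh.eigenvalues j)

/-- `w` is a GUE matrix: it is Hermitian, and its diagonal entries and the real and imaginary parts
of its entries above the diagonal are independent centered Gaussian random variables, of variance
`1` on the diagonal and `1/2` off the diagonal. In the family whose independence is required, the
index `(j, k)` with `j ≤ k` labels `Re w j k` and the index `(k, j)` with `j < k` labels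
`Im w j k`. -/
structure IsGUE {Ω : Type*} [MeasurableSpace Ω] (P : Measure Ω)
    (w : Ω → Matrix (Fin n) (Fin n) ℂ) : Prop where
  isHermitian : ∀ ω, (w ω).IsHermitian
  hasLaw_diag : ∀ j, HasLaw (fun ω => (w ω j j).re) (gaussianReal 0 1) P
  hasLaw_re : ∀ j k, j < k → HasLaw (fun ω => (w ω j k).re) (gaussianReal 0 (1 / 2)) P
  hasLaw_im : ∀ j k, j < k → HasLaw (fun ω => (w ω j k).im) (gaussianReal 0 (1 / 2)) P
  indep : iIndepFun (fun (p : Fin n × Fin n) (ω : Ω) =>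
    if p.1 ≤ p.2 then (w ω p.1 p.2).re else (w ω p.2 p.1).im) P

/-- `χ_Δ(H)`, where `χ_Δ` is the indicator of `Δ`: for Hermitian `H`, the spectral projection. -/
def spectralProjection {ι : Type*} [Fintype ι] [DecidableEq ι] (H : Matrix ι ι ℂ) (Δ : Set ℝ) :
    Matrix ι ι ℂ :=
  cfc (Δ.indicator (fun _ => (1 : ℝ))) H

theorem hasSum_spectralProjection {ι : Type*} [Fintype ι] [DecidableEq ι] (H : Matrix ι ι ℂ)
    (f : ℕ → Set ℝ) (hf : Pairwise (Function.onFun Disjoint f)) :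
    HasSum (fun i => spectralProjection H (f i)) (spectralProjection H (⋃ i, f i)) := by
  by_cases hH : H.IsHermitian
  · have key : ∀ x : ℝ, HasSum (fun i => (f i).indicator (fun _ => (1 : ℝ)) x)
        ((⋃ i, f i).indicator (fun _ => (1 : ℝ)) x) := by
      intro x
      by_cases hx : x ∈ ⋃ i, f i
      · obtain ⟨i, hi⟩ := Set.mem_iUnion.1 hx
        rw [Set.indicator_of_mem hx]
        have h1 : (f i).indicator (fun _ => (1 : ℝ)) x = 1 := Set.indicator_of_mem hi _
        have h2 := hasSum_single (f := fun i => (f i).indicator (fun _ => (1 : ℝ)) x) i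
          (fun j hj => Set.indicator_of_notMem
            (fun hxj : x ∈ f j => Set.disjoint_left.1 (hf hj) hxj hi) (fun _ => (1 : ℝ)))
        simp only [h1] at h2
        exact h2
      · rw [Set.indicator_of_notMem hx]
        have h0 : (fun i => (f i).indicator (fun _ => (1 : ℝ)) x) = fun _ => 0 := by
          funext i
          exact Set.indicator_of_notMem (fun hi : x ∈ f i => hx (Set.mem_iUnion.2 ⟨i, hi⟩)) _
        rw [h0]
        exact hasSum_zero
    have hd : HasSum (fun i => Matrix.diagonal
          (fun k => (((f i).indicator (fun _ => (1 : ℝ)) (hH.eigenvalues k) : ℝ) : ℂ)))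
        (Matrix.diagonal (fun k =>
          (((⋃ i, f i).indicator (fun _ => (1 : ℝ)) (hH.eigenvalues k) : ℝ) : ℂ))) := by
      refine HasSum.matrix_diagonal ?_
      rw [Pi.hasSum]
      exact fun k => Complex.hasSum_ofReal.2 (key _)
    have hm := (hd.mul_left (hH.eigenvectorUnitary : Matrix ι ι ℂ)).mul_right
      (star (hH.eigenvectorUnitary : Matrix ι ι ℂ))
    simp only [spectralProjection, hH.cfc_eq, Matrix.IsHermitian.cfc,
      Unitary.conjStarAlgAut_apply]
    exact hm
  · have h0 : ∀ Δ, spectralProjection H Δ = 0 := fun Δ => cfc_apply_of_not_predicate H hH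
    simp only [h0]
    exact hasSum_zero

/-- The entry `ν_{αγ}(Δ) = n⁻¹ ∑ⱼ χ_Δ(H)_{αj,γj}` of the `2 × 2` matrix spectral measure of `H`
(the normalized partial trace of the spectral projections), as a complex measure. -/
def spectralMeasure (H : Matrix (Fin 2 × Fin n) (Fin 2 × Fin n) ℂ) (α γ : Fin 2) :
    ComplexMeasure ℝ where
  measureOf' Δ := by
    classical
    exact if MeasurableSet Δ then (n : ℂ)⁻¹ * ∑ j, spectralProjection H Δ (α, j) (γ, j) else 0
  empty' := by simp [spectralProjection]
  not_measurable' Δ hΔ := by simp [hΔ]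
  m_iUnion' f hf hd := by
    have hs := hasSum_spectralProjection H f hd
    simp only [hf, MeasurableSet.iUnion hf, if_true]
    refine HasSum.mul_left _ (hasSum_sum (fun j _ => ?_))
    exact Pi.hasSum.1 (Pi.hasSum.1 hs (α, j)) (γ, j)

/-- The `2 × 2` matrix `∫ φ dν` of integrals of `φ` against the matrix spectral measure of `H`. -/
def spectralIntegral (H : Matrix (Fin 2 × Fin n) (Fin 2 × Fin n) ℂ) (φ : ℝ → ℝ) :
    Matrix (Fin 2) (Fin 2) ℂ :=
  Matrix.of fun α γ => (spectralMeasure H α γ).integral φ (ContinuousLinearMap.lsmul ℝ ℝ)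

/-- `(2εn)⁻¹ ∑ⱼ χ_ε(λ - H)_{αj,γj}`, with `χ_ε` the indicator of `(-ε, ε)`. -/
def smoothedDensity (ε lam : ℝ) (H : Matrix (Fin 2 × Fin n) (Fin 2 × Fin n) ℂ) :
    Matrix (Fin 2) (Fin 2) ℂ :=
  Matrix.of fun α γ => (2 * (ε : ℂ) * n)⁻¹ *
    ∑ j, spectralProjection ((lam : ℂ) • 1 - H) (Set.Ioo (-ε) ε) (α, j) (γ, j)

/-- The reduced microcanonical distribution of the two-level system. -/
def reducedMicrocanonical (ε lam : ℝ) (H : Matrix (Fin 2 × Fin n) (Fin 2 × Fin n) ℂ) :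
    Matrix (Fin 2) (Fin 2) ℂ :=
  Matrix.of fun α γ => smoothedDensity ε lam H α γ / ∑ δ, smoothedDensity ε lam H δ δ

/-- The reduced canonical distribution of the two-level system at inverse temperature `β`. -/
def reducedCanonical (β : ℝ) (H : Matrix (Fin 2 × Fin n) (Fin 2 × Fin n) ℂ) :
    Matrix (Fin 2) (Fin 2) ℂ :=
  Matrix.of fun α γ => spectralIntegral H (fun x => Real.exp (-β * x)) α γ /
    ∑ δ, spectralIntegral H (fun x => Real.exp (-β * x)) δ δ

/-- `(2ε)⁻¹ ν((λ - ε, λ + ε))`. -/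
def smoothedLimit (ε lam : ℝ) (ν : Measure ℝ) : ℝ :=
  (2 * ε)⁻¹ * ν.real (Set.Ioo (lam - ε) (lam + ε))

/-- The pair `f = (f₊, f₋)` is analytic off the real axis, satisfies `Im f_α(z) Im z > 0` there, and
solves `f_α(z) = ∫ ν₀(dE) / (E + s α - z - v² f_{-α}(z))`. -/
structure IsNevanlinnaSolution (s v : ℝ) (ν₀ : Measure ℝ) (f : Fin 2 → ℂ → ℂ) : Prop where
  analytic : ∀ α, AnalyticOnNhd ℂ (f α) {z | z.im ≠ 0}
  im_mul_im_pos : ∀ α z, z.im ≠ 0 → 0 < (f α z).im * z.im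
  eq_integral : ∀ α z, z.im ≠ 0 →
    f α z = ∫ E : ℝ, 1 / ((E : ℂ) + s * sgn α - z - (v : ℂ) ^ 2 * f (opp α) z) ∂ν₀

/-- The Stieltjes transform of a measure on the line. -/
def stieltjes (ν : Measure ℝ) (z : ℂ) : ℂ := ∫ x : ℝ, 1 / ((x : ℂ) - z) ∂ν

end SpinReservoir

end

noncomputable section

namespace SpinReservoir

/-! ### The Stieltjes transform -/

/-! Everything is read off the resolvent `G = (H - z)⁻¹` through the normalized partial traces
`g_{αγ} = n⁻¹ ∑ⱼ G_{αj,γj}`.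

Three properties of the Gaussian matrix carry the limit. Integration by parts
(`gaussian_integral_mul`) turns the term with `σˣ ⊗ w` in the resolvent identity into products of
partial traces (`IsGUELaw.integral_ptr_mul_pauliX_mul`). The Poincaré inequality
(`gaussian_poincare`) makes the variance of `g_{αγ}` of order `n⁻²` (`IsGUELaw.variance_le`). The
symmetry `w ↦ -w`, implemented by conjugation with `σᶻ`, kills the mean of the off-diagonal traces
(`IsGUELaw.integral_ptr_eq_zero`). Hence the mean diagonal traces satisfy the functional equation,
with the counting measure of `h_n` in place of `ν₀`, up to an error of order `1/n`
(`IsGUELaw.norm_sub_stieltjes_le`). Since the variances are summable, the traces themselves do so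
almost surely, whatever the joint law in `n`.

The functional equation is rigid at each nonreal `z` separately. Taking imaginary parts gives `v⁴ a
b < 1`, where `a` and `b` are the integrals of the squared modulus of the kernel for the two signs,
and Cauchy–Schwarz then shows that two solutions coincide (`IsSolutionAt.unique`). Existence comes
from compactness: along one typical realization the spectral measures are tight and any
subsequential limit solves the equation. By uniqueness the limit is the same for all typical
realizations, so it is not random.

The off-diagonal entries of the matrix measure are complex. They are reached through the positive
spectral measures in the unit directions `u ∈ ℂ²` (`dirMeasure`), whose limits are the mixtures `∑
|u_α|² ν_α`, followed by polarization (`tendsto_of_polarization`).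

Almost surely `‖w_n‖ ≤ 16 √n` eventually (`IsGUELaw.measure_norm_ge_le`), so `H` is a perturbation
of `1 ⊗ h` that is bounded uniformly in `n`. A resolvent estimate transfers tightness from `h` to
`H` (`sum_tailWeight_le`), and Jensen's inequality transfers the uniform integrability of `e^{-βλ}`
(`sum_convex_le`), which is what the canonical distribution needs.

For the density, the argument `z + v² f - αs` stays in the upper half plane, where the transform of
`ν₀` has imaginary part at most `π sup ν₀'`; Stieltjes inversion carries the bound over to `ν_α`.
For the microcanonical distribution the endpoints of the window must be null: an atom of `ν_α` of
mass `m` would force an atom of `ν₀` of mass `m + 1` (`measure_singleton_eq_zero`). -/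

theorem ofReal_sub_ne_zero {a : ℂ} (ha : a.im ≠ 0) (x : ℝ) : (x : ℂ) - a ≠ 0 := by
  intro h
  apply ha
  have := congrArg Complex.im h
  simpa using this

theorem abs_im_le_norm_ofReal_sub (a : ℂ) (x : ℝ) : |a.im| ≤ ‖(x : ℂ) - a‖ := by
  have := Complex.abs_im_le_norm ((x : ℂ) - a)
  simpa using this

theorem norm_kernel_le {a : ℂ} (ha : a.im ≠ 0) (x : ℝ) : ‖1 / ((x : ℂ) - a)‖ ≤ |a.im|⁻¹ := by
  rw [norm_div, norm_one, one_div]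
  exact inv_anti₀ (abs_pos.2 ha) (abs_im_le_norm_ofReal_sub a x)

theorem continuous_kernel {a : ℂ} (ha : a.im ≠ 0) :
    Continuous fun x : ℝ => 1 / ((x : ℂ) - a) :=
  continuous_const.div (by fun_prop) (ofReal_sub_ne_zero ha)

theorem integrable_kernel (ν : Measure ℝ) [IsFiniteMeasure ν] {a : ℂ} (ha : a.im ≠ 0) :
    Integrable (fun x : ℝ => 1 / ((x : ℂ) - a)) ν :=
  Integrable.of_bound (continuous_kernel ha).aestronglyMeasurable |a.im|⁻¹
    (Eventually.of_forall (norm_kernel_le ha))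

/-- The integral `∫ ν(dx) / |x - a|²`. -/
def kernelSq (ν : Measure ℝ) (a : ℂ) : ℝ := ∫ x : ℝ, ‖1 / ((x : ℂ) - a)‖ ^ 2 ∂ν

theorem norm_kernel_sq_le {a : ℂ} (ha : a.im ≠ 0) (x : ℝ) :
    ‖1 / ((x : ℂ) - a)‖ ^ 2 ≤ (|a.im|⁻¹) ^ 2 := by
  gcongr; exact norm_kernel_le ha x

theorem integrable_kernelSq (ν : Measure ℝ) [IsFiniteMeasure ν] {a : ℂ} (ha : a.im ≠ 0) :
    Integrable (fun x : ℝ => ‖1 / ((x : ℂ) - a)‖ ^ 2) ν := by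
  refine Integrable.of_bound (C := (|a.im|⁻¹) ^ 2)
    ((continuous_kernel ha).norm.pow 2).aestronglyMeasurable (Eventually.of_forall fun x => ?_)
  rw [Real.norm_of_nonneg (by positivity)]
  exact norm_kernel_sq_le ha x

theorem kernelSq_nonneg (ν : Measure ℝ) (a : ℂ) : 0 ≤ kernelSq ν a :=
  integral_nonneg fun _ => by positivity

theorem kernelSq_pos (ν : Measure ℝ) [IsProbabilityMeasure ν] {a : ℂ} (ha : a.im ≠ 0) :
    0 < kernelSq ν a := by
  unfold kernelSq
  rw [integral_pos_iff_support_of_nonneg (fun _ => by positivity) (integrable_kernelSq ν ha)]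
  have : Function.support (fun x : ℝ => ‖1 / ((x : ℂ) - a)‖ ^ 2) = Set.univ := by
    ext x
    simp [ofReal_sub_ne_zero ha x]
  rw [this]; simp

theorem kernel_im (a : ℂ) (x : ℝ) :
    (1 / ((x : ℂ) - a)).im = a.im * ‖1 / ((x : ℂ) - a)‖ ^ 2 := by
  rw [one_div, Complex.inv_im, norm_inv, inv_pow, ← Complex.normSq_eq_norm_sq]
  simp [div_eq_mul_inv]

theorem stieltjes_im (ν : Measure ℝ) [IsFiniteMeasure ν] {a : ℂ} (ha : a.im ≠ 0) :
    (stieltjes ν a).im = a.im * kernelSq ν a := by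
  have h := (Complex.imCLM.integral_comp_comm (integrable_kernel ν ha)).symm
  simp only [Complex.imCLM_apply] at h
  rw [stieltjes, h, kernelSq, ← integral_const_mul]
  exact integral_congr_ae (Eventually.of_forall (kernel_im a))

theorem stieltjes_im_mul_pos (ν : Measure ℝ) [IsProbabilityMeasure ν] {z : ℂ} (hz : z.im ≠ 0) :
    0 < (stieltjes ν z).im * z.im := by
  rw [stieltjes_im ν hz]
  have := kernelSq_pos ν hz
  have h2 : 0 < z.im ^ 2 := by positivity
  nlinarith

theorem kernel_sub_kernel {a b : ℂ} (ha : a.im ≠ 0) (hb : b.im ≠ 0) (x : ℝ) :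
    1 / ((x : ℂ) - a) - 1 / ((x : ℂ) - b) =
      (a - b) * (1 / ((x : ℂ) - a) * (1 / ((x : ℂ) - b))) := by
  have h1 := ofReal_sub_ne_zero ha x
  have h2 := ofReal_sub_ne_zero hb x
  field_simp
  ring

theorem stieltjes_sub (ν : Measure ℝ) [IsFiniteMeasure ν] {a b : ℂ} (ha : a.im ≠ 0)
    (hb : b.im ≠ 0) : stieltjes ν a - stieltjes ν b =
      (a - b) * ∫ x : ℝ, 1 / ((x : ℂ) - a) * (1 / ((x : ℂ) - b)) ∂ν := by
  rw [stieltjes, stieltjes, ← integral_sub (integrable_kernel ν ha) (integrable_kernel ν hb),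
    ← integral_const_mul]
  exact integral_congr_ae (Eventually.of_forall (kernel_sub_kernel ha hb))

/-- A Lipschitz bound uniform in the probability measure, for the places where the measure moves
with `n`. -/
theorem norm_stieltjes_sub_le (ν : Measure ℝ) [IsProbabilityMeasure ν] {a b : ℂ} (ha : a.im ≠ 0)
    (hb : b.im ≠ 0) :
    ‖stieltjes ν a - stieltjes ν b‖ ≤ ‖a - b‖ * (|a.im|⁻¹ * |b.im|⁻¹) := by
  rw [stieltjes_sub ν ha hb, norm_mul]
  gcongr
  have := norm_integral_le_of_norm_le_const (μ := ν)
    (f := fun x : ℝ => 1 / ((x : ℂ) - a) * (1 / ((x : ℂ) - b))) (C := |a.im|⁻¹ * |b.im|⁻¹)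
    (Eventually.of_forall fun x => by
      rw [norm_mul]
      gcongr
      · exact norm_kernel_le ha x
      · exact norm_kernel_le hb x)
  simpa using this

/-- Cauchy–Schwarz, from the discriminant of the nonnegative quadratic `t ↦ ∫ (t f - g)²`. -/
theorem integral_mul_sq_le {X : Type*} [MeasurableSpace X] {ν : Measure X} {f g : X → ℝ}
    (hf : Integrable (fun x => f x ^ 2) ν) (hg : Integrable (fun x => g x ^ 2) ν)
    (hfg : Integrable (fun x => f x * g x) ν) :
    (∫ x, f x * g x ∂ν) ^ 2 ≤ (∫ x, f x ^ 2 ∂ν) * ∫ x, g x ^ 2 ∂ν := by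
  have key : ∀ t : ℝ, 0 ≤ (∫ x, f x ^ 2 ∂ν) * (t * t) + (-2 * ∫ x, f x * g x ∂ν) * t
      + ∫ x, g x ^ 2 ∂ν := by
    intro t
    have h0 : 0 ≤ ∫ x, (t * f x - g x) ^ 2 ∂ν := integral_nonneg fun _ => by positivity
    have h1 : ∫ x, (t * f x - g x) ^ 2 ∂ν
        = ∫ x, (t * t) * f x ^ 2 + ((-2 * t) * (f x * g x) + g x ^ 2) ∂ν := by
      congr 1; ext x; ring
    rw [h1, integral_add (hf.const_mul _) (by exact (hfg.const_mul _).add hg),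
      integral_add (hfg.const_mul _) hg, integral_const_mul, integral_const_mul] at h0
    linarith
  have := discrim_le_zero key
  unfold discrim at this
  nlinarith

/-- Cauchy–Schwarz keeps the integrals `kernelSq`, which the imaginary parts of a solution control
exactly; the cruder bound by `|Im a|⁻¹ |Im b|⁻¹` would not give uniqueness for all `z`. -/
theorem norm_stieltjes_sub_sq_le (ν : Measure ℝ) [IsFiniteMeasure ν] {a b : ℂ}
    (ha : a.im ≠ 0) (hb : b.im ≠ 0) :
    ‖stieltjes ν a - stieltjes ν b‖ ^ 2 ≤ ‖a - b‖ ^ 2 * (kernelSq ν a * kernelSq ν b) := by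
  rw [stieltjes_sub ν ha hb, norm_mul, mul_pow]
  gcongr
  have h1 : ‖∫ x : ℝ, 1 / ((x : ℂ) - a) * (1 / ((x : ℂ) - b)) ∂ν‖
      ≤ ∫ x : ℝ, ‖1 / ((x : ℂ) - a)‖ * ‖1 / ((x : ℂ) - b)‖ ∂ν := by
    refine (norm_integral_le_integral_norm _).trans_eq ?_
    simp only [norm_mul]
  have hi : Integrable (fun x : ℝ => ‖1 / ((x : ℂ) - a)‖ * ‖1 / ((x : ℂ) - b)‖) ν := by
    refine Integrable.of_bound (C := |a.im|⁻¹ * |b.im|⁻¹)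
      ((continuous_kernel ha).norm.mul (continuous_kernel hb).norm).aestronglyMeasurable
      (Eventually.of_forall fun x => ?_)
    rw [Real.norm_of_nonneg (by positivity)]
    gcongr
    · exact norm_kernel_le ha x
    · exact norm_kernel_le hb x
  calc _ ≤ (∫ x : ℝ, ‖1 / ((x : ℂ) - a)‖ * ‖1 / ((x : ℂ) - b)‖ ∂ν) ^ 2 := by gcongr
    _ ≤ _ := integral_mul_sq_le (integrable_kernelSq ν ha) (integrable_kernelSq ν hb) hi

theorem isOpen_im_ne_zero : IsOpen {z : ℂ | z.im ≠ 0} :=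
  isOpen_ne_fun Complex.continuous_im continuous_const

theorem stieltjes_eq_resolventTransform (ν : Measure ℝ) :
    stieltjes ν = resolventTransform ν := by
  funext z
  simp [stieltjes, resolventTransform_apply, resolvent]

theorem analyticOnNhd_stieltjes (ν : Measure ℝ) [IsFiniteMeasure ν] :
    AnalyticOnNhd ℂ (stieltjes ν) {z | z.im ≠ 0} := by
  refine DifferentiableOn.analyticOnNhd (fun z hz => ?_) isOpen_im_ne_zero
  rw [stieltjes_eq_resolventTransform]
  refine (hasDerivAt_resolventTransform z ?_).differentiableAt.differentiableWithinAt
  rintro ⟨x, -, rfl⟩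
  simp at hz

theorem continuousOn_stieltjes (ν : Measure ℝ) [IsFiniteMeasure ν] :
    ContinuousOn (stieltjes ν) {z | z.im ≠ 0} :=
  (analyticOnNhd_stieltjes ν).continuousOn

/-! ### Uniqueness of the solution of the functional equation -/

/-- The argument `z + v² ζ - s α` at which the transform of `ν₀` is taken. -/
def subordinate (s v : ℝ) (α : Fin 2) (z ζ : ℂ) : ℂ := z + (v : ℂ) ^ 2 * ζ - s * sgn α

theorem subordinate_im (s v : ℝ) (α : Fin 2) (z ζ : ℂ) :
    (subordinate s v α z ζ).im = z.im + v ^ 2 * ζ.im := by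
  have : ((v : ℂ) ^ 2) = ((v ^ 2 : ℝ) : ℂ) := by push_cast; ring
  rw [subordinate, this, Complex.sub_im, Complex.add_im, Complex.im_ofReal_mul]
  simp

/-- Adding `v² ζ` with `Im ζ` of the same sign as `Im z` only moves the argument away from the real
axis. -/
theorem abs_im_le_subordinate_im (s v : ℝ) (α : Fin 2) {z ζ : ℂ} (h : 0 ≤ ζ.im * z.im) :
    |z.im| ≤ |(subordinate s v α z ζ).im| := by
  rw [subordinate_im]
  apply sq_le_sq.1
  nlinarith [mul_nonneg (sq_nonneg v) h, sq_nonneg (v ^ 2 * ζ.im)]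

theorem subordinate_im_ne_zero (s v : ℝ) (α : Fin 2) {z ζ : ℂ} (hz : z.im ≠ 0)
    (h : 0 ≤ ζ.im * z.im) : (subordinate s v α z ζ).im ≠ 0 :=
  abs_pos.1 ((abs_pos.2 hz).trans_le (abs_im_le_subordinate_im s v α h))

theorem integral_eq_stieltjes (s v : ℝ) (α : Fin 2) (z ζ : ℂ) (ν : Measure ℝ) :
    ∫ E : ℝ, 1 / ((E : ℂ) + s * sgn α - z - (v : ℂ) ^ 2 * ζ) ∂ν
      = stieltjes ν (subordinate s v α z ζ) := by
  unfold stieltjes subordinate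
  congr 1; ext E; congr 1; ring

theorem opp_zero : opp 0 = 1 := rfl
theorem opp_one : opp 1 = 0 := rfl
theorem opp_opp (α : Fin 2) : opp (opp α) = α := by fin_cases α <;> rfl

/-- `p` solves the functional equation at the point `z`. -/
structure IsSolutionAt (s v : ℝ) (ν₀ : Measure ℝ) (z : ℂ) (p : Fin 2 → ℂ) : Prop where
  im_pos : ∀ α, 0 < (p α).im * z.im
  eq : ∀ α, p α = stieltjes ν₀ (subordinate s v α z (p (opp α)))

variable {s v : ℝ} {ν₀ : Measure ℝ} {z : ℂ} {p q : Fin 2 → ℂ}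

theorem IsNevanlinnaSolution.isSolutionAt {f : Fin 2 → ℂ → ℂ}
    (hf : IsNevanlinnaSolution s v ν₀ f) (hz : z.im ≠ 0) :
    IsSolutionAt s v ν₀ z (fun α => f α z) where
  im_pos α := hf.im_mul_im_pos α z hz
  eq α := by rw [← integral_eq_stieltjes]; exact hf.eq_integral α z hz

variable [IsProbabilityMeasure ν₀]

theorem IsSolutionAt.im_eq (h : IsSolutionAt s v ν₀ z p) (hz : z.im ≠ 0) (α : Fin 2) :
    (p α).im = (z.im + v ^ 2 * (p (opp α)).im)
      * kernelSq ν₀ (subordinate s v α z (p (opp α))) := by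
  conv_lhs => rw [h.eq α]
  rw [stieltjes_im ν₀ (subordinate_im_ne_zero s v α hz (h.im_pos _).le), subordinate_im]

/-- With `x = Im p₀ Im z` and `y = Im p₁ Im z`, the imaginary parts of the two equations read `x =
(Im z² + v² y) a` and `y = (Im z² + v² x) b`. Eliminating `y` leaves `x (1 - v⁴ a b)` equal to a
positive quantity, and `x > 0`. -/
theorem IsSolutionAt.kernelSq_mul_lt (h : IsSolutionAt s v ν₀ z p) (hz : z.im ≠ 0) :
    v ^ 4 * (kernelSq ν₀ (subordinate s v 0 z (p 1)) * kernelSq ν₀ (subordinate s v 1 z (p 0)))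
      < 1 := by
  have h0 := h.im_eq hz 0
  have h1 := h.im_eq hz 1
  rw [opp_zero] at h0
  rw [opp_one] at h1
  have A := kernelSq_pos ν₀ (subordinate_im_ne_zero s v 0 hz (h.im_pos 1).le)
  have B := kernelSq_pos ν₀ (subordinate_im_ne_zero s v 1 hz (h.im_pos 0).le)
  set a := kernelSq ν₀ (subordinate s v 0 z (p 1))
  set b := kernelSq ν₀ (subordinate s v 1 z (p 0))
  have P0 := h.im_pos 0
  have P1 := h.im_pos 1
  have hy : 0 < z.im ^ 2 := by positivity
  have e0 : (p 0).im * z.im = (z.im ^ 2 + v ^ 2 * ((p 1).im * z.im)) * a := by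
    rw [h0]; ring
  have e1 : (p 1).im * z.im = (z.im ^ 2 + v ^ 2 * ((p 0).im * z.im)) * b := by
    conv_lhs => rw [h1]
    ring
  set x := (p 0).im * z.im
  set y := (p 1).im * z.im
  have hx : x * (1 - v ^ 4 * (a * b)) = z.im ^ 2 * a + v ^ 2 * z.im ^ 2 * b * a := by
    have : x = (z.im ^ 2 + v ^ 2 * ((z.im ^ 2 + v ^ 2 * x) * b)) * a := by rw [← e1]; exact e0
    linear_combination this
  have hpos : 0 < x * (1 - v ^ 4 * (a * b)) := by rw [hx]; positivity
  have := pos_of_mul_pos_right hpos P0.le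
  linarith

/-- The two equations bound `|p₀ - q₀|²` by `|p₁ - q₁|²` and conversely. Composing the bounds gives
the factor `(v⁴ a b)(v⁴ a' b')`, where the two brackets belong to `p` and to `q` and are each less
than one. -/
theorem IsSolutionAt.unique (hp : IsSolutionAt s v ν₀ z p) (hq : IsSolutionAt s v ν₀ z q)
    (hz : z.im ≠ 0) : p = q := by
  have hd : ∀ α, ‖p α - q α‖ ^ 2 ≤ v ^ 4 * ‖p (opp α) - q (opp α)‖ ^ 2 *
      (kernelSq ν₀ (subordinate s v α z (p (opp α)))
        * kernelSq ν₀ (subordinate s v α z (q (opp α)))) := by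
    intro α
    conv_lhs => rw [hp.eq α, hq.eq α]
    refine (norm_stieltjes_sub_sq_le ν₀ (subordinate_im_ne_zero s v α hz (hp.im_pos _).le)
      (subordinate_im_ne_zero s v α hz (hq.im_pos _).le)).trans_eq ?_
    have : subordinate s v α z (p (opp α)) - subordinate s v α z (q (opp α))
        = (v : ℂ) ^ 2 * (p (opp α) - q (opp α)) := by unfold subordinate; ring
    rw [this, norm_mul, norm_pow, Complex.norm_real, mul_pow, ← pow_mul,
      Real.norm_eq_abs, Even.pow_abs (by decide : Even (2 * 2)) v]
  have h0 := hd 0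
  have h1 := hd 1
  rw [opp_zero] at h0
  rw [opp_one] at h1
  have kp := hp.kernelSq_mul_lt hz
  have kq := hq.kernelSq_mul_lt hz
  have n1 := kernelSq_nonneg ν₀ (subordinate s v 0 z (p 1))
  have n2 := kernelSq_nonneg ν₀ (subordinate s v 0 z (q 1))
  have n3 := kernelSq_nonneg ν₀ (subordinate s v 1 z (p 0))
  have n4 := kernelSq_nonneg ν₀ (subordinate s v 1 z (q 0))
  set a := kernelSq ν₀ (subordinate s v 0 z (p 1))
  set a' := kernelSq ν₀ (subordinate s v 0 z (q 1))
  set b := kernelSq ν₀ (subordinate s v 1 z (p 0))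
  set b' := kernelSq ν₀ (subordinate s v 1 z (q 0))
  set x := ‖p 0 - q 0‖ ^ 2 with hxdef
  set y := ‖p 1 - q 1‖ ^ 2 with hydef
  have hx0 : 0 ≤ x := by positivity
  have hy0 : 0 ≤ y := by positivity
  have hc : v ^ 4 * (a * b) * (v ^ 4 * (a' * b')) < 1 :=
    mul_lt_one_of_nonneg_of_lt_one_left (by positivity) kp kq.le
  have hx : x = 0 := by
    have : x ≤ v ^ 4 * (a * b) * (v ^ 4 * (a' * b')) * x := by
      calc x ≤ v ^ 4 * y * (a * a') := h0
        _ ≤ v ^ 4 * (v ^ 4 * x * (b * b')) * (a * a') := by gcongr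
        _ = _ := by ring
    by_contra hne
    have hpos : 0 < x := lt_of_le_of_ne hx0 (Ne.symm hne)
    nlinarith
  have hy : y = 0 := by
    rw [hx] at h1
    have : y ≤ 0 := by simpa using h1
    linarith
  funext α
  fin_cases α
  · have : ‖p 0 - q 0‖ = 0 := by simpa [hxdef] using hx
    exact sub_eq_zero.1 (norm_eq_zero.1 this)
  · have : ‖p 1 - q 1‖ = 0 := by simpa [hydef] using hy
    exact sub_eq_zero.1 (norm_eq_zero.1 this)

end SpinReservoir

end

noncomputable section

namespace SpinReservoir

/-! ### Inversion of the Stieltjes transform -/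

theorem kernel_im_eq (l x : ℝ) (η : ℝ) :
    (1 / ((l : ℂ) - (x + η * Complex.I))).im = η / ((l - x) ^ 2 + η ^ 2) := by
  rw [one_div, Complex.inv_im, Complex.normSq_apply]
  simp [sq]

/-- The substitution `x = l + η u` moves the dependence on `η` out of the kernel and into `φ`, where
continuity handles `η → 0`. -/
theorem integral_mul_poisson (φ : ℝ → ℝ) (l : ℝ) {η : ℝ} (hη : 0 < η) :
    ∫ x, φ x * (η / ((l - x) ^ 2 + η ^ 2)) = ∫ u, φ (l + η * u) * (1 + u ^ 2)⁻¹ := by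
  set g : ℝ → ℝ := fun x => φ x * (η / ((l - x) ^ 2 + η ^ 2)) with hg
  have h1 : ∫ u, g (l + η * u) = |η⁻¹| • ∫ x, g (l + x) :=
    Measure.integral_comp_mul_left (fun x => g (l + x)) η
  rw [integral_add_left_eq_self g l, abs_of_pos (inv_pos.2 hη), smul_eq_mul] at h1
  have h2 : ∫ x, g x = η * ∫ u, g (l + η * u) := by
    rw [h1, ← mul_assoc, mul_inv_cancel₀ hη.ne', one_mul]
  rw [h2, ← integral_const_mul]
  congr 1; ext u
  have : (1 + u ^ 2) ≠ 0 := by positivity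
  simp only [hg]
  have e : (l - (l + η * u)) ^ 2 + η ^ 2 = η ^ 2 * (1 + u ^ 2) := by ring
  rw [e]
  field_simp

theorem integral_poisson (l : ℝ) {η : ℝ} (hη : 0 < η) :
    ∫ x, η / ((l - x) ^ 2 + η ^ 2) = Real.pi := by
  have := integral_mul_poisson (fun _ => 1) l hη
  simp only [one_mul] at this
  rw [this, integral_univ_inv_one_add_sq]

theorem tendsto_integral_poisson (ν : Measure ℝ) [IsFiniteMeasure ν] {φ : ℝ → ℝ}
    (hφ : Continuous φ) {C : ℝ} (hC : ∀ x, |φ x| ≤ C) :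
    Tendsto (fun η : ℝ => ∫ q : ℝ × ℝ, φ (q.1 + η * q.2) * (1 + q.2 ^ 2)⁻¹ ∂(ν.prod volume))
      (𝓝[>] 0) (𝓝 (Real.pi * ∫ x, φ x ∂ν)) := by
  have hlim : Real.pi * ∫ x, φ x ∂ν
      = ∫ q : ℝ × ℝ, φ q.1 * (1 + q.2 ^ 2)⁻¹ ∂(ν.prod volume) := by
    rw [integral_prod_mul (fun x => φ x) (fun u : ℝ => (1 + u ^ 2)⁻¹),
      integral_univ_inv_one_add_sq, mul_comm]
  have hcont : Continuous fun q : ℝ × ℝ => (1 + q.2 ^ 2)⁻¹ :=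
    Continuous.inv₀ (by fun_prop) fun q => by positivity
  rw [hlim]
  refine tendsto_integral_filter_of_dominated_convergence
    (fun q : ℝ × ℝ => C * (1 + q.2 ^ 2)⁻¹) ?_ ?_ ?_ ?_
  · exact Eventually.of_forall fun η =>
      ((hφ.comp (by fun_prop)).mul hcont).aestronglyMeasurable
  · refine Eventually.of_forall fun η => Eventually.of_forall fun q => ?_
    rw [norm_mul, Real.norm_eq_abs, Real.norm_of_nonneg (by positivity : 0 ≤ (1 + q.2 ^ 2)⁻¹)]
    gcongr
    exact hC _
  · exact (Integrable.mul_prod (integrable_const C) integrable_inv_one_add_sq)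
  · refine Eventually.of_forall fun q => ?_
    refine Tendsto.mul_const _ ?_
    have : Tendsto (fun η : ℝ => φ (q.1 + η * q.2)) (𝓝 0) (𝓝 (φ (q.1 + 0 * q.2))) :=
      (Continuous.tendsto (by fun_prop) 0)
    rw [zero_mul, add_zero] at this
    exact this.mono_left nhdsWithin_le_nhds

theorem integral_mul_stieltjes_im (ν : Measure ℝ) [IsFiniteMeasure ν] {φ : ℝ → ℝ}
    (hφ : Continuous φ) (hs : HasCompactSupport φ) {η : ℝ} (hη : 0 < η) :
    ∫ x : ℝ, φ x * (stieltjes ν (x + η * Complex.I)).im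
      = ∫ q : ℝ × ℝ, φ (q.1 + η * q.2) * (1 + q.2 ^ 2)⁻¹ ∂(ν.prod volume) := by
  obtain ⟨C, hC⟩ := hs.exists_bound_of_continuous hφ
  have hcont : Continuous fun q : ℝ × ℝ => (1 + q.2 ^ 2)⁻¹ :=
    Continuous.inv₀ (by fun_prop) fun q => by positivity
  have hi2 : Integrable (fun q : ℝ × ℝ => φ (q.1 + η * q.2) * (1 + q.2 ^ 2)⁻¹)
      (ν.prod volume) := by
    refine Integrable.mono' (Integrable.mul_prod (integrable_const C) integrable_inv_one_add_sq)
      ((hφ.comp (by fun_prop)).mul hcont).aestronglyMeasurable (Eventually.of_forall fun q => ?_)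
    rw [norm_mul, Real.norm_of_nonneg (by positivity : 0 ≤ (1 + q.2 ^ 2)⁻¹)]
    gcongr
    exact hC _
  rw [integral_prod _ hi2]
  have hne : ∀ x : ℝ, (x + η * Complex.I : ℂ).im ≠ 0 := fun x => by simpa using hη.ne'
  have h1 : ∀ x : ℝ, φ x * (stieltjes ν (x + η * Complex.I)).im
      = ∫ l, φ x * (η / ((l - x) ^ 2 + η ^ 2)) ∂ν := by
    intro x
    have h := (Complex.imCLM.integral_comp_comm (integrable_kernel ν (hne x))).symm
    simp only [Complex.imCLM_apply] at h
    rw [stieltjes, h, integral_const_mul]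
    simp only [kernel_im_eq]
  simp only [h1]
  rw [integral_integral_swap]
  · congr 1; ext l
    exact integral_mul_poisson φ l hη
  · have hb : Integrable (fun q : ℝ × ℝ => ‖φ q.1‖ * η⁻¹) (volume.prod ν) :=
      Integrable.mul_prod (hφ.integrable_of_hasCompactSupport hs).norm (integrable_const _)
    refine Integrable.mono' hb ?_ (Eventually.of_forall fun q => ?_)
    · refine Continuous.aestronglyMeasurable ((hφ.comp continuous_fst).mul ?_)
      exact continuous_const.div (by fun_prop) fun q => by positivity
    · simp only [Function.uncurry]
      rw [norm_mul]
      gcongr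
      rw [Real.norm_of_nonneg (by positivity), div_le_iff₀ (by positivity), inv_mul_eq_div,
        le_div_iff₀ hη]
      nlinarith [sq_nonneg (q.2 - q.1)]

theorem tendsto_integral_mul_stieltjes_im (ν : Measure ℝ) [IsFiniteMeasure ν] {φ : ℝ → ℝ}
    (hφ : Continuous φ) (hs : HasCompactSupport φ) :
    Tendsto (fun η : ℝ => ∫ x : ℝ, φ x * (stieltjes ν (x + η * Complex.I)).im)
      (𝓝[>] 0) (𝓝 (Real.pi * ∫ x, φ x ∂ν)) := by
  obtain ⟨C, hC⟩ := hs.exists_bound_of_continuous hφ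
  refine (tendsto_integral_poisson ν hφ hC).congr' ?_
  filter_upwards [self_mem_nhdsWithin] with η hη
  exact (integral_mul_stieltjes_im ν hφ hs hη).symm

/-- Stieltjes inversion recovers the integrals of compactly supported continuous functions from
boundary values of the imaginary part. -/
theorem ext_of_stieltjes {μ ν : Measure ℝ} [IsFiniteMeasure μ] [IsFiniteMeasure ν]
    (h : ∀ z : ℂ, 0 < z.im → stieltjes μ z = stieltjes ν z) : μ = ν := by
  refine Measure.ext_of_integral_eq_on_compactlySupported fun φ => ?_
  have h1 := tendsto_integral_mul_stieltjes_im μ φ.continuous φ.hasCompactSupport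
  have h2 := tendsto_integral_mul_stieltjes_im ν φ.continuous φ.hasCompactSupport
  have h3 := tendsto_nhds_unique (h1.congr' ?_) h2
  · exact mul_left_cancel₀ Real.pi_ne_zero h3
  · filter_upwards [self_mem_nhdsWithin] with η hη
    congr 1; ext x
    rw [h]
    simpa using hη

/-! ### Boundedness of the density -/

/-- The imaginary part is a Poisson integral, and the Poisson kernel has Lebesgue integral `π` at
every height. -/
theorem stieltjes_im_le_of_le {ν₀ : Measure ℝ} [IsFiniteMeasure ν₀] {M : ℝ≥0∞} (hM : M ≠ ∞)
    (h : ν₀ ≤ M • volume) {a : ℂ} (ha : 0 < a.im) :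
    (stieltjes ν₀ a).im ≤ M.toReal * Real.pi := by
  have e : ∀ x : ℝ, (1 / ((x : ℂ) - a)).im = a.im / ((a.re - x) ^ 2 + a.im ^ 2) := by
    intro x
    have := kernel_im_eq x a.re a.im
    rw [Complex.re_add_im] at this
    rw [this]; ring
  have h0 := (Complex.imCLM.integral_comp_comm (integrable_kernel ν₀ ha.ne')).symm
  simp only [Complex.imCLM_apply] at h0
  rw [stieltjes, h0]
  simp only [e]
  -- The Bochner integral of a non-integrable function is `0` by convention, whereas this one is
  -- already known to be `π`.
  have hint : Integrable (fun x : ℝ => a.im / ((a.re - x) ^ 2 + a.im ^ 2)) volume := by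
    by_contra hn
    have := integral_poisson a.re ha
    rw [integral_undef hn] at this
    exact Real.pi_ne_zero this.symm
  calc ∫ x : ℝ, a.im / ((a.re - x) ^ 2 + a.im ^ 2) ∂ν₀
      ≤ ∫ x : ℝ, a.im / ((a.re - x) ^ 2 + a.im ^ 2) ∂(M • volume) :=
        integral_mono_measure h (Eventually.of_forall fun x => by positivity)
          (hint.smul_measure hM)
    _ = _ := by rw [integral_smul_measure, integral_poisson a.re ha, smul_eq_mul]

/-- Inversion against nonnegative test functions gives `∫ φ dν ≤ M ∫ φ`; regularity of both measures
passes from test functions to sets. -/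
theorem le_smul_volume_of_stieltjes_im_le {ν : Measure ℝ} [IsFiniteMeasure ν] {M : ℝ≥0∞}
    (hM : M ≠ ∞) (h : ∀ z : ℂ, 0 < z.im → (stieltjes ν z).im ≤ M.toReal * Real.pi) :
    ν ≤ M • volume := by
  have key : ∀ φ : ℝ → ℝ, Continuous φ → HasCompactSupport φ → (∀ x, 0 ≤ φ x) →
      ∫ x, φ x ∂ν ≤ M.toReal * ∫ x, φ x := by
    intro φ hφ hs h0
    have hφi := hφ.integrable_of_hasCompactSupport (μ := volume) hs
    have hl := tendsto_integral_mul_stieltjes_im ν hφ hs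
    have : Real.pi * ∫ x, φ x ∂ν ≤ Real.pi * (M.toReal * ∫ x, φ x) := by
      refine le_of_tendsto hl ?_
      filter_upwards [self_mem_nhdsWithin] with η hη
      rw [← integral_const_mul, ← integral_const_mul]
      refine integral_mono_of_nonneg (Eventually.of_forall fun x => ?_)
        ((hφi.const_mul _).const_mul _) (Eventually.of_forall fun x => ?_)
      · refine mul_nonneg (h0 x) ?_
        have hz : (x + η * Complex.I : ℂ).im = η := by simp
        rw [stieltjes_im ν (by rw [hz]; exact (ne_of_gt hη)), hz]
        exact mul_nonneg (le_of_lt hη) (kernelSq_nonneg _ _)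
      · have := h (x + η * Complex.I) (by simpa using hη)
        calc φ x * (stieltjes ν (x + η * Complex.I)).im ≤ φ x * (M.toReal * Real.pi) := by
              gcongr; exact h0 x
          _ = _ := by ring
    exact le_of_mul_le_mul_left this Real.pi_pos
  -- A Urysohn function between `K` and `U` compares the two measures; inner regularity of `ν` and
  -- outer regularity of Lebesgue measure then reduce the general case to this one.
  have hK : ∀ K U : Set ℝ, IsCompact K → IsOpen U → K ⊆ U → ν K ≤ M * volume U := by
    intro K U hKc hU hKU
    obtain ⟨f, hf1, hf0, hfs, hf⟩ := exists_continuous_one_zero_of_isCompact hKc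
      hU.isClosed_compl (Set.disjoint_compl_right_iff_subset.2 hKU)
    have h1 : ν K ≤ ENNReal.ofReal (∫ x, f x ∂ν) := by
      rw [ofReal_integral_eq_lintegral_ofReal (f.continuous.integrable_of_hasCompactSupport hfs)
        (Eventually.of_forall fun x => (hf x).1), ← lintegral_indicator_one hKc.measurableSet]
      refine lintegral_mono fun x => ?_
      by_cases hx : x ∈ K
      · simp [hx, hf1 hx]
      · simp [hx]
    refine h1.trans ((ENNReal.ofReal_le_ofReal
      (key f f.continuous hfs (fun x => (hf x).1))).trans ?_)
    rw [ENNReal.ofReal_mul ENNReal.toReal_nonneg, ENNReal.ofReal_toReal hM]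
    gcongr
    rw [ofReal_integral_eq_lintegral_ofReal (f.continuous.integrable_of_hasCompactSupport hfs)
      (Eventually.of_forall fun x => (hf x).1), ← lintegral_indicator_one hU.measurableSet]
    refine lintegral_mono fun x => ?_
    by_cases hx : x ∈ U
    · simpa [hx] using ENNReal.ofReal_le_one.2 (hf x).2
    · simp [hx, hf0 hx]
  refine Measure.le_iff.2 fun S hS => ?_
  rw [Measure.smul_apply, smul_eq_mul, hS.measure_eq_iSup_isCompact_of_ne_top (measure_ne_top ν S)]
  refine iSup₂_le fun K hKS => iSup_le fun hKc => ?_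
  have hl : Tendsto (fun ε : ℝ≥0∞ => M * (volume S + ε)) (𝓝[>] 0) (𝓝 (M * (volume S + 0))) :=
    (ENNReal.Tendsto.const_mul (tendsto_const_nhds.add tendsto_id) (Or.inr hM)).mono_left
      nhdsWithin_le_nhds
  rw [add_zero] at hl
  refine ge_of_tendsto hl ?_
  filter_upwards [self_mem_nhdsWithin] with ε hε
  obtain ⟨U, hSU, hU, hUε⟩ := S.exists_isOpen_le_add volume (ne_of_gt hε)
  exact (hK K U hKc hU (hKS.trans hSU)).trans (by gcongr)

/-- The functional equation evaluates the transform of `ν₀` at a point still in the upper half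
plane, so the bound on its imaginary part is inherited with the same constant. -/
theorem le_smul_volume_of_isSolutionAt {s v : ℝ} {ν₀ : Measure ℝ} [IsProbabilityMeasure ν₀]
    {ν : Fin 2 → Measure ℝ} [∀ α, IsProbabilityMeasure (ν α)]
    (h : ∀ z : ℂ, z.im ≠ 0 → IsSolutionAt s v ν₀ z fun α => stieltjes (ν α) z)
    {M : ℝ≥0∞} (hM : M ≠ ∞) (hν₀ : ν₀ ≤ M • volume) (α : Fin 2) : ν α ≤ M • volume := by
  refine le_smul_volume_of_stieltjes_im_le hM fun z hz => ?_
  rw [(h z hz.ne').eq α]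
  refine stieltjes_im_le_of_le hM hν₀ ?_
  rw [subordinate_im]
  have := pos_of_mul_pos_left ((h z hz.ne').im_pos (opp α)) hz.le
  positivity

theorem density_bound {s v : ℝ} {ν₀ : Measure ℝ} [IsProbabilityMeasure ν₀]
    {ν : Fin 2 → Measure ℝ} [∀ α, IsProbabilityMeasure (ν α)]
    (h : ∀ z : ℂ, z.im ≠ 0 → IsSolutionAt s v ν₀ z fun α => stieltjes (ν α) z)
    (hac : ν₀ ≪ volume) (hM : essSup (ν₀.rnDeriv volume) volume < ∞) (α : Fin 2) :
    ν α ≪ volume ∧ ∀ᵐ x, (ν α).rnDeriv volume x ≤ essSup (ν₀.rnDeriv volume) volume := by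
  set M := essSup (ν₀.rnDeriv volume) volume
  have h0 : ν₀ ≤ M • volume := by
    rw [← Measure.withDensity_rnDeriv_eq ν₀ volume hac, ← withDensity_const]
    exact withDensity_mono (ENNReal.ae_le_essSup _)
  have h1 := le_smul_volume_of_isSolutionAt h hM.ne h0 α
  have hac1 : ν α ≪ volume :=
    (Measure.absolutelyContinuous_of_le h1).trans (Measure.smul_absolutelyContinuous)
  refine ⟨hac1, ?_⟩
  refine ae_le_of_forall_setLIntegral_le_of_sigmaFinite (Measure.measurable_rnDeriv _ _) ?_
  intro S hS _
  rw [Measure.setLIntegral_rnDeriv hac1, setLIntegral_const]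
  exact h1 S

/-! ### Absence of atoms -/

/-- Since `|x - (l + η κ)| ≥ η Im κ ≥ η`, the integrand is dominated by `1`; it tends to `-1/κ₀` at
`x = l` and to `0` elsewhere. The direction `κ` may vary with `η` because the argument produced by
the functional equation does not approach the axis vertically. -/
theorem tendsto_mul_stieltjes (ν : Measure ℝ) [IsFiniteMeasure ν] (l : ℝ) {κ : ℝ → ℂ} {κ₀ : ℂ}
    (hκ : Tendsto κ (𝓝[>] 0) (𝓝 κ₀)) (him : ∀ᶠ η in 𝓝[>] 0, 1 ≤ (κ η).im) :
    Tendsto (fun η : ℝ => (η : ℂ) * stieltjes ν (l + η * κ η)) (𝓝[>] 0)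
      (𝓝 (-κ₀⁻¹ * ν.real {l})) := by
  have h0 : 1 ≤ κ₀.im := ge_of_tendsto ((Complex.continuous_im.tendsto _).comp hκ) him
  have hκ0 : κ₀ ≠ 0 := by rintro rfl; simp at h0; linarith
  have e : (-κ₀⁻¹ * ν.real {l} : ℂ) = ∫ x, ({l} : Set ℝ).indicator (fun _ => -κ₀⁻¹) x ∂ν := by
    rw [integral_indicator_const _ (measurableSet_singleton l), Complex.real_smul, mul_comm]
  have e2 : ∀ η : ℝ, (η : ℂ) * stieltjes ν (l + η * κ η)
      = ∫ x : ℝ, (η : ℂ) * (1 / ((x : ℂ) - (l + η * κ η))) ∂ν := fun η => by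
    rw [stieltjes, integral_const_mul]
  rw [e]
  simp only [e2]
  refine tendsto_integral_filter_of_dominated_convergence (fun _ => 1) ?_ ?_
    (integrable_const _) ?_
  · filter_upwards [self_mem_nhdsWithin, him] with η hη hk
    have : (l + η * κ η : ℂ).im ≠ 0 := by
      have : 0 < η * (κ η).im := mul_pos hη (by linarith)
      simpa using this.ne'
    exact ((continuous_kernel this).const_mul _).aestronglyMeasurable
  · filter_upwards [self_mem_nhdsWithin, him] with η hη hk
    refine Eventually.of_forall fun x => ?_
    have hη : 0 < η := hη
    have h1 : (l + η * κ η : ℂ).im = η * (κ η).im := by simp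
    have h2 : 0 < η * (κ η).im := mul_pos hη (by linarith)
    rw [norm_mul, Complex.norm_real, Real.norm_of_nonneg hη.le]
    have := norm_kernel_le (a := l + η * κ η) (by rw [h1]; exact h2.ne') x
    rw [h1, abs_of_pos h2] at this
    calc η * _ ≤ η * (η * (κ η).im)⁻¹ := by gcongr
      _ = ((κ η).im)⁻¹ := by field_simp
      _ ≤ 1 := inv_le_one_of_one_le₀ hk
  · refine Eventually.of_forall fun x => ?_
    by_cases hx : x = l
    · subst hx
      simp only [Set.mem_singleton_iff, Set.indicator_of_mem]
      refine (hκ.inv₀ hκ0).neg.congr' ?_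
      filter_upwards [self_mem_nhdsWithin] with η hη
      have : (η : ℂ) ≠ 0 := by exact_mod_cast (ne_of_gt hη)
      rw [sub_add_cancel_left, one_div, inv_neg, mul_inv, mul_neg, ← mul_assoc,
        mul_inv_cancel₀ this, one_mul]
    · rw [Set.indicator_of_notMem (by simpa using hx)]
      have hη0 : Tendsto (fun η : ℝ => (η : ℂ)) (𝓝[>] 0) (𝓝 0) :=
        (Complex.continuous_ofReal.tendsto' 0 0 (by simp)).mono_left nhdsWithin_le_nhds
      have h1 : Tendsto (fun η : ℝ => (x : ℂ) - (l + η * κ η)) (𝓝[>] 0)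
          (𝓝 ((x : ℂ) - (l + 0 * κ₀))) :=
        tendsto_const_nhds.sub (tendsto_const_nhds.add (hη0.mul hκ))
      have hne : (x : ℂ) - (l + 0 * κ₀) ≠ 0 := by
        rw [zero_mul, add_zero, sub_ne_zero]; exact_mod_cast hx
      have := hη0.mul (h1.inv₀ hne)
      simpa [one_div] using this

/-- Let `m > 0` be the mass of `ν_α` at `l`. Then `f_α(l + iη) ~ i m / η` blows up, so the equation
for `-α` gives `f_{-α} ~ -1/(v² f_α)`, of order `η`. In the equation for `α` the argument is
therefore `l - αs + η i (1 + 1/m) + o(η)`, whence `m = ν₀{l - αs} / (1 + 1/m)`. This makes the atom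
of `ν₀` have mass `m + 1 > 1`. -/
theorem measure_singleton_eq_zero {s v : ℝ} (hv : v ≠ 0) {ν₀ : Measure ℝ}
    [IsProbabilityMeasure ν₀] {ν : Fin 2 → Measure ℝ} [∀ α, IsProbabilityMeasure (ν α)]
    (h : ∀ z : ℂ, z.im ≠ 0 → IsSolutionAt s v ν₀ z fun α => stieltjes (ν α) z)
    (α : Fin 2) (l : ℝ) : ν α {l} = 0 := by
  by_contra hne
  set m := (ν α).real {l} with hm
  have hm0 : 0 < m := ENNReal.toReal_pos hne (measure_ne_top _ _)
  have hmC : (m : ℂ) ≠ 0 := by exact_mod_cast hm0.ne'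
  have hvC : (v : ℂ) ≠ 0 := by exact_mod_cast hv
  set Z : ℝ → ℂ := fun η => l + η * Complex.I with hZ
  have hZim : ∀ η, (Z η).im = η := fun η => by simp [hZ]
  set f : ℝ → ℂ := fun η => stieltjes (ν α) (Z η) with hf
  set g : ℝ → ℂ := fun η => stieltjes (ν (opp α)) (Z η) with hg
  have hη0 : Tendsto (fun η : ℝ => (η : ℂ)) (𝓝[>] 0) (𝓝 0) :=
    (Complex.continuous_ofReal.tendsto' 0 0 (by simp)).mono_left nhdsWithin_le_nhds
  have hF : Tendsto (fun η : ℝ => (η : ℂ) * f η) (𝓝[>] 0) (𝓝 (Complex.I * m)) := by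
    have := tendsto_mul_stieltjes (ν α) l (κ := fun _ => Complex.I) tendsto_const_nhds
      (Eventually.of_forall fun _ => by simp)
    simpa [hf, hZ] using this
  have hlim0 : Complex.I * (m : ℂ) ≠ 0 := mul_ne_zero Complex.I_ne_zero hmC
  have hFim : ∀ᶠ η : ℝ in 𝓝[>] 0, m / 2 ≤ ((η : ℂ) * f η).im := by
    have h1 := (Complex.continuous_im.tendsto _).comp hF
    have h2 : (Complex.I * (m : ℂ)).im = m := by simp
    rw [h2] at h1
    exact (h1.eventually (eventually_gt_nhds (half_lt_self hm0))).mono fun _ hx => le_of_lt hx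
  have hFnorm : ∀ᶠ η : ℝ in 𝓝[>] 0, ‖(η : ℂ) * f η‖ ≤ 2 * m := by
    have h1 := hF.norm
    have h2 : ‖Complex.I * (m : ℂ)‖ = m := by simp [abs_of_pos hm0]
    rw [h2] at h1
    exact (h1.eventually (eventually_lt_nhds (by linarith : m < 2 * m))).mono
      fun _ hx => le_of_lt hx
  -- the product of the two transforms tends to `-1 / v²`
  have hfg : Tendsto (fun η => f η * g η) (𝓝[>] 0) (𝓝 (-((v : ℂ) ^ 2)⁻¹)) := by
    have e : -((v : ℂ) ^ 2)⁻¹ = ∫ _ : ℝ, -((v : ℂ) ^ 2)⁻¹ ∂ν₀ := by simp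
    have e2 : ∀ᶠ η in 𝓝[>] (0 : ℝ), ∫ E : ℝ, f η *
        (1 / ((E : ℂ) - subordinate s v (opp α) (Z η) (f η))) ∂ν₀ = f η * g η := by
      filter_upwards [self_mem_nhdsWithin] with η hη
      rw [integral_const_mul]
      have := (h (Z η) (by rw [hZim]; exact ne_of_gt hη)).eq (opp α)
      rw [opp_opp] at this
      simp only [hg]
      rw [this]; rfl
    rw [e]
    refine Tendsto.congr' e2 ?_
    -- Near the axis `η |f| ≤ 2m ≤ 4 η Im f`, and the kernel is at most `1/(v² Im f)`; the product
    -- is at most `4/v²`.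
    refine tendsto_integral_filter_of_dominated_convergence (fun _ => 4 / v ^ 2) ?_ ?_
      (integrable_const _) ?_
    · filter_upwards [self_mem_nhdsWithin] with η hη
      have h1 : (Z η).im ≠ 0 := by rw [hZim]; exact ne_of_gt hη
      exact ((continuous_kernel (subordinate_im_ne_zero s v (opp α) h1
        ((h _ h1).im_pos α).le)).const_mul _).aestronglyMeasurable
    · filter_upwards [self_mem_nhdsWithin, hFim, hFnorm] with η hη h1 h2
      have hη : 0 < η := hη
      refine Eventually.of_forall fun E => ?_
      have hz1 : (Z η).im ≠ 0 := by rw [hZim]; exact ne_of_gt hη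
      have hsub := subordinate_im_ne_zero s v (opp α) hz1 ((h _ hz1).im_pos α).le
      rw [Complex.im_ofReal_mul] at h1
      rw [norm_mul, Complex.norm_real, Real.norm_of_nonneg hη.le] at h2
      have h3 : 0 < (f η).im := by
        by_contra hc
        nlinarith
      have h4 : v ^ 2 * (f η).im ≤ |(subordinate s v (opp α) (Z η) (f η)).im| := by
        rw [subordinate_im, hZim]
        exact le_trans (by linarith) (le_abs_self _)
      have h5 : ‖f η‖ ≤ 4 * (f η).im := by
        have : η * ‖f η‖ ≤ η * (4 * (f η).im) := by linarith
        exact le_of_mul_le_mul_left this hη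
      rw [norm_mul]
      calc ‖f η‖ * _ ≤ (4 * (f η).im) * (v ^ 2 * (f η).im)⁻¹ := by
            refine mul_le_mul h5 ((norm_kernel_le hsub E).trans (inv_anti₀ (by positivity) h4))
              (norm_nonneg _) (by positivity)
        _ = 4 / v ^ 2 := by field_simp
    · refine Eventually.of_forall fun E => ?_
      have hZ0 : Tendsto Z (𝓝[>] 0) (𝓝 (l + 0 * Complex.I)) :=
        tendsto_const_nhds.add (hη0.mul_const _)
      have hden : Tendsto (fun η : ℝ => (η : ℂ) * ((E : ℂ) - (Z η - s * sgn (opp α)))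
          - (v : ℂ) ^ 2 * ((η : ℂ) * f η)) (𝓝[>] 0)
          (𝓝 (0 * ((E : ℂ) - ((l + 0 * Complex.I) - s * sgn (opp α)))
            - (v : ℂ) ^ 2 * (Complex.I * m))) :=
        (hη0.mul (tendsto_const_nhds.sub (hZ0.sub tendsto_const_nhds))).sub (hF.const_mul _)
      have hd0 : (0 * ((E : ℂ) - ((l + 0 * Complex.I) - s * sgn (opp α)))
            - (v : ℂ) ^ 2 * (Complex.I * m)) ≠ 0 := by
        rw [zero_mul, zero_sub, neg_ne_zero]
        exact mul_ne_zero (pow_ne_zero 2 hvC) hlim0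
      have hl := hF.mul (hden.inv₀ hd0)
      have e3 : Complex.I * (m : ℂ) * (0 * ((E : ℂ) - ((l + 0 * Complex.I) - s * sgn (opp α)))
            - (v : ℂ) ^ 2 * (Complex.I * m))⁻¹ = -((v : ℂ) ^ 2)⁻¹ := by
        rw [zero_mul, zero_sub, inv_neg, mul_inv, mul_neg, mul_comm ((v : ℂ) ^ 2)⁻¹, ← mul_assoc,
          mul_inv_cancel₀ hlim0, one_mul]
      rw [e3] at hl
      refine hl.congr' ?_
      filter_upwards [self_mem_nhdsWithin] with η hη
      have hηC : (η : ℂ) ≠ 0 := by exact_mod_cast (ne_of_gt hη)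
      have e4 : (η : ℂ) * ((E : ℂ) - (Z η - s * sgn (opp α))) - (v : ℂ) ^ 2 * ((η : ℂ) * f η)
          = η * ((E : ℂ) - subordinate s v (opp α) (Z η) (f η)) := by
        unfold subordinate; ring
      rw [e4, mul_inv, one_div]
      field_simp
  -- This is `κ(η) = i + v² g/η`, with `g/η` written as `f g · (η f)⁻¹` so that both factors have
  -- known limits.
  have hgη : Tendsto (fun η : ℝ => Complex.I + (v : ℂ) ^ 2 * (f η * g η * ((η : ℂ) * f η)⁻¹))
      (𝓝[>] 0) (𝓝 (Complex.I + (v : ℂ) ^ 2 * (-((v : ℂ) ^ 2)⁻¹ * (Complex.I * m)⁻¹))) :=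
    tendsto_const_nhds.add ((hfg.mul (hF.inv₀ hlim0)).const_mul _)
  have hκ0 : Complex.I + (v : ℂ) ^ 2 * (-((v : ℂ) ^ 2)⁻¹ * (Complex.I * m)⁻¹)
      = Complex.I * (1 + (m : ℂ)⁻¹) := by
    rw [mul_inv, Complex.inv_I]
    field_simp
  rw [hκ0] at hgη
  have hfne : ∀ η : ℝ, 0 < η → f η ≠ 0 := by
    intro η hη h0
    have := (h (Z η) (by rw [hZim]; exact ne_of_gt hη)).im_pos α
    simp only [hf] at h0
    simp [h0] at this
  have hκeq : ∀ η : ℝ, 0 < η → (η : ℂ) * (Complex.I + (v : ℂ) ^ 2 * (f η * g η *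
      ((η : ℂ) * f η)⁻¹)) = η * Complex.I + (v : ℂ) ^ 2 * g η := by
    intro η hη
    have hηC : (η : ℂ) ≠ 0 := by exact_mod_cast (ne_of_gt hη)
    have := hfne η hη
    field_simp
  have hfinal := tendsto_mul_stieltjes ν₀ (l - s * sgn α) hgη (by
    filter_upwards [self_mem_nhdsWithin] with η hη
    have hη : 0 < η := hη
    have e5 : ((v : ℂ) ^ 2) = ((v ^ 2 : ℝ) : ℂ) := by push_cast; ring
    have h1 : η * (Complex.I + (v : ℂ) ^ 2 * (f η * g η * ((η : ℂ) * f η)⁻¹)).im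
        = η + v ^ 2 * (g η).im := by
      rw [← Complex.im_ofReal_mul, hκeq η hη, Complex.add_im, e5, Complex.im_ofReal_mul,
        Complex.im_ofReal_mul, Complex.I_im, mul_one]
    have h2 := (h (Z η) (by rw [hZim]; exact ne_of_gt hη)).im_pos (opp α)
    rw [hZim] at h2
    have h3 : 0 < (g η).im := pos_of_mul_pos_left h2 hη.le
    have h4 : η * 1 ≤ η * (Complex.I + (v : ℂ) ^ 2 * (f η * g η * ((η : ℂ) * f η)⁻¹)).im := by
      rw [h1]; nlinarith [mul_nonneg (sq_nonneg v) h3.le]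
    exact le_of_mul_le_mul_left h4 hη)
  have hfinal2 := hfinal.congr' (f₂ := fun η : ℝ => (η : ℂ) * f η) (by
    filter_upwards [self_mem_nhdsWithin] with η hη
    have hη : 0 < η := hη
    rw [hκeq η hη]
    have := (h (Z η) (by rw [hZim]; exact ne_of_gt hη)).eq α
    simp only [hf]
    rw [this]
    congr 2
    simp only [subordinate, hZ, hg]
    push_cast
    ring)
  have huniq := tendsto_nhds_unique hfinal2 hF
  rw [mul_inv, Complex.inv_I] at huniq
  have hpos : (1 + (m : ℂ)⁻¹) ≠ 0 := by
    have : (1 + m⁻¹ : ℝ) ≠ 0 := by positivity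
    exact_mod_cast this
  -- Two evaluations of the limit of `η f`: `i m` by assumption, and `i (1 + 1/m)⁻¹ ν₀{l - αs}`
  -- through the functional equation.
  have hfin : (ν₀.real {l - s * sgn α} : ℂ) = ((m + 1 : ℝ) : ℂ) := by
    have h1 : Complex.I * ((1 + (m : ℂ)⁻¹)⁻¹ * (ν₀.real {l - s * sgn α} : ℂ)) = Complex.I * m := by
      rw [← huniq]; ring
    have h2 := mul_left_cancel₀ Complex.I_ne_zero h1
    rw [inv_mul_eq_iff_eq_mul₀ hpos] at h2
    rw [h2]; push_cast; field_simp
  have h1 : ν₀.real {l - s * sgn α} = m + 1 := by exact_mod_cast hfin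
  have h2 : ν₀.real {l - s * sgn α} ≤ 1 := measureReal_le_one
  linarith

end SpinReservoir

end

noncomputable section

namespace SpinReservoir

/-! ### Weak convergence and the Stieltjes transform -/

/-- The function `x ↦ x² / (x² + η²)`. -/
def tailWeight (η x : ℝ) : ℝ := x ^ 2 / (x ^ 2 + η ^ 2)

theorem tailWeight_nonneg (η x : ℝ) : 0 ≤ tailWeight η x := by unfold tailWeight; positivity

theorem tailWeight_le_one (η x : ℝ) : tailWeight η x ≤ 1 :=
  div_le_one_of_le₀ (by nlinarith [sq_nonneg η]) (by positivity)

theorem continuous_tailWeight {η : ℝ} (hη : 0 < η) : Continuous (tailWeight η) :=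
  Continuous.div (by fun_prop) (by fun_prop) fun x => by positivity

/-- `x ↦ x² / (x² + η²)` as a bounded continuous function. -/
def tailWeightBCF (η : ℝ) (hη : 0 < η) : ℝ →ᵇ ℝ :=
  BoundedContinuousFunction.ofNormedAddCommGroup (tailWeight η) (continuous_tailWeight hη) 1
    fun x => by rw [Real.norm_of_nonneg (tailWeight_nonneg η x)]; exact tailWeight_le_one η x

theorem integrable_tailWeight (μ : Measure ℝ) [IsFiniteMeasure μ] {η : ℝ} (hη : 0 < η) :
    Integrable (tailWeight η) μ :=
  (tailWeightBCF η hη).integrable μ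

/-- The tail weight is affine in the imaginary part of the kernel at `iη`, so tails can be estimated
by resolvents. -/
theorem tailWeight_eq {η : ℝ} (hη : 0 < η) (x : ℝ) :
    tailWeight η x = 1 - η * (1 / ((x : ℂ) - η * Complex.I)).im := by
  have h := kernel_im_eq x 0 η
  rw [Complex.ofReal_zero, zero_add] at h
  rw [h, sub_zero, tailWeight]
  have : x ^ 2 + η ^ 2 ≠ 0 := by positivity
  field_simp
  ring

theorem tendsto_integral_tailWeight (μ : Measure ℝ) [IsFiniteMeasure μ] :
    Tendsto (fun η : ℝ => ∫ x, tailWeight η x ∂μ) atTop (𝓝 0) := by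
  have e : (0 : ℝ) = ∫ _ : ℝ, (0 : ℝ) ∂μ := by simp
  rw [e]
  refine tendsto_integral_filter_of_dominated_convergence (fun _ => 1) ?_ ?_
    (integrable_const _) ?_
  · filter_upwards [eventually_gt_atTop 0] with η hη
    exact (continuous_tailWeight hη).aestronglyMeasurable
  · refine Eventually.of_forall fun η => Eventually.of_forall fun x => ?_
    rw [Real.norm_of_nonneg (tailWeight_nonneg η x)]; exact tailWeight_le_one η x
  · refine Eventually.of_forall fun x => ?_
    exact tendsto_const_nhds.div_atTop
      (tendsto_atTop_add_const_left _ _ (tendsto_pow_atTop two_ne_zero))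

/-- Beyond `η` the tail weight is at least `1/2`. -/
theorem measure_norm_gt_le (μ : Measure ℝ) [IsFiniteMeasure μ] {η : ℝ} (hη : 0 < η) :
    μ {x | η < ‖x‖} ≤ ENNReal.ofReal (2 * ∫ x, tailWeight η x ∂μ) := by
  have hS : MeasurableSet {x : ℝ | η < ‖x‖} := measurableSet_lt measurable_const measurable_norm
  rw [← integral_const_mul, ofReal_integral_eq_lintegral_ofReal
    ((integrable_tailWeight μ hη).const_mul 2)
    (Eventually.of_forall fun x => mul_nonneg zero_le_two (tailWeight_nonneg η x)),
    ← lintegral_indicator_one hS]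
  refine lintegral_mono fun x => ?_
  by_cases hx : η < ‖x‖
  · rw [Set.indicator_of_mem (by exact hx), Pi.one_apply]
    rw [← ENNReal.ofReal_one]
    refine ENNReal.ofReal_le_ofReal ?_
    have h1 : η ^ 2 < x ^ 2 := by
      rw [← sq_abs x]; exact pow_lt_pow_left₀ hx hη.le two_ne_zero
    rw [tailWeight, mul_div_assoc', le_div_iff₀ (by positivity)]
    linarith
  · rw [Set.indicator_of_notMem (by exact hx)]; exact zero_le

/-- A sequence of probability measures whose mass does not escape to infinity. -/
def TailsVanish (μ : ℕ → ProbabilityMeasure ℝ) : Prop :=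
  ∀ ε : ℝ, 0 < ε → ∃ η : ℝ, 0 < η ∧ ∀ᶠ n in atTop, ∫ x, tailWeight η x ∂(μ n : Measure ℝ) ≤ ε

theorem TailsVanish.isTight {μ : ℕ → ProbabilityMeasure ℝ} (h : TailsVanish μ) :
    IsTightMeasureSet (Set.range fun n => (μ n : Measure ℝ)) := by
  refine isTightMeasureSet_range_of_tendsto_limsup_measure_norm_gt ?_
  rw [ENNReal.tendsto_atTop_zero]
  intro ε hε
  by_cases hε' : ε = ∞
  · exact ⟨0, fun _ _ => by rw [hε']; exact le_top⟩
  obtain ⟨η, hη, hev⟩ := h (ε.toReal / 2) (half_pos (ENNReal.toReal_pos hε.ne' hε'))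
  refine ⟨η, fun r hr => ?_⟩
  refine limsup_le_of_le (h := ?_)
  filter_upwards [hev] with n hn
  calc (μ n : Measure ℝ) {x | r < ‖x‖} ≤ (μ n : Measure ℝ) {x | η < ‖x‖} :=
        measure_mono fun x hx => lt_of_le_of_lt hr hx
    _ ≤ ENNReal.ofReal (2 * ∫ x, tailWeight η x ∂(μ n : Measure ℝ)) := measure_norm_gt_le _ hη
    _ ≤ ENNReal.ofReal ε.toReal := ENNReal.ofReal_le_ofReal (by linarith)
    _ = ε := ENNReal.ofReal_toReal hε'

theorem TailsVanish.exists_subseq {μ : ℕ → ProbabilityMeasure ℝ} (h : TailsVanish μ)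
    (ns : ℕ → ℕ) : ∃ (ρ : ProbabilityMeasure ℝ) (ms : ℕ → ℕ), StrictMono ms ∧
      Tendsto (fun k => μ (ns (ms k))) atTop (𝓝 ρ) := by
  have hc : IsCompact (closure (Set.range μ)) := by
    refine isCompact_closure_of_isTightMeasureSet ?_
    refine h.isTight.subset ?_
    rintro _ ⟨_, ⟨n, rfl⟩, rfl⟩
    exact ⟨n, rfl⟩
  obtain ⟨ρ, -, ms, hms, hlim⟩ := hc.isSeqCompact (x := fun k => μ (ns k))
    fun k => subset_closure ⟨ns k, rfl⟩
  exact ⟨ρ, ms, hms, hlim⟩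

/-- `x ↦ 1 / (x - z)` as a bounded continuous function. -/
def kernelBCF (z : ℂ) (hz : z.im ≠ 0) : ℝ →ᵇ ℂ :=
  BoundedContinuousFunction.ofNormedAddCommGroup (fun x : ℝ => 1 / ((x : ℂ) - z))
    (continuous_kernel hz) |z.im|⁻¹ (norm_kernel_le hz)

theorem tendsto_stieltjes {ι : Type*} {L : Filter ι} {μ : ι → ProbabilityMeasure ℝ}
    {ρ : ProbabilityMeasure ℝ} (h : Tendsto μ L (𝓝 ρ)) {z : ℂ} (hz : z.im ≠ 0) :
    Tendsto (fun i => stieltjes (μ i) z) L (𝓝 (stieltjes ρ z)) :=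
  (ProbabilityMeasure.tendsto_iff_forall_integral_rclike_tendsto ℂ).1 h (kernelBCF z hz)

theorem eq_of_stieltjes {μ ν : ProbabilityMeasure ℝ}
    (h : ∀ z : ℂ, 0 < z.im → stieltjes μ z = stieltjes ν z) : μ = ν :=
  Subtype.ext (show (μ : Measure ℝ) = ν from ext_of_stieltjes h)

/-- Allows almost sure statements to be made on a countable set of points `z` only. -/
theorem eqOn_im_ne_zero_of_dense {D : Set ℂ} (hD : Dense D) {f g : ℂ → ℂ}
    (hf : ContinuousOn f {z | z.im ≠ 0}) (hg : ContinuousOn g {z | z.im ≠ 0})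
    (h : ∀ z ∈ D, z.im ≠ 0 → f z = g z) {z : ℂ} (hz : z.im ≠ 0) : f z = g z :=
  Set.EqOn.of_subset_closure (s := {z : ℂ | z.im ≠ 0} ∩ D) (t := {z : ℂ | z.im ≠ 0})
    (fun z hz => h z hz.2 hz.1) hf hg Set.inter_subset_left
    (hD.open_subset_closure_inter isOpen_im_ne_zero) hz

/-- By tightness each subsequence has a weakly convergent further subsequence; its limit has the
transform of `ρ` on `D`, hence off the whole real axis, hence equals `ρ`. -/
theorem tendsto_of_tendsto_stieltjes {μ : ℕ → ProbabilityMeasure ℝ} (hμ : TailsVanish μ)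
    {ρ : ProbabilityMeasure ℝ} {D : Set ℂ} (hD : Dense D)
    (h : ∀ z ∈ D, z.im ≠ 0 → Tendsto (fun n => stieltjes (μ n) z) atTop (𝓝 (stieltjes ρ z))) :
    Tendsto μ atTop (𝓝 ρ) := by
  refine tendsto_of_subseq_tendsto fun ns hns => ?_
  obtain ⟨ρ', ms, hms, hlim⟩ := hμ.exists_subseq ns
  refine ⟨ms, ?_⟩
  suffices ρ' = ρ by rwa [this] at hlim
  refine eq_of_stieltjes fun z hz => ?_
  refine eqOn_im_ne_zero_of_dense hD (continuousOn_stieltjes _) (continuousOn_stieltjes _)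
    (fun z hzD hz => ?_) hz.ne'
  exact tendsto_nhds_unique (tendsto_stieltjes hlim hz)
    ((h z hzD hz).comp (hns.comp hms.tendsto_atTop))

/-! ### Limits of approximate solutions -/

variable {s v : ℝ} {ν₀ : ProbabilityMeasure ℝ}

/-- The pair of transforms of `μ n` solves the functional equation, with the measure `N n` in place
of `ν₀`, up to an error that vanishes as `n → ∞`. -/
def IsApproxSolution (s v : ℝ) (N : ℕ → ProbabilityMeasure ℝ)
    (μ : ℕ → Fin 2 → ProbabilityMeasure ℝ) (D : Set ℂ) : Prop :=
  ∀ α, ∀ z ∈ D, z.im ≠ 0 → Tendsto (fun n => stieltjes (μ n α) z -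
    stieltjes (N n) (subordinate s v α z (stieltjes (μ n (opp α)) z))) atTop (𝓝 0)

theorem continuousOn_stieltjes_subordinate (s v : ℝ) (ν₀ ρ : Measure ℝ) [IsFiniteMeasure ν₀]
    [IsProbabilityMeasure ρ] (α : Fin 2) :
    ContinuousOn (fun z => stieltjes ν₀ (subordinate s v α z (stieltjes ρ z))) {z | z.im ≠ 0} := by
  refine (continuousOn_stieltjes ν₀).comp ?_ fun z hz =>
    subordinate_im_ne_zero s v α hz (stieltjes_im_mul_pos ρ hz).le
  unfold subordinate
  exact (continuousOn_id.add ((continuousOn_stieltjes ρ).const_smul ((v : ℂ) ^ 2))).sub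
    continuousOn_const

theorem IsApproxSolution.isSolutionAt_of_tendsto {N : ℕ → ProbabilityMeasure ℝ}
    (hN : Tendsto N atTop (𝓝 ν₀)) {μ : ℕ → Fin 2 → ProbabilityMeasure ℝ} {D : Set ℂ}
    (hD : Dense D) (h : IsApproxSolution s v N μ D) {ns : ℕ → ℕ} (hns : Tendsto ns atTop atTop)
    {ρ : Fin 2 → ProbabilityMeasure ℝ}
    (hρ : ∀ α, Tendsto (fun k => μ (ns k) α) atTop (𝓝 (ρ α))) {z : ℂ} (hz : z.im ≠ 0) :
    IsSolutionAt s v ν₀ z fun α => stieltjes (ρ α) z where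
  im_pos α := stieltjes_im_mul_pos _ hz
  eq α := by
    refine eqOn_im_ne_zero_of_dense hD (continuousOn_stieltjes _)
      (continuousOn_stieltjes_subordinate s v ν₀ (ρ (opp α)) α) (fun z hzD hz => ?_) hz
    have h1 := (h α z hzD hz).comp hns
    have h2 := tendsto_stieltjes (hρ α) hz
    have h3 := tendsto_stieltjes (hρ (opp α)) hz
    have him : ∀ τ : ProbabilityMeasure ℝ,
        0 ≤ (stieltjes τ z).im * z.im := fun τ => (stieltjes_im_mul_pos _ hz).le
    have h4 := (tendsto_stieltjes hN (z := subordinate s v α z (stieltjes (ρ (opp α)) z))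
      (subordinate_im_ne_zero s v α hz (him _))).comp hns
    -- Both the measure and the point vary with `k`. The Lipschitz bound, uniform in the measure,
    -- freezes the point first; weak convergence of `N` applies afterwards.
    have h5 : Tendsto (fun k => stieltjes (N (ns k))
          (subordinate s v α z (stieltjes (μ (ns k) (opp α)) z)) - stieltjes (N (ns k))
          (subordinate s v α z (stieltjes (ρ (opp α)) z))) atTop (𝓝 0) := by
      have hd : Tendsto (fun k => v ^ 2 * ‖stieltjes (μ (ns k) (opp α)) z
          - stieltjes (ρ (opp α)) z‖ * (|z.im|⁻¹ * |z.im|⁻¹)) atTop (𝓝 0) := by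
        have := (tendsto_iff_norm_sub_tendsto_zero.1 h3)
        simpa using (this.const_mul (v ^ 2)).mul_const (|z.im|⁻¹ * |z.im|⁻¹)
      refine squeeze_zero_norm (fun k => ?_) hd
      refine (norm_stieltjes_sub_le _ (subordinate_im_ne_zero s v α hz (him _))
        (subordinate_im_ne_zero s v α hz (him _))).trans ?_
      have e : subordinate s v α z (stieltjes (μ (ns k) (opp α)) z)
          - subordinate s v α z (stieltjes (ρ (opp α)) z)
          = (v : ℂ) ^ 2 * (stieltjes (μ (ns k) (opp α)) z - stieltjes (ρ (opp α)) z) := by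
        unfold subordinate; ring
      rw [e, norm_mul, norm_pow, Complex.norm_real, Real.norm_eq_abs, sq_abs]
      have hz' := abs_pos.2 hz
      exact mul_le_mul_of_nonneg_left (mul_le_mul
        (inv_anti₀ hz' (abs_im_le_subordinate_im s v α (him _)))
        (inv_anti₀ hz' (abs_im_le_subordinate_im s v α (him _))) (by positivity) (by positivity))
        (by positivity)
    have h6 := (h1.add h5).add h4
    rw [zero_add, zero_add] at h6
    refine tendsto_nhds_unique h2 (h6.congr fun k => ?_)
    simp only [Function.comp]
    ring

/-- The source of existence: no fixed point theorem is invoked, a solution is produced as a limit of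
spectral measures. -/
theorem IsApproxSolution.exists_isSolutionAt {N : ℕ → ProbabilityMeasure ℝ}
    (hN : Tendsto N atTop (𝓝 ν₀)) {μ : ℕ → Fin 2 → ProbabilityMeasure ℝ} {D : Set ℂ}
    (hD : Dense D) (h : IsApproxSolution s v N μ D) (hμ : ∀ α, TailsVanish fun n => μ n α)
    {ns : ℕ → ℕ} (hns : Tendsto ns atTop atTop) :
    ∃ (ρ : Fin 2 → ProbabilityMeasure ℝ) (ms : ℕ → ℕ),
      (∀ α, Tendsto (fun k => μ (ns (ms k)) α) atTop (𝓝 (ρ α))) ∧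
      ∀ z : ℂ, z.im ≠ 0 → IsSolutionAt s v ν₀ z fun α => stieltjes (ρ α) z := by
  obtain ⟨ρ₀, ms₀, hms₀, h₀⟩ := (hμ 0).exists_subseq ns
  obtain ⟨ρ₁, ms₁, hms₁, h₁⟩ := (hμ 1).exists_subseq (ns ∘ ms₀)
  have key : ∀ α, Tendsto (fun k => μ (ns ((ms₀ ∘ ms₁) k)) α) atTop (𝓝 (![ρ₀, ρ₁] α)) := by
    intro α
    fin_cases α
    · exact h₀.comp hms₁.tendsto_atTop
    · exact h₁
  exact ⟨![ρ₀, ρ₁], ms₀ ∘ ms₁, key, fun z hz => h.isSolutionAt_of_tendsto hN hD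
    (hns.comp (hms₀.comp hms₁).tendsto_atTop) key hz⟩

/-- Every subsequential limit solves the limiting equation, and the equation has one solution at
each `z`. -/
theorem IsApproxSolution.tendsto {N : ℕ → ProbabilityMeasure ℝ}
    (hN : Tendsto N atTop (𝓝 ν₀)) {μ : ℕ → Fin 2 → ProbabilityMeasure ℝ} {D : Set ℂ}
    (hD : Dense D) (h : IsApproxSolution s v N μ D) (hμ : ∀ α, TailsVanish fun n => μ n α)
    {ν : Fin 2 → ProbabilityMeasure ℝ}
    (hν : ∀ z : ℂ, z.im ≠ 0 → IsSolutionAt s v ν₀ z fun α => stieltjes (ν α) z) (α : Fin 2) :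
    Tendsto (fun n => μ n α) atTop (𝓝 (ν α)) := by
  refine tendsto_of_subseq_tendsto fun ns hns => ?_
  obtain ⟨ρ, ms, hlim, hsol⟩ := h.exists_isSolutionAt hN hD hμ hns
  refine ⟨ms, ?_⟩
  suffices ρ α = ν α by rw [← this]; exact hlim α
  refine eq_of_stieltjes fun z hz => ?_
  exact congrFun ((hsol z hz.ne').unique (hν z hz.ne') hz.ne') α

end SpinReservoir

end

noncomputable section

namespace SpinReservoir

/-! ### Centered Gaussian measures: integration by parts and the Poincaré inequality -/

section Rotation

variable {E : Type*} [NormedAddCommGroup E] [NormedSpace ℝ E]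

theorem norm_rotation_fst_le (θ : ℝ) (q : E × E) :
    ‖Real.cos θ • q.1 + Real.sin θ • q.2‖ ≤ ‖q.1‖ + ‖q.2‖ := by
  refine (norm_add_le _ _).trans ?_
  rw [norm_smul, norm_smul]
  have h1 := Real.abs_cos_le_one θ
  have h2 := Real.abs_sin_le_one θ
  gcongr
  · exact mul_le_of_le_one_left (norm_nonneg _) h1
  · exact mul_le_of_le_one_left (norm_nonneg _) h2

theorem norm_rotation_snd_le (θ : ℝ) (q : E × E) :
    ‖-Real.sin θ • q.1 + Real.cos θ • q.2‖ ≤ ‖q.1‖ + ‖q.2‖ := by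
  refine (norm_add_le _ _).trans ?_
  rw [norm_smul, norm_smul, norm_neg]
  have h1 := Real.abs_cos_le_one θ
  have h2 := Real.abs_sin_le_one θ
  gcongr
  · exact mul_le_of_le_one_left (norm_nonneg _) h2
  · exact mul_le_of_le_one_left (norm_nonneg _) h1

theorem hasDerivAt_rotation_fst (θ : ℝ) (q : E × E) :
    HasDerivAt (fun θ : ℝ => Real.cos θ • q.1 + Real.sin θ • q.2)
      (-Real.sin θ • q.1 + Real.cos θ • q.2) θ :=
  ((Real.hasDerivAt_cos θ).smul_const q.1).add ((Real.hasDerivAt_sin θ).smul_const q.2)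

theorem hasDerivAt_rotation_snd (θ : ℝ) (q : E × E) :
    HasDerivAt (fun θ : ℝ => -Real.sin θ • q.1 + Real.cos θ • q.2)
      (-(Real.cos θ • q.1 + Real.sin θ • q.2)) θ := by
  have := ((Real.hasDerivAt_sin θ).neg.smul_const q.1).add
    ((Real.hasDerivAt_cos θ).smul_const q.2)
  convert! this using 1
  simp only [neg_smul]; abel

/-- The quarter circle `cos θ q₁ + sin θ q₂` joins `q₁` to `q₂`, and its velocity is the second
rotated coordinate. The factor `π/2` is the Cauchy–Schwarz cost of the length of the interval. -/
theorem enorm_sub_sq_le_lintegral {F : E → ℂ} {F' : E → E →L[ℝ] ℂ}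
    (hF : ∀ x, HasFDerivAt F (F' x) x) (hF' : Continuous F') (q : E × E) :
    ‖F q.2 - F q.1‖ₑ ^ 2 ≤ ENNReal.ofReal (Real.pi / 2) *
      ∫⁻ θ in Set.Ioc 0 (Real.pi / 2), ‖F' (Real.cos θ • q.1 + Real.sin θ • q.2)
        (-Real.sin θ • q.1 + Real.cos θ • q.2)‖ₑ ^ 2 := by
  set G : ℝ → ℂ := fun θ => F' (Real.cos θ • q.1 + Real.sin θ • q.2)
        (-Real.sin θ • q.1 + Real.cos θ • q.2) with hG
  have hGc : Continuous G := (hF'.comp (by fun_prop)).clm_apply (by fun_prop)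
  have hpi : 0 ≤ Real.pi / 2 := by positivity
  have hftc : ∫ θ in (0 : ℝ)..(Real.pi / 2), G θ = F q.2 - F q.1 := by
    rw [intervalIntegral.integral_eq_sub_of_hasDerivAt
      (f := fun θ => F (Real.cos θ • q.1 + Real.sin θ • q.2))
      (fun θ _ => (hF _).comp_hasDerivAt θ (hasDerivAt_rotation_fst θ q))
      (hGc.intervalIntegrable _ _)]
    simp
  have hint : ∀ f : ℝ → ℝ, Continuous f → IntegrableOn f (Set.Ioc 0 (Real.pi / 2)) := fun f hf =>
    (hf.integrableOn_Icc).mono_set Set.Ioc_subset_Icc_self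
  have hcs := integral_mul_sq_le (ν := volume.restrict (Set.Ioc 0 (Real.pi / 2)))
    (f := fun _ => 1) (g := fun θ => ‖G θ‖) (hint _ (by fun_prop)) (hint _ (by fun_prop))
    (hint _ (by fun_prop))
  simp only [one_mul, one_pow, integral_const, smul_eq_mul, mul_one, MeasurableSet.univ,
    measureReal_restrict_apply, Set.univ_inter, Real.volume_real_Ioc_of_le hpi, sub_zero] at hcs
  have hle : ‖F q.2 - F q.1‖ ≤ ∫ θ in Set.Ioc 0 (Real.pi / 2), ‖G θ‖ := by
    rw [← hftc, intervalIntegral.integral_of_le hpi]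
    exact norm_integral_le_integral_norm _
  have hreal : ‖F q.2 - F q.1‖ ^ 2 ≤ Real.pi / 2 * ∫ θ in Set.Ioc 0 (Real.pi / 2), ‖G θ‖ ^ 2 :=
    (pow_le_pow_left₀ (norm_nonneg _) hle 2).trans hcs
  have h1 := ENNReal.ofReal_le_ofReal hreal
  rw [ENNReal.ofReal_mul hpi, ofReal_integral_eq_lintegral_ofReal (hint _ (by fun_prop))
    (Eventually.of_forall fun _ => by positivity)] at h1
  simpa only [ENNReal.ofReal_pow (norm_nonneg _), ofReal_norm] using h1

end Rotation

section Gaussian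

variable {E : Type*} [NormedAddCommGroup E] [NormedSpace ℝ E] [MeasurableSpace E] [BorelSpace E]
  [SecondCountableTopology E] [CompleteSpace E] {μ : Measure E} [IsGaussian μ]

theorem integrable_norm_add_norm_sq (μ : Measure E) [IsGaussian μ] :
    Integrable (fun q : E × E => (‖q.1‖ + ‖q.2‖) ^ 2) (μ.prod μ) := by
  have h1 : MemLp (fun q : E × E => ‖q.1‖) 2 (μ.prod μ) :=
    ((IsGaussian.memLp_id μ 2 (by simp)).norm).comp_fst μ
  have h2 : MemLp (fun q : E × E => ‖q.2‖) 2 (μ.prod μ) :=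
    ((IsGaussian.memLp_id μ 2 (by simp)).norm).comp_snd μ
  exact (h1.add h2).integrable_sq

theorem integrable_norm_add_norm (μ : Measure E) [IsGaussian μ] :
    Integrable (fun q : E × E => ‖q.1‖ + ‖q.2‖) (μ.prod μ) := by
  have h1 : MemLp (fun q : E × E => ‖q.1‖) 1 (μ.prod μ) :=
    ((IsGaussian.memLp_id μ 1 (by simp)).norm).comp_fst μ
  have h2 : MemLp (fun q : E × E => ‖q.2‖) 1 (μ.prod μ) :=
    ((IsGaussian.memLp_id μ 1 (by simp)).norm).comp_snd μ
  exact memLp_one_iff_integrable.1 (h1.add h2)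

/-- A product of two copies of a centered Gaussian measure is invariant under rotations that mix the
copies; both integration by parts and the Poincaré inequality rest on this. -/
theorem integral_rotation (hμ : ∀ L : StrongDual ℝ E, μ[L] = 0) (θ : ℝ) {f : E × E → ℂ}
    (hf : Continuous f) :
    ∫ q, f (Real.cos θ • q.1 + Real.sin θ • q.2, -Real.sin θ • q.1 + Real.cos θ • q.2)
      ∂(μ.prod μ) = ∫ q, f q ∂(μ.prod μ) := by
  conv_rhs => rw [← IsGaussian.map_rotation_eq_self_of_forall_strongDual_eq_zero hμ θ]
  rw [integral_map (by fun_prop) hf.aestronglyMeasurable]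
  rfl

theorem lintegral_rotation (hμ : ∀ L : StrongDual ℝ E, μ[L] = 0) (θ : ℝ) {f : E × E → ℝ≥0∞}
    (hf : Measurable f) :
    ∫⁻ q, f (Real.cos θ • q.1 + Real.sin θ • q.2, -Real.sin θ • q.1 + Real.cos θ • q.2)
      ∂(μ.prod μ) = ∫⁻ q, f q ∂(μ.prod μ) := by
  conv_rhs => rw [← IsGaussian.map_rotation_eq_self_of_forall_strongDual_eq_zero hμ θ]
  rw [lintegral_map hf (by fun_prop)]
  rfl

/-- Gaussian integration by parts. -/
theorem gaussian_integral_mul (hμ : ∀ L : StrongDual ℝ E, μ[L] = 0) (l : E →L[ℝ] ℂ)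
    {F : E → ℂ} {F' : E → E →L[ℝ] ℂ} (hF : ∀ x, HasFDerivAt F (F' x) x) (hF' : Continuous F')
    {C C' : ℝ} (hC : ∀ x, ‖F x‖ ≤ C) (hC' : ∀ x, ‖F' x‖ ≤ C') :
    ∫ x, l x * F x ∂μ = ∫ q, l q.2 * F' q.1 q.2 ∂(μ.prod μ) := by
  have hFc : Continuous F := continuous_iff_continuousAt.2 fun x => (hF x).continuousAt
  have hC0 : 0 ≤ C := (norm_nonneg _).trans (hC 0)
  have hC'0 : 0 ≤ C' := (norm_nonneg _).trans (hC' 0)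
  set X : ℝ → E × E → E := fun θ q => Real.cos θ • q.1 + Real.sin θ • q.2 with hX
  set Y : ℝ → E × E → E := fun θ q => -Real.sin θ • q.1 + Real.cos θ • q.2 with hY
  have hXc : ∀ θ, Continuous (X θ) := fun θ => by fun_prop
  have hYc : ∀ θ, Continuous (Y θ) := fun θ => by fun_prop
  have hb1 : ∀ θ q, ‖l (X θ q)‖ ≤ ‖l‖ * (‖q.1‖ + ‖q.2‖) := fun θ q =>
    (l.le_opNorm _).trans (by gcongr; exact norm_rotation_fst_le θ q)
  have hb2 : ∀ θ q, ‖l (Y θ q)‖ ≤ ‖l‖ * (‖q.1‖ + ‖q.2‖) := fun θ q =>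
    (l.le_opNorm _).trans (by gcongr; exact norm_rotation_snd_le θ q)
  have hb3 : ∀ θ q, ‖F' (X θ q) (Y θ q)‖ ≤ C' * (‖q.1‖ + ‖q.2‖) := fun θ q =>
    ((F' _).le_opNorm _).trans (by gcongr; exacts [hC' _, norm_rotation_snd_le θ q])
  have hA : ∀ θ, Integrable (fun q => l (X θ q) * F (X θ q)) (μ.prod μ) := fun θ => by
    refine Integrable.mono' (((integrable_norm_add_norm μ).const_mul ‖l‖).mul_const C)
      (Continuous.aestronglyMeasurable (by fun_prop)) (Eventually.of_forall fun q => ?_)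
    rw [norm_mul]
    exact mul_le_mul (hb1 θ q) (hC _) (norm_nonneg _) (by positivity)
  have hA' : ∀ θ, Integrable (fun q => l (Y θ q) * F (X θ q)) (μ.prod μ) := fun θ => by
    refine Integrable.mono' (((integrable_norm_add_norm μ).const_mul ‖l‖).mul_const C)
      (Continuous.aestronglyMeasurable (by fun_prop)) (Eventually.of_forall fun q => ?_)
    rw [norm_mul]
    exact mul_le_mul (hb2 θ q) (hC _) (norm_nonneg _) (by positivity)
  have hcF' : ∀ θ, Continuous fun q => F' (X θ q) (Y θ q) := fun θ =>
    (hF'.comp (hXc θ)).clm_apply (hYc θ)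
  have hB : ∀ θ, Integrable (fun q => l (Y θ q) * F' (X θ q) (Y θ q)) (μ.prod μ) := fun θ => by
    refine Integrable.mono' (((integrable_norm_add_norm_sq μ).const_mul (‖l‖ * C')))
      ((l.continuous.comp (hYc θ)).mul (hcF' θ)).aestronglyMeasurable
      (Eventually.of_forall fun q => ?_)
    rw [norm_mul]
    refine (mul_le_mul (hb2 θ q) (hb3 θ q) (norm_nonneg _) (by positivity)).trans_eq ?_
    ring
  have hder := (hasDerivAt_integral_of_dominated_loc_of_deriv_le (μ := μ.prod μ) (𝕜 := ℝ)
    (F := fun θ q => l (Y θ q) * F (X θ q))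
    (F' := fun θ q => -(l (X θ q) * F (X θ q)) + l (Y θ q) * F' (X θ q) (Y θ q))
    (x₀ := 0) (s := Set.univ)
    (bound := fun q => ‖l‖ * (‖q.1‖ + ‖q.2‖) * C + ‖l‖ * C' * (‖q.1‖ + ‖q.2‖) ^ 2)
    Filter.univ_mem (Eventually.of_forall fun θ => (hA' θ).aestronglyMeasurable) (hA' 0)
    ((hA 0).neg.add (hB 0)).aestronglyMeasurable
    (Eventually.of_forall fun q θ _ => by
      refine (norm_add_le _ _).trans (add_le_add ?_ ?_)
      · rw [norm_neg, norm_mul]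
        exact mul_le_mul (hb1 θ q) (hC _) (norm_nonneg _) (by positivity)
      · rw [norm_mul]
        refine (mul_le_mul (hb2 θ q) (hb3 θ q) (norm_nonneg _) (by positivity)).trans_eq ?_
        ring)
    ((((integrable_norm_add_norm μ).const_mul ‖l‖).mul_const C).add
      ((integrable_norm_add_norm_sq μ).const_mul (‖l‖ * C')))
    (Eventually.of_forall fun q θ _ => by
      have h1 : HasDerivAt (fun θ => l (Y θ q)) (l (-(X θ q))) θ :=
        l.hasFDerivAt.comp_hasDerivAt θ (hasDerivAt_rotation_snd θ q)
      have h2 : HasDerivAt (fun θ => F (X θ q)) (F' (X θ q) (Y θ q)) θ :=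
        (hF (X θ q)).comp_hasDerivAt θ (hasDerivAt_rotation_fst θ q)
      have := h1.mul h2
      rwa [map_neg, neg_mul] at this)).2
  -- By rotation invariance this integral does not depend on `θ`, so its derivative at `0`, computed
  -- in `hder`, vanishes. That is the integration by parts formula.
  have hconst : (fun θ : ℝ => ∫ q, l (Y θ q) * F (X θ q) ∂(μ.prod μ))
      = fun _ => ∫ q, l q.2 * F q.1 ∂(μ.prod μ) := by
    funext θ
    exact integral_rotation hμ θ (f := fun q => l q.2 * F q.1) (by fun_prop)
  rw [hconst] at hder
  have h0 := hder.unique (hasDerivAt_const 0 _)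
  have hX0 : ∀ q, X 0 q = q.1 := fun q => by simp [hX]
  have hY0 : ∀ q, Y 0 q = q.2 := fun q => by simp [hY]
  rw [integral_add (by exact (hA 0).neg) (hB 0), integral_neg] at h0
  simp only [hX0, hY0] at h0
  have h1 : ∫ q : E × E, l q.1 * F q.1 ∂(μ.prod μ) = ∫ x, l x * F x ∂μ := by
    have := integral_fun_fst (μ := μ) (ν := μ) (fun x => l x * F x)
    simpa using this
  rw [← h1]
  linear_combination -h0

/-- For each angle the rotated pair has the law of the original one, so the integrand along the arc
has mean at most `K`; integrating over the arc gives the second factor `π/2`. -/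
theorem lintegral_norm_sub_sq_le (hμ : ∀ L : StrongDual ℝ E, μ[L] = 0)
    {F : E → ℂ} {F' : E → E →L[ℝ] ℂ} (hF : ∀ x, HasFDerivAt F (F' x) x) (hF' : Continuous F')
    {K : ℝ≥0∞} (hK : ∀ x, ∫⁻ y, ‖F' x y‖ₑ ^ 2 ∂μ ≤ K) :
    ∫⁻ q, ‖F q.2 - F q.1‖ₑ ^ 2 ∂(μ.prod μ) ≤ ENNReal.ofReal (Real.pi / 2) ^ 2 * K := by
  have hm : Measurable fun q : E × E => ‖F' q.1 q.2‖ₑ ^ 2 :=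
    ((hF'.comp continuous_fst).clm_apply continuous_snd).enorm.measurable.pow_const 2
  calc ∫⁻ q, ‖F q.2 - F q.1‖ₑ ^ 2 ∂(μ.prod μ)
      ≤ ∫⁻ q, (ENNReal.ofReal (Real.pi / 2) *
        ∫⁻ θ in Set.Ioc 0 (Real.pi / 2), ‖F' (Real.cos θ • q.1 + Real.sin θ • q.2)
          (-Real.sin θ • q.1 + Real.cos θ • q.2)‖ₑ ^ 2) ∂(μ.prod μ) :=
        lintegral_mono fun q => enorm_sub_sq_le_lintegral hF hF' q
    _ = ENNReal.ofReal (Real.pi / 2) * ∫⁻ θ in Set.Ioc 0 (Real.pi / 2),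
          (∫⁻ q : E × E, ‖F' (Real.cos θ • q.1 + Real.sin θ • q.2)
          (-Real.sin θ • q.1 + Real.cos θ • q.2)‖ₑ ^ 2 ∂(μ.prod μ)) := by
        rw [lintegral_const_mul' _ _ ENNReal.ofReal_ne_top, lintegral_lintegral_swap]
        refine (Measurable.pow_const (Continuous.measurable (Continuous.enorm ?_)) 2).aemeasurable
        exact (hF'.comp (by fun_prop)).clm_apply (by fun_prop)
    _ = ENNReal.ofReal (Real.pi / 2) * ∫⁻ θ in Set.Ioc 0 (Real.pi / 2),
          (∫⁻ q : E × E, ‖F' q.1 q.2‖ₑ ^ 2 ∂(μ.prod μ)) := by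
        congr 1
        refine lintegral_congr fun θ => ?_
        exact lintegral_rotation hμ θ hm
    _ ≤ ENNReal.ofReal (Real.pi / 2) * ∫⁻ θ in Set.Ioc 0 (Real.pi / 2), K := by
        gcongr
        rw [lintegral_prod _ hm.aemeasurable]
        calc _ ≤ ∫⁻ _, K ∂μ := lintegral_mono hK
          _ = K := by simp
    _ = _ := by
        rw [setLIntegral_const, Real.volume_Ioc, sub_zero]
        ring

/-- The Poincaré inequality, with a constant that is not optimal. -/
theorem gaussian_poincare (hμ : ∀ L : StrongDual ℝ E, μ[L] = 0)
    {F : E → ℂ} {F' : E → E →L[ℝ] ℂ} (hF : ∀ x, HasFDerivAt F (F' x) x) (hF' : Continuous F')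
    {C : ℝ} (hC : ∀ x, ‖F x‖ ≤ C) {K : ℝ≥0∞} (hK : ∀ x, ∫⁻ y, ‖F' x y‖ₑ ^ 2 ∂μ ≤ K) :
    ∫⁻ x, ‖F x - ∫ y, F y ∂μ‖ₑ ^ 2 ∂μ ≤ ENNReal.ofReal (Real.pi / 2) ^ 2 * K := by
  refine le_trans ?_ (lintegral_norm_sub_sq_le hμ hF hF' hK)
  have hFc : Continuous F := continuous_iff_continuousAt.2 fun x => (hF x).continuousAt
  have hFi : Integrable F μ :=
    Integrable.of_bound hFc.aestronglyMeasurable C (Eventually.of_forall hC)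
  -- For fixed `x`, Jensen's inequality in the independent copy `y` bounds `|F x - ∫ F|²` by `∫ |F x
  -- - F y|²`.
  rw [lintegral_prod_symm _ (by fun_prop)]
  refine lintegral_mono fun x => ?_
  simp only
  have hi : ∀ f : E → ℝ, Continuous f → (∀ y, |f y| ≤ (2 * C) ^ 2 + 2 * C) → Integrable f μ :=
    fun f hf hb => Integrable.of_bound hf.aestronglyMeasurable _ (Eventually.of_forall hb)
  have hC0 : 0 ≤ C := (norm_nonneg _).trans (hC x)
  have hb : ∀ y, ‖F x - F y‖ ≤ 2 * C := fun y =>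
    (norm_sub_le _ _).trans (by linarith [hC x, hC y])
  have hint2 : Integrable (fun y => ‖F x - F y‖ ^ 2) μ := hi _ (by fun_prop) fun y => by
    rw [abs_of_nonneg (by positivity)]
    have := pow_le_pow_left₀ (norm_nonneg _) (hb y) 2
    linarith
  have hcs := integral_mul_sq_le (ν := μ) (f := fun _ => 1) (g := fun y => ‖F x - F y‖)
    (by simp) hint2
    (hi _ (by fun_prop) fun y => by
      rw [abs_of_nonneg (by positivity), one_mul]
      have := hb y
      nlinarith)
  simp only [one_mul, one_pow, integral_const, smul_eq_mul, mul_one, probReal_univ] at hcs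
  have h1 : ‖F x - ∫ y, F y ∂μ‖ ≤ ∫ y, ‖F x - F y‖ ∂μ := by
    have : F x - ∫ y, F y ∂μ = ∫ y, (F x - F y) ∂μ := by
      rw [integral_sub (integrable_const _) hFi]; simp
    rw [this]
    exact norm_integral_le_integral_norm _
  have h2 := ENNReal.ofReal_le_ofReal ((pow_le_pow_left₀ (norm_nonneg _) h1 2).trans hcs)
  rw [ofReal_integral_eq_lintegral_ofReal hint2 (Eventually.of_forall fun _ => by positivity)] at h2
  simpa only [ENNReal.ofReal_pow (norm_nonneg _), ofReal_norm] using h2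

end Gaussian

end SpinReservoir

end

noncomputable section

namespace SpinReservoir

open scoped Matrix.Norms.L2Operator

/-! ### Diagonalized matrices and resolvents -/

section Diagonalization

variable {ι : Type*} [Fintype ι] [DecidableEq ι]

theorem sum_norm_sq_col_le (X : Matrix ι ι ℂ) (q : ι) : ∑ p, ‖X p q‖ ^ 2 ≤ ‖X‖ ^ 2 := by
  have h := Matrix.l2_opNorm_mulVec X (EuclideanSpace.single q 1)
  rw [PiLp.norm_single, norm_one, mul_one, EuclideanSpace.norm_eq] at h
  have h2 := pow_le_pow_left₀ (Real.sqrt_nonneg _) h 2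
  rw [Real.sq_sqrt (Finset.sum_nonneg fun _ _ => by positivity)] at h2
  simpa using h2

theorem norm_entry_le (X : Matrix ι ι ℂ) (p q : ι) : ‖X p q‖ ≤ ‖X‖ := by
  have h := (Finset.single_le_sum (f := fun p => ‖X p q‖ ^ 2) (fun _ _ => by positivity)
    (Finset.mem_univ p)).trans (sum_norm_sq_col_le X q)
  exact le_of_sq_le_sq h (norm_nonneg _)

theorem norm_trace_le (X : Matrix ι ι ℂ) : ‖X.trace‖ ≤ Fintype.card ι * ‖X‖ := by
  refine (norm_sum_le _ _).trans ((Finset.sum_le_sum fun p _ => norm_entry_le X p p).trans_eq ?_)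
  simp

/-- The matrix `U diag(ψ) U*`. -/
def udiag (U : Matrix.unitaryGroup ι ℂ) (ψ : ι → ℂ) : Matrix ι ι ℂ :=
  (U : Matrix ι ι ℂ) * Matrix.diagonal ψ * star (U : Matrix ι ι ℂ)

variable (U : Matrix.unitaryGroup ι ℂ)

theorem udiag_apply (ψ : ι → ℂ) (p q : ι) :
    udiag U ψ p q = ∑ k, (U : Matrix ι ι ℂ) p k * ψ k * star ((U : Matrix ι ι ℂ) q k) := by
  rw [udiag, Matrix.mul_apply]
  simp [Matrix.mul_diagonal, Matrix.star_apply]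

theorem udiag_mul (φ ψ : ι → ℂ) : udiag U φ * udiag U ψ = udiag U (fun k => φ k * ψ k) := by
  unfold udiag
  rw [← Matrix.diagonal_mul_diagonal]
  have h : star (U : Matrix ι ι ℂ) * (U : Matrix ι ι ℂ) = 1 := Unitary.coe_star_mul_self U
  calc _ = (U : Matrix ι ι ℂ) * Matrix.diagonal φ * (star (U : Matrix ι ι ℂ) * U)
        * Matrix.diagonal ψ * star (U : Matrix ι ι ℂ) := by noncomm_ring
    _ = _ := by rw [h]; noncomm_ring

theorem udiag_const (c : ℂ) : udiag U (fun _ => c) = c • (1 : Matrix ι ι ℂ) := by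
  have h : (U : Matrix ι ι ℂ) * star (U : Matrix ι ι ℂ) = 1 := Unitary.coe_mul_star_self U
  have : Matrix.diagonal (fun _ : ι => c) = c • (1 : Matrix ι ι ℂ) := by
    rw [Matrix.smul_one_eq_diagonal]
  rw [udiag, this, Matrix.mul_smul, mul_one, Matrix.smul_mul, h]

theorem udiag_sub (φ ψ : ι → ℂ) : udiag U (fun k => φ k - ψ k) = udiag U φ - udiag U ψ := by
  unfold udiag
  rw [← Matrix.diagonal_sub, mul_sub, sub_mul]

theorem norm_udiag_le {ψ : ι → ℂ} {C : ℝ} (hC : 0 ≤ C) (h : ∀ k, ‖ψ k‖ ≤ C) :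
    ‖udiag U ψ‖ ≤ C := by
  have e : udiag U ψ = ((U : Matrix ι ι ℂ) * Matrix.diagonal ψ)
      * ((star U : Matrix.unitaryGroup ι ℂ) : Matrix ι ι ℂ) := rfl
  rw [e, CStarRing.norm_mul_coe_unitary, CStarRing.norm_coe_unitary_mul,
    Matrix.l2_opNorm_diagonal]
  exact (pi_norm_le_iff_of_nonneg hC).2 h

theorem trace_udiag (ψ : ι → ℂ) : (udiag U ψ).trace = ∑ k, ψ k := by
  have h : star (U : Matrix ι ι ℂ) * (U : Matrix ι ι ℂ) = 1 := Unitary.coe_star_mul_self U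
  rw [udiag, Matrix.trace_mul_comm, ← mul_assoc, h, one_mul, Matrix.trace_diagonal]

/-- The resolvent `(H - z)⁻¹`. -/
def green (H : Matrix ι ι ℂ) (z : ℂ) : Matrix ι ι ℂ := (H - z • (1 : Matrix ι ι ℂ))⁻¹

theorem eq_udiag {H : Matrix ι ι ℂ} (hH : H.IsHermitian) :
    H = udiag hH.eigenvectorUnitary fun k => (hH.eigenvalues k : ℂ) := by
  conv_lhs => rw [hH.spectral_theorem, Unitary.conjStarAlgAut_apply]
  rfl

variable {U}

theorem sub_smul_mul_udiag {H : Matrix ι ι ℂ} {d : ι → ℝ} (h : H = udiag U fun k => (d k : ℂ))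
    {z : ℂ} (hz : z.im ≠ 0) :
    (H - z • (1 : Matrix ι ι ℂ)) * udiag U (fun k => 1 / ((d k : ℂ) - z)) = 1 := by
  rw [h, ← udiag_const U z, ← udiag_sub, udiag_mul]
  have : (fun k => ((d k : ℂ) - z) * (1 / ((d k : ℂ) - z))) = fun _ => (1 : ℂ) := by
    funext k
    exact mul_one_div_cancel (ofReal_sub_ne_zero hz (d k))
  rw [this, udiag_const, one_smul]

theorem green_eq_udiag {H : Matrix ι ι ℂ} {d : ι → ℝ} (h : H = udiag U fun k => (d k : ℂ))
    {z : ℂ} (hz : z.im ≠ 0) : green H z = udiag U (fun k => 1 / ((d k : ℂ) - z)) :=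
  Matrix.inv_eq_right_inv (sub_smul_mul_udiag h hz)

theorem isUnit_sub_smul {H : Matrix ι ι ℂ} (hH : H.IsHermitian) {z : ℂ} (hz : z.im ≠ 0) :
    IsUnit (H - z • (1 : Matrix ι ι ℂ)) := by
  have h := sub_smul_mul_udiag (eq_udiag hH) hz
  exact ⟨⟨_, _, h, mul_eq_one_comm.1 h⟩, rfl⟩

theorem mul_green {H : Matrix ι ι ℂ} (hH : H.IsHermitian) {z : ℂ} (hz : z.im ≠ 0) :
    (H - z • (1 : Matrix ι ι ℂ)) * green H z = 1 :=
  Matrix.mul_nonsing_inv _ ((Matrix.isUnit_iff_isUnit_det _).1 (isUnit_sub_smul hH hz))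

theorem green_mul {H : Matrix ι ι ℂ} (hH : H.IsHermitian) {z : ℂ} (hz : z.im ≠ 0) :
    green H z * (H - z • (1 : Matrix ι ι ℂ)) = 1 :=
  Matrix.nonsing_inv_mul _ ((Matrix.isUnit_iff_isUnit_det _).1 (isUnit_sub_smul hH hz))

theorem norm_green_le {H : Matrix ι ι ℂ} (hH : H.IsHermitian) {z : ℂ} (hz : z.im ≠ 0) :
    ‖green H z‖ ≤ |z.im|⁻¹ := by
  rw [green_eq_udiag (eq_udiag hH) hz]
  exact norm_udiag_le _ (by positivity) fun k => norm_kernel_le hz _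

theorem green_sub_green {H K : Matrix ι ι ℂ} (hH : H.IsHermitian) (hK : K.IsHermitian) {z : ℂ}
    (hz : z.im ≠ 0) : green H z - green K z = green H z * (K - H) * green K z := by
  have e : K - H = (K - z • (1 : Matrix ι ι ℂ)) - (H - z • (1 : Matrix ι ι ℂ)) := by abel
  rw [e, mul_sub, sub_mul, mul_assoc, mul_green hK hz, green_mul hH hz, mul_one, one_mul]

theorem udiag_isHermitian (U : Matrix.unitaryGroup ι ℂ) (d : ι → ℝ) :
    (udiag U fun k => (d k : ℂ)).IsHermitian := by
  rw [Matrix.IsHermitian, udiag, Matrix.conjTranspose_mul, Matrix.conjTranspose_mul,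
    Matrix.diagonal_conjTranspose, ← Matrix.star_eq_conjTranspose, ← Matrix.star_eq_conjTranspose,
    star_star, mul_assoc]
  congr 3
  funext k
  simp

/-! ### Perturbation of eigenvalue sums -/

variable {V : Matrix.unitaryGroup ι ℂ} {lam a : ι → ℝ} {B : Matrix ι ι ℂ} {C : ℝ}

/-- Each sum is the dimension minus `η` times the imaginary part of the trace of the resolvent at
`iη`. The resolvent identity bounds the difference of the resolvents by `C/η²` in norm, and the
trace costs the dimension. -/
theorem sum_tailWeight_le (h : udiag U (fun k => (lam k : ℂ)) = udiag V (fun k => (a k : ℂ)) + B)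
    (hB : ‖B‖ ≤ C) {η : ℝ} (hη : 0 < η) :
    ∑ k, tailWeight η (lam k) ≤ ∑ k, tailWeight η (a k) + Fintype.card ι * (C / η) := by
  have hz : ((η : ℂ) * Complex.I).im ≠ 0 := by simpa using hη.ne'
  have hs : ∀ (W : Matrix.unitaryGroup ι ℂ) (d : ι → ℝ), ∑ k, tailWeight η (d k)
      = Fintype.card ι - η * ((green (udiag W fun k => (d k : ℂ)) (η * Complex.I)).trace).im := by
    intro W d
    rw [green_eq_udiag rfl hz, trace_udiag, Complex.im_sum, Finset.mul_sum]
    simp only [tailWeight_eq hη]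
    rw [Finset.sum_sub_distrib]
    simp
  rw [hs U, hs V]
  set H := udiag U (fun k => (lam k : ℂ))
  set K := udiag V (fun k => (a k : ℂ))
  have hH : H.IsHermitian := udiag_isHermitian U lam
  have hK : K.IsHermitian := udiag_isHermitian V a
  have hd : ‖green H (η * Complex.I) - green K (η * Complex.I)‖ ≤ C / η ^ 2 := by
    have hg : ∀ M : Matrix ι ι ℂ, M.IsHermitian → ‖green M (η * Complex.I)‖ ≤ η⁻¹ := fun M hM => by
      have := norm_green_le hM hz
      simpa [abs_of_pos hη] using this
    have e : K - H = -B := by rw [h]; abel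
    rw [green_sub_green hH hK hz, e]
    calc _ ≤ ‖green H (η * Complex.I)‖ * ‖-B‖ * ‖green K (η * Complex.I)‖ :=
          (norm_mul_le _ _).trans (by gcongr; exact norm_mul_le _ _)
      _ ≤ η⁻¹ * C * η⁻¹ := by
          rw [norm_neg]
          have := (norm_nonneg B).trans hB
          gcongr
          exacts [hg H hH, hg K hK]
      _ = C / η ^ 2 := by field_simp
  have ht : |(green H (η * Complex.I)).trace.im - (green K (η * Complex.I)).trace.im|
      ≤ Fintype.card ι * (C / η ^ 2) := by
    rw [← Complex.sub_im, ← Matrix.trace_sub]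
    exact (Complex.abs_im_le_norm _).trans ((norm_trace_le _).trans (by gcongr))
  have h1 := mul_le_mul_of_nonneg_left (neg_le_of_abs_le ht) hη.le
  have e : η * -(Fintype.card ι * (C / η ^ 2)) = -(Fintype.card ι * (C / η)) := by field_simp
  rw [e] at h1
  linarith

theorem sum_norm_sq_row (W : Matrix.unitaryGroup ι ℂ) (k : ι) :
    ∑ j, ‖(W : Matrix ι ι ℂ) k j‖ ^ 2 = 1 := by
  have h : (W : Matrix ι ι ℂ) * star (W : Matrix ι ι ℂ) = 1 := Unitary.coe_mul_star_self W
  have h2 := congrFun (congrFun h k) k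
  rw [Matrix.mul_apply, Matrix.one_apply_eq] at h2
  simp only [Matrix.star_apply] at h2
  have h3 : ∀ j, (W : Matrix ι ι ℂ) k j * star ((W : Matrix ι ι ℂ) k j)
      = ((‖(W : Matrix ι ι ℂ) k j‖ ^ 2 : ℝ) : ℂ) := fun j => by
    rw [Complex.star_def, Complex.mul_conj, Complex.normSq_eq_norm_sq]
  simp only [h3] at h2
  exact_mod_cast h2

theorem sum_norm_sq_col (W : Matrix.unitaryGroup ι ℂ) (j : ι) :
    ∑ k, ‖(W : Matrix ι ι ℂ) k j‖ ^ 2 = 1 := by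
  have := sum_norm_sq_row (star W) j
  simpa [Matrix.star_apply] using this

/-- Jensen's inequality for a convex function of the eigenvalues of a perturbed matrix. -/
theorem sum_convex_le (h : udiag U (fun k => (lam k : ℂ)) = udiag V (fun k => (a k : ℂ)) + B)
    (hB : ‖B‖ ≤ C) {ψ ψ' : ℝ → ℝ} (hψ : ConvexOn ℝ Set.univ ψ)
    (h' : ∀ x b, |b| ≤ C → ψ (x + b) ≤ ψ' x) : ∑ k, ψ (lam k) ≤ ∑ j, ψ' (a j) := by
  have hU : star (U : Matrix ι ι ℂ) * (U : Matrix ι ι ℂ) = 1 := Unitary.coe_star_mul_self U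
  set W : Matrix.unitaryGroup ι ℂ := star U * V with hW
  have hWc : (W : Matrix ι ι ℂ) = star (U : Matrix ι ι ℂ) * V := rfl
  set T : Matrix ι ι ℂ := star (U : Matrix ι ι ℂ) * B * U with hT
  have hTn : ‖T‖ = ‖B‖ := by
    have e : T = ((star U : Matrix.unitaryGroup ι ℂ) : Matrix ι ι ℂ) * B * U := rfl
    rw [e, CStarRing.norm_mul_coe_unitary, CStarRing.norm_coe_unitary_mul]
  -- The identity is read in the eigenbasis of the perturbed matrix, where its left side is
  -- diagonal.
  have hmat : Matrix.diagonal (fun k => (lam k : ℂ)) = udiag W (fun k => (a k : ℂ)) + T := by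
    have h1 := congrArg (fun X => star (U : Matrix ι ι ℂ) * X * U) h
    simp only [udiag] at h1
    have e1 : star (U : Matrix ι ι ℂ) * ((U : Matrix ι ι ℂ) * Matrix.diagonal (fun k => (lam k : ℂ))
        * star (U : Matrix ι ι ℂ)) * U = (star (U : Matrix ι ι ℂ) * U)
        * Matrix.diagonal (fun k => (lam k : ℂ)) * (star (U : Matrix ι ι ℂ) * U) := by noncomm_ring
    rw [e1, hU, one_mul, mul_one] at h1
    rw [h1, udiag, hWc, star_mul, star_star, hT]
    noncomm_ring
  -- Each `lam k` is an average of the shifted `a j` with weights `|W_{kj}|²`. The rows sum to one,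
  -- which is what Jensen's inequality needs; the columns do too, which makes the final double sum
  -- collapse.
  have hk : ∀ k, lam k = ∑ j, ‖(W : Matrix ι ι ℂ) k j‖ ^ 2 * (a j + (T k k).re) := by
    intro k
    have h1 := congrFun (congrFun hmat k) k
    rw [Matrix.diagonal_apply_eq, Matrix.add_apply, udiag_apply] at h1
    have h2 := congrArg Complex.re h1
    rw [Complex.ofReal_re, Complex.add_re, Complex.re_sum] at h2
    rw [h2]
    simp only [mul_add, Finset.sum_add_distrib]
    rw [← Finset.sum_mul, sum_norm_sq_row, one_mul]
    congr 1
    refine Finset.sum_congr rfl fun j _ => ?_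
    have h3 : (W : Matrix ι ι ℂ) k j * (a j : ℂ) * star ((W : Matrix ι ι ℂ) k j)
        = ((‖(W : Matrix ι ι ℂ) k j‖ ^ 2 * a j : ℝ) : ℂ) := by
      rw [mul_right_comm, Complex.star_def, Complex.mul_conj, Complex.normSq_eq_norm_sq]
      push_cast; ring
    rw [h3, Complex.ofReal_re]
  have hb : ∀ k, |(T k k).re| ≤ C := fun k =>
    (Complex.abs_re_le_norm _).trans ((norm_entry_le T k k).trans (hTn.le.trans hB))
  calc ∑ k, ψ (lam k) ≤ ∑ k, ∑ j, ‖(W : Matrix ι ι ℂ) k j‖ ^ 2 * ψ' (a j) := by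
        refine Finset.sum_le_sum fun k _ => ?_
        rw [hk k]
        have := hψ.map_sum_le (t := Finset.univ) (w := fun j => ‖(W : Matrix ι ι ℂ) k j‖ ^ 2)
          (p := fun j => a j + (T k k).re) (fun _ _ => by positivity) (sum_norm_sq_row W k)
          (fun _ _ => Set.mem_univ _)
        simp only [smul_eq_mul] at this
        refine this.trans (Finset.sum_le_sum fun j _ => ?_)
        gcongr
        exact h' _ _ (hb k)
    _ = ∑ j, ψ' (a j) := by
        rw [Finset.sum_comm]
        refine Finset.sum_congr rfl fun j _ => ?_
        rw [← Finset.sum_mul, sum_norm_sq_col, one_mul]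

end Diagonalization

end SpinReservoir

end

noncomputable section

namespace SpinReservoir

variable {n : ℕ}

/-! ### The functional calculus -/

theorem cfc_eq_udiag {ι : Type*} [Fintype ι] [DecidableEq ι] {H : Matrix ι ι ℂ}
    (hH : H.IsHermitian) (ψ : ℝ → ℝ) :
    cfc ψ H = udiag hH.eigenvectorUnitary fun k => ((ψ (hH.eigenvalues k) : ℝ) : ℂ) := by
  rw [hH.cfc_eq, Matrix.IsHermitian.cfc, Unitary.conjStarAlgAut_apply]
  rfl

theorem spectralProjection_eq_udiag {ι : Type*} [Fintype ι] [DecidableEq ι] {H : Matrix ι ι ℂ}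
    (hH : H.IsHermitian) (Δ : Set ℝ) : spectralProjection H Δ = udiag hH.eigenvectorUnitary
      fun k => ((Δ.indicator (fun _ => (1 : ℝ)) (hH.eigenvalues k) : ℝ) : ℂ) :=
  cfc_eq_udiag hH _

/-- Composition in the functional calculus; the spectrum is finite, so every function is continuous
on it, indicators included. -/
theorem spectralProjection_sub {ι : Type*} [Fintype ι] [DecidableEq ι] {H : Matrix ι ι ℂ}
    (hH : H.IsHermitian) (lam : ℝ) (Δ : Set ℝ) :
    spectralProjection ((lam : ℂ) • 1 - H) Δ = spectralProjection H ((fun x => lam - x) ⁻¹' Δ) := by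
  have h1 : (lam : ℂ) • (1 : Matrix ι ι ℂ) - H = cfc (fun x : ℝ => lam - x) H := by
    rw [cfc_eq_udiag hH]
    push_cast
    rw [udiag_sub, udiag_const, ← eq_udiag hH]
  rw [spectralProjection, h1]
  exact (cfc_comp _ _ H hH ((H.finite_real_spectrum.image _).continuousOn _)
    (H.finite_real_spectrum.continuousOn _)).symm

open scoped Matrix.Norms.L2Operator

/-! ### The matrix spectral measure -/

/-- The normalized partial trace over the second factor. -/
def ptr (X : Matrix (Fin 2 × Fin n) (Fin 2 × Fin n) ℂ) (α γ : Fin 2) : ℂ :=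
  (n : ℂ)⁻¹ * ∑ j, X (α, j) (γ, j)

theorem norm_ptr_le (X : Matrix (Fin 2 × Fin n) (Fin 2 × Fin n) ℂ) (α γ : Fin 2) :
    ‖ptr X α γ‖ ≤ ‖X‖ := by
  rw [ptr, norm_mul, norm_inv, Complex.norm_natCast]
  calc (n : ℝ)⁻¹ * ‖∑ j, X (α, j) (γ, j)‖ ≤ (n : ℝ)⁻¹ * ∑ _j : Fin n, ‖X‖ := by
        gcongr
        exact (norm_sum_le _ _).trans (Finset.sum_le_sum fun j _ => norm_entry_le X _ _)
    _ = ((n : ℝ)⁻¹ * n) * ‖X‖ := by simp [mul_assoc]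
    _ ≤ 1 * ‖X‖ := by gcongr; exact inv_mul_le_one
    _ = ‖X‖ := one_mul _

/-- The weight of the `k`-th eigenvector in the matrix spectral measure. -/
def cweight (U : Matrix.unitaryGroup (Fin 2 × Fin n) ℂ) (α γ : Fin 2) (k : Fin 2 × Fin n) : ℂ :=
  (n : ℂ)⁻¹ * ∑ j, (U : Matrix (Fin 2 × Fin n) (Fin 2 × Fin n) ℂ) (α, j) k
    * star ((U : Matrix (Fin 2 × Fin n) (Fin 2 × Fin n) ℂ) (γ, j) k)

theorem ptr_udiag (U : Matrix.unitaryGroup (Fin 2 × Fin n) ℂ) (ψ : Fin 2 × Fin n → ℂ)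
    (α γ : Fin 2) : ptr (udiag U ψ) α γ = ∑ k, cweight U α γ k * ψ k := by
  simp only [ptr, udiag_apply, cweight]
  rw [Finset.sum_comm, Finset.mul_sum]
  refine Finset.sum_congr rfl fun k _ => ?_
  rw [mul_assoc, Finset.sum_mul]
  congr 1
  exact Finset.sum_congr rfl fun j _ => by ring

/-- Writing the complex measure as finitely many point masses makes integrals against it computable
for every function, bounded or not. -/
theorem spectralMeasure_eq_sum {H : Matrix (Fin 2 × Fin n) (Fin 2 × Fin n) ℂ} (hH : H.IsHermitian)
    (α γ : Fin 2) : spectralMeasure H α γ =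
    ∑ k, VectorMeasure.dirac (hH.eigenvalues k) (cweight hH.eigenvectorUnitary α γ k) := by
  ext S hS
  have h1 : spectralMeasure H α γ S = ptr (spectralProjection H S) α γ := by
    simp [spectralMeasure, hS, ptr]
  rw [h1, spectralProjection_eq_udiag hH, ptr_udiag, FunLike.coe_sum,
    Finset.sum_apply]
  refine Finset.sum_congr rfl fun k _ => ?_
  by_cases hk : hH.eigenvalues k ∈ S
  · rw [VectorMeasure.dirac_apply_of_mem hS hk, Set.indicator_of_mem hk]; simp
  · rw [VectorMeasure.dirac_apply_of_notMem hk, Set.indicator_of_notMem hk]; simp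

theorem spectralIntegral_apply {H : Matrix (Fin 2 × Fin n) (Fin 2 × Fin n) ℂ} (hH : H.IsHermitian)
    (φ : ℝ → ℝ) (α γ : Fin 2) : spectralIntegral H φ α γ =
    ptr (udiag hH.eigenvectorUnitary fun k => ((φ (hH.eigenvalues k) : ℝ) : ℂ)) α γ := by
  rw [spectralIntegral, Matrix.of_apply, spectralMeasure_eq_sum hH, ptr_udiag,
    VectorMeasure.integral_finsetSum_vectorMeasure]
  · refine Finset.sum_congr rfl fun k _ => ?_
    rw [VectorMeasure.integral_dirac, ContinuousLinearMap.lsmul_apply, Complex.real_smul, mul_comm]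
  · intro k _
    rw [VectorMeasure.Integrable, VectorMeasure.variation_dirac]
    exact (integrable_dirac (by simp)).smul_measure (by simp)

theorem smoothedDensity_apply {H : Matrix (Fin 2 × Fin n) (Fin 2 × Fin n) ℂ} (hH : H.IsHermitian)
    (ε lam : ℝ) (α γ : Fin 2) : smoothedDensity ε lam H α γ =
    ((2 * ε : ℝ) : ℂ)⁻¹ * ptr (udiag hH.eigenvectorUnitary fun k =>
      (((Set.Ioo (lam - ε) (lam + ε)).indicator (fun _ => (1 : ℝ)) (hH.eigenvalues k) : ℝ) : ℂ))
      α γ := by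
  have h2 : (fun x => lam - x) ⁻¹' Set.Ioo (-ε) ε = Set.Ioo (lam - ε) (lam + ε) := by
    ext x
    simp only [Set.mem_preimage, Set.mem_Ioo]
    constructor <;> rintro ⟨h1, h2⟩ <;> constructor <;> linarith
  rw [smoothedDensity, Matrix.of_apply, spectralProjection_sub hH, h2,
    spectralProjection_eq_udiag hH, ptr, mul_inv]
  push_cast
  ring

/-! ### Directional spectral measures -/

/-- The weight of the `k`-th eigenvector in the direction `u`. -/
def dweight (U : Matrix.unitaryGroup (Fin 2 × Fin n) ℂ) (u : Fin 2 → ℂ) (k : Fin 2 × Fin n) : ℝ :=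
  (n : ℝ)⁻¹ * ∑ j, ‖∑ α, star (u α) * (U : Matrix (Fin 2 × Fin n) (Fin 2 × Fin n) ℂ) (α, j) k‖ ^ 2

/-- The spectral measure in the direction `u ∈ ℂ²`. -/
def dirMeasure (U : Matrix.unitaryGroup (Fin 2 × Fin n) ℂ) (lam : Fin 2 × Fin n → ℝ)
    (u : Fin 2 → ℂ) : Measure ℝ :=
  ∑ k, ENNReal.ofReal (dweight U u k) • Measure.dirac (lam k)

variable (U : Matrix.unitaryGroup (Fin 2 × Fin n) ℂ) (lam : Fin 2 × Fin n → ℝ) (u : Fin 2 → ℂ)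

theorem dweight_nonneg (k : Fin 2 × Fin n) : 0 ≤ dweight U u k := by unfold dweight; positivity

instance : IsFiniteMeasure (dirMeasure U lam u) := by
  constructor
  rw [dirMeasure, Measure.finsetSum_apply]
  simp only [Measure.smul_apply, measure_univ, smul_eq_mul, mul_one]
  exact ENNReal.sum_lt_top.2 fun k _ => ENNReal.ofReal_lt_top

theorem integral_dirMeasure {F : Type*} [NormedAddCommGroup F] [NormedSpace ℝ F] [CompleteSpace F]
    (ψ : ℝ → F) : ∫ x, ψ x ∂(dirMeasure U lam u) = ∑ k, dweight U u k • ψ (lam k) := by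
  rw [dirMeasure, integral_finsetSum_measure fun k _ =>
    (integrable_dirac (by simp)).smul_measure ENNReal.ofReal_ne_top]
  refine Finset.sum_congr rfl fun k _ => ?_
  rw [integral_smul_measure, integral_dirac, ENNReal.toReal_ofReal (dweight_nonneg U u k)]

theorem integrable_dirMeasure {F : Type*} [NormedAddCommGroup F] (ψ : ℝ → F) :
    Integrable ψ (dirMeasure U lam u) := by
  rw [dirMeasure, integrable_finsetSum_measure]
  exact fun k _ => (integrable_dirac (by simp)).smul_measure ENNReal.ofReal_ne_top

theorem dweight_eq (k : Fin 2 × Fin n) :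
    (dweight U u k : ℂ) = ∑ α, ∑ γ, star (u α) * u γ * cweight U α γ k := by
  have h : ∀ w : ℂ, ((‖w‖ ^ 2 : ℝ) : ℂ) = w * star w := fun w => by
    rw [Complex.star_def, Complex.mul_conj, Complex.normSq_eq_norm_sq]
  rw [dweight]
  push_cast
  simp only [← Complex.ofReal_pow, h, cweight, Fin.sum_univ_two, Finset.mul_sum,
    ← Finset.sum_add_distrib, star_add, star_mul', star_star]
  refine Finset.sum_congr rfl fun j _ => ?_
  ring

/-- The directional measure is the sesquilinear form of the matrix measure at `u`; this links
positive measures to the complex entries. -/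
theorem integral_dirMeasure_complex (ψ : ℝ → ℂ) : ∫ x, ψ x ∂(dirMeasure U lam u) =
    ∑ α, ∑ γ, star (u α) * u γ * ptr (udiag U fun k => ψ (lam k)) α γ := by
  rw [integral_dirMeasure]
  simp only [Complex.real_smul, dweight_eq, ptr_udiag, Finset.sum_mul, Finset.mul_sum]
  rw [Finset.sum_comm]
  refine Finset.sum_congr rfl fun α _ => ?_
  rw [Finset.sum_comm]
  exact Finset.sum_congr rfl fun γ _ => Finset.sum_congr rfl fun k _ => by ring

theorem ofReal_integral_dirMeasure (ψ : ℝ → ℝ) : ((∫ x, ψ x ∂(dirMeasure U lam u) : ℝ) : ℂ) =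
    ∑ α, ∑ γ, star (u α) * u γ * ptr (udiag U fun k => ((ψ (lam k) : ℝ) : ℂ)) α γ := by
  rw [← integral_dirMeasure_complex U lam u fun x => ((ψ x : ℝ) : ℂ)]
  exact integral_ofReal.symm

variable {u}

theorem isProbabilityMeasure_dirMeasure (hn : n ≠ 0) (hu : ∑ α, ‖u α‖ ^ 2 = 1) :
    IsProbabilityMeasure (dirMeasure U lam u) := by
  have h := ofReal_integral_dirMeasure U lam u fun _ => 1
  have hp : ∀ α γ : Fin 2, ptr (1 : Matrix (Fin 2 × Fin n) (Fin 2 × Fin n) ℂ) α γ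
      = if α = γ then 1 else 0 := by
    intro α γ
    have hn' : (n : ℂ) ≠ 0 := by exact_mod_cast hn
    by_cases hαγ : α = γ
    · subst hαγ; simp [ptr, hn']
    · simp [ptr, hαγ]
  have h1 : ((∑ α, ‖u α‖ ^ 2 : ℝ) : ℂ) = 1 := by rw [hu]; simp
  rw [Complex.ofReal_one, udiag_const, one_smul] at h
  simp only [hp, Fin.sum_univ_two] at h h1
  have h2 : ∀ w : ℂ, star w * w = ((‖w‖ ^ 2 : ℝ) : ℂ) := fun w => by
    rw [Complex.star_def, mul_comm, Complex.mul_conj, Complex.normSq_eq_norm_sq]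
  simp only [if_true, mul_one, Fin.isValue, zero_ne_one, one_ne_zero, if_false, mul_zero, add_zero,
    zero_add, h2] at h
  rw [← Complex.ofReal_add, Complex.ofReal_inj] at h
  rw [integral_const, smul_eq_mul, mul_one] at h
  rw [← Complex.ofReal_one, Complex.ofReal_inj] at h1
  rw [h1] at h
  constructor
  rw [measureReal_def] at h
  rw [← ENNReal.ofReal_toReal (measure_ne_top (dirMeasure U lam u) Set.univ), h,
    ENNReal.ofReal_one]

/-- Cauchy–Schwarz in `ℂ²` and the unit length of the eigenvectors. The directional measures are
thus dominated by the eigenvalue counting sum, uniformly in `u`. -/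
theorem dweight_le (hu : ∑ α, ‖u α‖ ^ 2 = 1) (k : Fin 2 × Fin n) :
    dweight U u k ≤ (n : ℝ)⁻¹ := by
  have h := sum_norm_sq_col U k
  rw [Fintype.sum_prod_type_right] at h
  calc dweight U u k ≤ (n : ℝ)⁻¹ * ∑ j, ∑ α,
        ‖(U : Matrix (Fin 2 × Fin n) (Fin 2 × Fin n) ℂ) (α, j) k‖ ^ 2 := by
        unfold dweight
        gcongr with j _
        have h1 : ‖∑ α, star (u α) * (U : Matrix (Fin 2 × Fin n) (Fin 2 × Fin n) ℂ) (α, j) k‖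
            ≤ ∑ α, ‖u α‖ * ‖(U : Matrix (Fin 2 × Fin n) (Fin 2 × Fin n) ℂ) (α, j) k‖ :=
          (norm_sum_le _ _).trans_eq (Finset.sum_congr rfl fun α _ => by rw [norm_mul, norm_star])
        refine (pow_le_pow_left₀ (norm_nonneg _) h1 2).trans ?_
        refine (Finset.sum_mul_sq_le_sq_mul_sq _ _ _).trans_eq ?_
        rw [hu, one_mul]
    _ = (n : ℝ)⁻¹ := by rw [h, mul_one]

theorem integral_dirMeasure_le (hu : ∑ α, ‖u α‖ ^ 2 = 1) {ψ : ℝ → ℝ} (hψ : ∀ x, 0 ≤ ψ x) :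
    ∫ x, ψ x ∂(dirMeasure U lam u) ≤ (n : ℝ)⁻¹ * ∑ k, ψ (lam k) := by
  rw [integral_dirMeasure, Finset.mul_sum]
  refine Finset.sum_le_sum fun k _ => ?_
  rw [smul_eq_mul]
  exact mul_le_mul_of_nonneg_right (dweight_le U hu k) (hψ _)

/-! ### The Hamiltonian -/

/-- `P` has at most one nonzero entry, of modulus at most one, in each row and column, so the block
`α` of the image of `x` is `c α` times `M` applied to the block `π α` of `x`. This form covers the
Pauli matrices, the identity and the matrix units. -/
theorem norm_kronecker_le {P : Matrix (Fin 2) (Fin 2) ℂ} (π : Equiv.Perm (Fin 2)) {c : Fin 2 → ℂ}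
    (hP : ∀ α γ, P α γ = if γ = π α then c α else 0) (hc : ∀ α, ‖c α‖ ≤ 1)
    (M : Matrix (Fin n) (Fin n) ℂ) : ‖P ⊗ₖ M‖ ≤ ‖M‖ := by
  rw [Matrix.l2_opNorm_def]
  refine ContinuousLinearMap.opNorm_le_bound _ (norm_nonneg _) fun x => ?_
  refine le_of_sq_le_sq ?_ (by positivity)
  rw [mul_pow, EuclideanSpace.norm_sq_eq, EuclideanSpace.norm_sq_eq]
  set y : Fin 2 → EuclideanSpace ℂ (Fin n) := fun α => WithLp.toLp 2 fun j => x (α, j) with hy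
  have hentry : ∀ α i, ((P ⊗ₖ M).mulVec x.ofLp) (α, i) = c α * (M.mulVec (y (π α)).ofLp) i := by
    intro α i
    simp only [Matrix.mulVec, dotProduct, Matrix.kronecker_apply, Fintype.sum_prod_type, hP, hy]
    rw [Finset.sum_comm, Finset.mul_sum]
    refine Finset.sum_congr rfl fun j _ => ?_
    rw [Finset.sum_eq_single (π α)]
    · simp; ring
    · intro b _ hb; simp [hb]
    · simp
  have hM : ∀ α, ∑ i, ‖(M.mulVec (y (π α)).ofLp) i‖ ^ 2
      ≤ ‖M‖ ^ 2 * ∑ j, ‖x (π α, j)‖ ^ 2 := by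
    intro α
    have h := pow_le_pow_left₀ (norm_nonneg _) (Matrix.l2_opNorm_mulVec M (y (π α))) 2
    rw [mul_pow, EuclideanSpace.norm_sq_eq, EuclideanSpace.norm_sq_eq] at h
    exact h
  have e1 : ∀ p : Fin 2 × Fin n, ((LinearMap.toContinuousLinearMap
      (Matrix.toEuclideanLin (P ⊗ₖ M))) x).ofLp p = ((P ⊗ₖ M).mulVec x.ofLp) p := fun p => rfl
  rw [Fintype.sum_prod_type, Fintype.sum_prod_type]
  calc _ ≤ ∑ α, ‖M‖ ^ 2 * ∑ j, ‖x (π α, j)‖ ^ 2 := by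
        refine Finset.sum_le_sum fun α _ => ?_
        refine le_trans (Finset.sum_le_sum fun i _ => ?_) (hM α)
        have e2 := (e1 (α, i)).trans (hentry α i)
        refine pow_le_pow_left₀ (norm_nonneg _) ?_ 2
        refine (congrArg norm e2).le.trans ?_
        rw [norm_mul]
        exact mul_le_of_le_one_left (norm_nonneg _) (hc α)
    _ = _ := by
        rw [← Finset.mul_sum]
        congr 1
        exact Equiv.sum_comp π fun α => ∑ j, ‖x (α, j)‖ ^ 2

theorem norm_pauliX_kronecker_le (M : Matrix (Fin n) (Fin n) ℂ) : ‖pauliX ⊗ₖ M‖ ≤ ‖M‖ :=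
  norm_kronecker_le (Equiv.swap 0 1) (c := fun _ => 1)
    (fun α γ => by fin_cases α <;> fin_cases γ <;> simp [pauliX]) (fun _ => by simp) M

theorem norm_pauliZ_kronecker_one_le :
    ‖pauliZ ⊗ₖ (1 : Matrix (Fin n) (Fin n) ℂ)‖ ≤ 1 := by
  refine (norm_kronecker_le (Equiv.refl _) (c := fun α => (sgn α : ℂ))
    (fun α γ => by fin_cases α <;> fin_cases γ <;> simp [pauliZ, sgn])
    (fun α => by fin_cases α <;> simp [sgn]) _).trans ?_
  rw [← Matrix.diagonal_one, Matrix.l2_opNorm_diagonal]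
  exact (pi_norm_le_iff_of_nonneg zero_le_one).2 fun i => by simp

theorem pauliX_isHermitian : pauliX.IsHermitian := by
  ext i j; fin_cases i <;> fin_cases j <;> simp [pauliX]

theorem pauliZ_isHermitian : pauliZ.IsHermitian := by
  ext i j; fin_cases i <;> fin_cases j <;> simp [pauliZ]

theorem kronecker_isHermitian {P : Matrix (Fin 2) (Fin 2) ℂ} {M : Matrix (Fin n) (Fin n) ℂ}
    (hP : P.IsHermitian) (hM : M.IsHermitian) : (P ⊗ₖ M).IsHermitian := by
  rw [Matrix.IsHermitian, Matrix.conjTranspose_kronecker, hP, hM]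

theorem ofReal_smul_isHermitian {ι : Type*} {M : Matrix ι ι ℂ} (c : ℝ) (hM : M.IsHermitian) :
    ((c : ℂ) • M).IsHermitian := by
  rw [Matrix.IsHermitian, Matrix.conjTranspose_smul, hM]
  simp

theorem hamiltonian_isHermitian (s v : ℝ) {h w : Matrix (Fin n) (Fin n) ℂ} (hh : h.IsHermitian)
    (hw : w.IsHermitian) : (hamiltonian s v h w).IsHermitian :=
  ((ofReal_smul_isHermitian s (kronecker_isHermitian pauliZ_isHermitian
    Matrix.isHermitian_one)).add (kronecker_isHermitian Matrix.isHermitian_one hh)).add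
    (ofReal_smul_isHermitian _ (kronecker_isHermitian pauliX_isHermitian hw))

theorem exists_hamiltonian_eq (s v : ℝ) {h : Matrix (Fin n) (Fin n) ℂ}
    (hh : h.IsHermitian) (w : Matrix (Fin n) (Fin n) ℂ) :
    ∃ (V : Matrix.unitaryGroup (Fin 2 × Fin n) ℂ) (B : Matrix (Fin 2 × Fin n) (Fin 2 × Fin n) ℂ),
      hamiltonian s v h w = udiag V (fun k => (hh.eigenvalues k.2 : ℂ)) + B ∧
      ‖B‖ ≤ |s| + |v / √(n : ℝ)| * ‖w‖ := by
  refine ⟨⟨(1 : Matrix (Fin 2) (Fin 2) ℂ) ⊗ₖ (hh.eigenvectorUnitary : Matrix (Fin n) (Fin n) ℂ),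
    Matrix.kronecker_mem_unitary (one_mem _) hh.eigenvectorUnitary.2⟩,
    (s : ℂ) • (pauliZ ⊗ₖ (1 : Matrix (Fin n) (Fin n) ℂ))
      + ((v / √(n : ℝ) : ℝ) : ℂ) • (pauliX ⊗ₖ w), ?_, ?_⟩
  · have e : udiag ⟨(1 : Matrix (Fin 2) (Fin 2) ℂ) ⊗ₖ
        (hh.eigenvectorUnitary : Matrix (Fin n) (Fin n) ℂ),
        Matrix.kronecker_mem_unitary (one_mem _) hh.eigenvectorUnitary.2⟩
        (fun k : Fin 2 × Fin n => (hh.eigenvalues k.2 : ℂ))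
        = (1 : Matrix (Fin 2) (Fin 2) ℂ) ⊗ₖ h := by
      conv_rhs => rw [eq_udiag hh]
      have hd : Matrix.diagonal (fun k : Fin 2 × Fin n => (hh.eigenvalues k.2 : ℂ))
          = (1 : Matrix (Fin 2) (Fin 2) ℂ) ⊗ₖ Matrix.diagonal fun k => (hh.eigenvalues k : ℂ) := by
        rw [← Matrix.diagonal_one, Matrix.diagonal_kronecker_diagonal]
        simp
      rw [udiag, udiag, hd, Matrix.star_eq_conjTranspose, Matrix.conjTranspose_kronecker,
        ← Matrix.mul_kronecker_mul, ← Matrix.mul_kronecker_mul]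
      simp [Matrix.star_eq_conjTranspose]
    rw [e, hamiltonian]
    abel
  · refine (norm_add_le _ _).trans ?_
    rw [norm_smul, norm_smul, Complex.norm_real, Complex.norm_real, Real.norm_eq_abs,
      Real.norm_eq_abs]
    gcongr
    · exact mul_le_of_le_one_right (abs_nonneg _) norm_pauliZ_kronecker_one_le
    · exact norm_pauliX_kronecker_le w

theorem integral_countingMeasure {h : Matrix (Fin n) (Fin n) ℂ} (hh : h.IsHermitian)
    (ψ : ℝ → ℝ) : ∫ x, ψ x ∂(countingMeasure hh) = (n : ℝ)⁻¹ * ∑ j, ψ (hh.eigenvalues j) := by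
  rw [countingMeasure, integral_smul_measure, integral_finsetSum_measure fun k _ =>
    integrable_dirac (by simp)]
  simp

theorem isProbabilityMeasure_countingMeasure {h : Matrix (Fin n) (Fin n) ℂ} (hh : h.IsHermitian)
    (hn : n ≠ 0) : IsProbabilityMeasure (countingMeasure hh) := by
  constructor
  rw [countingMeasure, Measure.smul_apply, Measure.finsetSum_apply]
  simp only [measure_univ, Finset.sum_const, Finset.card_univ, Fintype.card_fin, smul_eq_mul,
    nsmul_eq_mul, mul_one]
  exact ENNReal.inv_mul_cancel (by exact_mod_cast hn) (ENNReal.natCast_ne_top n)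

/-- In `1 ⊗ h` every eigenvalue of `h` occurs twice. -/
theorem sum_eigenvalues_snd {h : Matrix (Fin n) (Fin n) ℂ} (hh : h.IsHermitian) (ψ : ℝ → ℝ) :
    (n : ℝ)⁻¹ * ∑ k : Fin 2 × Fin n, ψ (hh.eigenvalues k.2)
      = 2 * ∫ x, ψ x ∂(countingMeasure hh) := by
  rw [integral_countingMeasure, Fintype.sum_prod_type]
  simp
  ring

end SpinReservoir

end

noncomputable section

namespace SpinReservoir

open scoped Matrix.Norms.L2Operator

/-! ### Uniform integrability and weak convergence -/

/-- Split `g = min(g, K) + (g - K)⁺`. Weak convergence handles the bounded part; the excess is small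
along the sequence by assumption and under the limit by a Fatou inequality for weakly convergent
measures. -/
theorem integrable_and_tendsto_integral {μ : ℕ → ProbabilityMeasure ℝ} {ρ : ProbabilityMeasure ℝ}
    (hμ : Tendsto μ atTop (𝓝 ρ)) {g : ℝ → ℝ} (hg : Continuous g) (hg0 : ∀ x, 0 ≤ g x)
    (hgi : ∀ n, Integrable g (μ n : Measure ℝ))
    (hK : ∀ ε : ℝ, 0 < ε → ∃ K : ℝ, 0 ≤ K ∧
      ∀ᶠ n in atTop, ∫ x, max (g x - K) 0 ∂(μ n : Measure ℝ) ≤ ε) :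
    Integrable g (ρ : Measure ℝ) ∧
      Tendsto (fun n => ∫ x, g x ∂(μ n : Measure ℝ)) atTop (𝓝 (∫ x, g x ∂(ρ : Measure ℝ))) := by
  have hcont : ∀ K : ℝ, Continuous fun x => max (g x - K) 0 := fun K => by fun_prop
  have hi : ∀ K n, Integrable (fun x => max (g x - K) 0) (μ n : Measure ℝ) := fun K n =>
    ((hgi n).sub (integrable_const K)).sup (integrable_const 0)
  have hfatou : ∀ (ε : ℝ) (K : ℝ), 0 < ε →
      (∀ᶠ n in atTop, ∫ x, max (g x - K) 0 ∂(μ n : Measure ℝ) ≤ ε) →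
      ∫⁻ x, ENNReal.ofReal (max (g x - K) 0) ∂(ρ : Measure ℝ) ≤ ENNReal.ofReal ε := by
    intro ε K hε hev
    refine (lintegral_le_liminf_lintegral_of_forall_isOpen_measure_le_liminf_measure (hcont K)
      (fun x => le_max_right _ _) (μs := fun n => (μ n : Measure ℝ)) fun G hG =>
        ProbabilityMeasure.le_liminf_measure_open_of_tendsto hμ hG).trans ?_
    refine liminf_le_of_le (by isBoundedDefault) fun b hb => ?_
    obtain ⟨n, hn, hbn⟩ := (hev.and hb).exists
    refine hbn.trans ?_
    rw [← ofReal_integral_eq_lintegral_ofReal (hi K n)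
      (Eventually.of_forall fun x => le_max_right _ _)]
    exact ENNReal.ofReal_le_ofReal hn
  have hiρ : ∀ (ε : ℝ) (K : ℝ), 0 < ε →
      (∀ᶠ n in atTop, ∫ x, max (g x - K) 0 ∂(μ n : Measure ℝ) ≤ ε) →
      Integrable (fun x => max (g x - K) 0) (ρ : Measure ℝ) := by
    intro ε K hε hev
    refine ⟨(hcont K).aestronglyMeasurable, ?_⟩
    rw [hasFiniteIntegral_iff_ofReal (Eventually.of_forall fun x => le_max_right (g x - K) (0 : ℝ))]
    exact (hfatou ε K hε hev).trans_lt ENNReal.ofReal_lt_top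
  have hmin : ∀ K : ℝ, 0 ≤ K → ∃ φ : ℝ →ᵇ ℝ, ∀ x, φ x = min (g x) K := fun K hK0 =>
    ⟨BoundedContinuousFunction.ofNormedAddCommGroup (fun x => min (g x) K) (by fun_prop) K
      fun x => by
        rw [Real.norm_of_nonneg (le_min (hg0 x) hK0)]
        exact min_le_right _ _, fun _ => rfl⟩
  have hsplit : ∀ K x, g x = min (g x) K + max (g x - K) 0 := by
    intro K x
    rcases le_total (g x) K with h | h
    · rw [min_eq_left h, max_eq_right (by linarith), add_zero]
    · rw [min_eq_right h, max_eq_left (by linarith)]; ring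
  have hgρ : Integrable g (ρ : Measure ℝ) := by
    obtain ⟨K, hK0, hev⟩ := hK 1 one_pos
    obtain ⟨φ, hφ⟩ := hmin K hK0
    have := (φ.integrable (ρ : Measure ℝ)).add (hiρ 1 K one_pos hev)
    refine this.congr (Eventually.of_forall fun x => ?_)
    simp only [Pi.add_apply, hφ]
    exact (hsplit K x).symm
  refine ⟨hgρ, ?_⟩
  rw [Metric.tendsto_atTop']
  intro ε hε
  obtain ⟨K, hK0, hev⟩ := hK (ε / 4) (by positivity)
  obtain ⟨φ, hφ⟩ := hmin K hK0
  have hφlim := (ProbabilityMeasure.tendsto_iff_forall_integral_tendsto.1 hμ) φ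
  have hdecomp : ∀ σ : ProbabilityMeasure ℝ, Integrable (fun x => max (g x - K) 0) (σ : Measure ℝ) →
      ∫ x, g x ∂(σ : Measure ℝ) = ∫ x, φ x ∂(σ : Measure ℝ)
        + ∫ x, max (g x - K) 0 ∂(σ : Measure ℝ) := by
    intro σ hσ
    rw [← integral_add (φ.integrable _) hσ]
    exact integral_congr_ae (Eventually.of_forall fun x => by simp only [hφ]; exact hsplit K x)
  have hρε : ∫ x, max (g x - K) 0 ∂(ρ : Measure ℝ) ≤ ε / 4 := by
    rw [integral_eq_lintegral_of_nonneg_ae (Eventually.of_forall fun x => le_max_right (g x - K) (0 : ℝ))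
      (hcont K).aestronglyMeasurable]
    exact ENNReal.toReal_le_of_le_ofReal (by positivity) (hfatou _ K (by positivity) hev)
  have hρ0 : 0 ≤ ∫ x, max (g x - K) 0 ∂(ρ : Measure ℝ) :=
    integral_nonneg fun x => le_max_right _ _
  obtain ⟨n₀, hn₀⟩ := eventually_atTop.1
    (hev.and ((Metric.tendsto_nhds.1 hφlim) (ε / 4) (by positivity)))
  refine ⟨n₀, fun n hn => ?_⟩
  obtain ⟨h1, h2⟩ := hn₀ n hn.le
  have h0 : 0 ≤ ∫ x, max (g x - K) 0 ∂(μ n : Measure ℝ) := integral_nonneg fun x => le_max_right _ _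
  rw [Real.dist_eq] at h2 ⊢
  rw [hdecomp _ (hi K n), hdecomp ρ (hiρ _ K (by positivity) hev)]
  rw [abs_lt] at h2 ⊢
  constructor <;> linarith [h2.1, h2.2]

/-! ### Polarisation -/

/-- Four unit vectors of `ℂ²` that determine a sesquilinear form. -/
theorem tendsto_of_polarization {M : ℕ → Fin 2 → Fin 2 → ℂ} {I : Fin 2 → ℝ}
    (h : ∀ u : Fin 2 → ℂ, ∑ α, ‖u α‖ ^ 2 = 1 →
      Tendsto (fun n => ∑ α, ∑ γ, star (u α) * u γ * M n α γ) atTop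
        (𝓝 ((∑ α, ‖u α‖ ^ 2 * I α : ℝ) : ℂ))) (α γ : Fin 2) :
    Tendsto (fun n => M n α γ) atTop (𝓝 (Matrix.diagonal (fun α => (I α : ℂ)) α γ)) := by
  set r : ℝ := (√2)⁻¹ with hr
  have hr2 : r ^ 2 = 1 / 2 := by rw [hr, inv_pow, Real.sq_sqrt (by norm_num)]; norm_num
  have hrC : (r : ℂ) * r = 1 / 2 := by
    rw [← Complex.ofReal_mul, ← sq, hr2]; push_cast; rfl
  have hr0 : 0 ≤ r := by positivity
  have h0 := h ![1, 0] (by simp)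
  have h1 := h ![0, 1] (by simp)
  have h2 := h ![r, r] (by simp [Complex.norm_real, hr2]; norm_num)
  have h3 := h ![r, r * Complex.I] (by simp [Complex.norm_real, hr2]; norm_num)
  simp only [Fin.sum_univ_two, Matrix.cons_val_zero, Matrix.cons_val_one, norm_mul, Complex.norm_I,
    Complex.norm_real, mul_one, Real.norm_eq_abs, sq_abs, hr2, norm_zero, norm_one, map_zero,
    map_one, one_mul, zero_mul, mul_zero, add_zero, zero_add, one_pow, map_mul,
    Complex.star_def, Complex.conj_ofReal, Complex.conj_I, hrC, ne_eq, OfNat.ofNat_ne_zero,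
    not_false_eq_true, zero_pow] at h0 h1 h2 h3
  have e2 : ∀ n, (1 / 2 * M n 0 0 + 1 / 2 * M n 0 1 + (1 / 2 * M n 1 0 + 1 / 2 * M n 1 1))
      = (M n 0 0 + M n 1 1) / 2 + (M n 0 1 + M n 1 0) / 2 := fun n => by ring
  have e3 : ∀ n, (1 / 2 * M n 0 0 + r * (r * Complex.I) * M n 0 1 +
      (r * -Complex.I * r * M n 1 0 + r * -Complex.I * (r * Complex.I) * M n 1 1))
      = (M n 0 0 + M n 1 1) / 2 + Complex.I * (M n 0 1 - M n 1 0) / 2 := fun n => by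
    linear_combination (Complex.I * M n 0 1 - Complex.I * M n 1 0
      - Complex.I ^ 2 * M n 1 1) * hrC - 1 / 2 * M n 1 1 * Complex.I_sq
  simp only [e2] at h2
  simp only [e3] at h3
  -- The direction `(1, 1)/√2` sees the sum of the off-diagonal entries and `(1, i)/√2` their
  -- difference, once the diagonal ones are subtracted.
  have hs : Tendsto (fun n => M n 0 1 + M n 1 0) atTop (𝓝 0) := by
    have := ((h2.const_mul 2).sub h0).sub h1
    convert this using 2
    · ring
    · push_cast; ring
  have hd : Tendsto (fun n => M n 0 1 - M n 1 0) atTop (𝓝 0) := by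
    have := (((h3.const_mul 2).sub h0).sub h1).const_mul (-Complex.I)
    convert this using 2
    · linear_combination (M _ 0 1 - M _ 1 0) * Complex.I_sq
    · push_cast; ring
  fin_cases α <;> fin_cases γ
  · simpa using h0
  · have := (hs.add hd).div_const 2
    simp only [add_zero, zero_div] at this
    simp only [Fin.zero_eta, Fin.mk_one, ne_eq, zero_ne_one, not_false_eq_true,
      Matrix.diagonal_apply_ne]
    refine this.congr fun n => by ring
  · have := (hs.sub hd).div_const 2
    simp only [sub_zero, zero_div] at this
    simp only [Fin.zero_eta, Fin.mk_one, ne_eq, one_ne_zero, not_false_eq_true,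
      Matrix.diagonal_apply_ne]
    refine this.congr fun n => by ring
  · simpa using h1

/-! ### Directional measures as probability measures -/

variable {n : ℕ} {u : Fin 2 → ℂ}

/-- The spectral measure of `H` in the unit direction `u`. -/
def dirProb {H : Matrix (Fin 2 × Fin (n + 1)) (Fin 2 × Fin (n + 1)) ℂ} (hH : H.IsHermitian)
    (hu : ∑ α, ‖u α‖ ^ 2 = 1) : ProbabilityMeasure ℝ :=
  ⟨dirMeasure hH.eigenvectorUnitary hH.eigenvalues u,
    isProbabilityMeasure_dirMeasure _ _ n.succ_ne_zero hu⟩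

theorem stieltjes_dirProb {H : Matrix (Fin 2 × Fin (n + 1)) (Fin 2 × Fin (n + 1)) ℂ}
    (hH : H.IsHermitian) (hu : ∑ α, ‖u α‖ ^ 2 = 1) {z : ℂ} (hz : z.im ≠ 0) :
    stieltjes (dirProb hH hu : Measure ℝ) z
      = ∑ α, ∑ γ, star (u α) * u γ * ptr (green H z) α γ := by
  rw [green_eq_udiag (eq_udiag hH) hz]
  exact integral_dirMeasure_complex _ _ u _

/-- The mixture `∑ ‖u α‖² ν α`. -/
def mixture (ν : Fin 2 → ProbabilityMeasure ℝ) (hu : ∑ α, ‖u α‖ ^ 2 = 1) : ProbabilityMeasure ℝ :=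
  ⟨∑ α, ENNReal.ofReal (‖u α‖ ^ 2) • (ν α : Measure ℝ), by
    constructor
    rw [Measure.finsetSum_apply]
    simp only [Measure.smul_apply, measure_univ, smul_eq_mul, mul_one]
    rw [← ENNReal.ofReal_sum_of_nonneg fun _ _ => by positivity, hu, ENNReal.ofReal_one]⟩

theorem integral_mixture {F : Type*} [NormedAddCommGroup F] [NormedSpace ℝ F] [CompleteSpace F]
    (ν : Fin 2 → ProbabilityMeasure ℝ) (hu : ∑ α, ‖u α‖ ^ 2 = 1) {ψ : ℝ → F}
    (hψ : ∀ α, Integrable ψ (ν α : Measure ℝ)) :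
    ∫ x, ψ x ∂(mixture ν hu : Measure ℝ) = ∑ α, ‖u α‖ ^ 2 • ∫ x, ψ x ∂(ν α : Measure ℝ) := by
  change ∫ x, ψ x ∂(∑ α, ENNReal.ofReal (‖u α‖ ^ 2) • (ν α : Measure ℝ)) = _
  rw [integral_finsetSum_measure fun k _ => (hψ k).smul_measure ENNReal.ofReal_ne_top]
  refine Finset.sum_congr rfl fun k _ => ?_
  rw [integral_smul_measure, ENNReal.toReal_ofReal (by positivity)]

theorem mixture_apply_eq_zero (ν : Fin 2 → ProbabilityMeasure ℝ) (hu : ∑ α, ‖u α‖ ^ 2 = 1)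
    {S : Set ℝ} (h : ∀ α, (ν α : Measure ℝ) S = 0) : (mixture ν hu : Measure ℝ) S = 0 := by
  change (∑ α, ENNReal.ofReal (‖u α‖ ^ 2) • (ν α : Measure ℝ)) S = 0
  rw [Measure.finsetSum_apply]
  simp [h]

theorem sum_norm_sq_single (α : Fin 2) : ∑ γ, ‖(Pi.single α 1 : Fin 2 → ℂ) γ‖ ^ 2 = 1 := by
  fin_cases α <;> simp

theorem stieltjes_dirProb_single {H : Matrix (Fin 2 × Fin (n + 1)) (Fin 2 × Fin (n + 1)) ℂ}
    (hH : H.IsHermitian) (α : Fin 2) {z : ℂ} (hz : z.im ≠ 0) :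
    stieltjes (dirProb hH (sum_norm_sq_single α) : Measure ℝ) z = ptr (green H z) α α := by
  rw [stieltjes_dirProb hH _ hz]
  fin_cases α <;> simp [Fin.sum_univ_two]

/-- The counting measure as a probability measure. -/
def countingProb {h : Matrix (Fin (n + 1)) (Fin (n + 1)) ℂ} (hh : h.IsHermitian) :
    ProbabilityMeasure ℝ :=
  ⟨countingMeasure hh, isProbabilityMeasure_countingMeasure hh n.succ_ne_zero⟩

/-! ### Comparison of the spectral measures of the Hamiltonian and of `h` -/

theorem exists_udiag_eq {s v C : ℝ} {h w : Matrix (Fin n) (Fin n) ℂ} (hh : h.IsHermitian)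
    (hw : w.IsHermitian) (hC : |s| + |v / √(n : ℝ)| * ‖w‖ ≤ C) :
    ∃ (V : Matrix.unitaryGroup (Fin 2 × Fin n) ℂ) (B : Matrix (Fin 2 × Fin n) (Fin 2 × Fin n) ℂ),
      udiag (hamiltonian_isHermitian s v hh hw).eigenvectorUnitary
        (fun k => ((hamiltonian_isHermitian s v hh hw).eigenvalues k : ℂ))
        = udiag V (fun k => (hh.eigenvalues k.2 : ℂ)) + B ∧ ‖B‖ ≤ C := by
  obtain ⟨V, B, h1, h2⟩ := exists_hamiltonian_eq s v hh w
  exact ⟨V, B, by rw [← eq_udiag]; exact h1, h2.trans hC⟩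

theorem integral_tailWeight_dirProb_le {s v C : ℝ} {h w : Matrix (Fin (n + 1)) (Fin (n + 1)) ℂ}
    (hh : h.IsHermitian) (hw : w.IsHermitian)
    (hC : |s| + |v / √((n + 1 : ℕ) : ℝ)| * ‖w‖ ≤ C) (hu : ∑ α, ‖u α‖ ^ 2 = 1) {η : ℝ}
    (hη : 0 < η) :
    ∫ x, tailWeight η x ∂(dirProb (hamiltonian_isHermitian s v hh hw) hu : Measure ℝ)
      ≤ 2 * ∫ x, tailWeight η x ∂(countingProb hh : Measure ℝ) + 2 * (C / η) := by
  obtain ⟨V, B, h1, h2⟩ := exists_udiag_eq hh hw hC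
  refine (integral_dirMeasure_le _ _ hu (tailWeight_nonneg η)).trans ?_
  refine (mul_le_mul_of_nonneg_left (sum_tailWeight_le h1 h2 hη) (by positivity)).trans ?_
  rw [mul_add, sum_eigenvalues_snd hh (tailWeight η)]
  refine add_le_add le_rfl (le_of_eq ?_)
  have : ((n + 1 : ℕ) : ℝ) ≠ 0 := by positivity
  rw [Fintype.card_prod, Fintype.card_fin, Fintype.card_fin, Nat.cast_mul]
  field_simp
  push_cast
  ring

theorem integral_dirProb_le_of_convex {s v C : ℝ} {h w : Matrix (Fin (n + 1)) (Fin (n + 1)) ℂ}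
    (hh : h.IsHermitian) (hw : w.IsHermitian)
    (hC : |s| + |v / √((n + 1 : ℕ) : ℝ)| * ‖w‖ ≤ C) (hu : ∑ α, ‖u α‖ ^ 2 = 1) {ψ ψ' : ℝ → ℝ}
    (hψ0 : ∀ x, 0 ≤ ψ x) (hψ : ConvexOn ℝ Set.univ ψ)
    (h' : ∀ x b, |b| ≤ C → ψ (x + b) ≤ ψ' x) :
    ∫ x, ψ x ∂(dirProb (hamiltonian_isHermitian s v hh hw) hu : Measure ℝ)
      ≤ 2 * ∫ x, ψ' x ∂(countingProb hh : Measure ℝ) := by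
  obtain ⟨V, B, h1, h2⟩ := exists_udiag_eq hh hw hC
  refine (integral_dirMeasure_le _ _ hu hψ0).trans ?_
  refine (mul_le_mul_of_nonneg_left (sum_convex_le h1 h2 hψ h') (by positivity)).trans ?_
  rw [sum_eigenvalues_snd hh ψ']
  exact le_rfl

/-! ### Limits along a sequence of Hamiltonians -/

section Limits

variable {s v C : ℝ} {h w : ∀ n : ℕ, Matrix (Fin n) (Fin n) ℂ} (hh : ∀ n, (h n).IsHermitian)
  (hw : ∀ n, (w n).IsHermitian)
  (hC : ∀ᶠ n : ℕ in atTop, |s| + |v / √((n + 1 : ℕ) : ℝ)| * ‖w (n + 1)‖ ≤ C)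
  {ν₀ : ProbabilityMeasure ℝ}
  (hN : Tendsto (fun n => countingProb (hh (n + 1))) atTop (𝓝 ν₀))

/-- The tails of the counting measures are small by weak convergence, and the bounded perturbation
adds at most `2C/η`. -/
theorem tailsVanish_dirProb (hu : ∑ α, ‖u α‖ ^ 2 = 1)
    (hC : ∀ᶠ n : ℕ in atTop, |s| + |v / √((n + 1 : ℕ) : ℝ)| * ‖w (n + 1)‖ ≤ C)
    (hN : Tendsto (fun n => countingProb (hh (n + 1))) atTop (𝓝 ν₀)) :
    TailsVanish fun n => dirProb (hamiltonian_isHermitian s v (hh (n + 1)) (hw (n + 1))) hu := by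
  intro ε hε
  have e1 : ∀ᶠ η : ℝ in atTop, ∫ x, tailWeight η x ∂(ν₀ : Measure ℝ) < ε / 8 :=
    (tendsto_integral_tailWeight _).eventually_lt_const (by positivity)
  have e2 : ∀ᶠ η : ℝ in atTop, C / η < ε / 4 :=
    (tendsto_const_nhds.div_atTop tendsto_id).eventually_lt_const (by positivity)
  obtain ⟨η, h1, h2, hη⟩ := (e1.and (e2.and (eventually_gt_atTop 0))).exists
  refine ⟨η, hη, ?_⟩
  have h3 := (ProbabilityMeasure.tendsto_iff_forall_integral_tendsto.1 hN) (tailWeightBCF η hη)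
  filter_upwards [hC, h3.eventually_lt_const h1] with n hn1 hn2
  refine (integral_tailWeight_dirProb_le (hh _) (hw _) hn1 hu hη).trans ?_
  change ∫ x, tailWeight η x ∂(countingProb (hh (n + 1)) : Measure ℝ) < ε / 8 at hn2
  linarith

variable {ν : Fin 2 → ProbabilityMeasure ℝ} {D : Set ℂ}

/-- When the off-diagonal traces vanish in the limit, the form at `u` reduces to the average of the
diagonal transforms with weights `|u_α|²`. -/
theorem tendsto_dirProb (hu : ∑ α, ‖u α‖ ^ 2 = 1)
    (hC : ∀ᶠ n : ℕ in atTop, |s| + |v / √((n + 1 : ℕ) : ℝ)| * ‖w (n + 1)‖ ≤ C)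
    (hN : Tendsto (fun n => countingProb (hh (n + 1))) atTop (𝓝 ν₀)) (hD : Dense D)
    (hν : ∀ α, Tendsto (fun n => dirProb (hamiltonian_isHermitian s v (hh (n + 1)) (hw (n + 1)))
      (sum_norm_sq_single α)) atTop (𝓝 (ν α)))
    (hoff : ∀ z ∈ D, z.im ≠ 0 → ∀ α γ, α ≠ γ → Tendsto (fun n : ℕ =>
      ptr (green (hamiltonian s v (h (n + 1)) (w (n + 1))) z) α γ) atTop (𝓝 0)) :
    Tendsto (fun n => dirProb (hamiltonian_isHermitian s v (hh (n + 1)) (hw (n + 1))) hu) atTop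
      (𝓝 (mixture ν hu)) := by
  refine tendsto_of_tendsto_stieltjes (tailsVanish_dirProb hh hw hu hC hN) hD fun z hzD hz => ?_
  have key : ∀ α γ, Tendsto (fun n : ℕ =>
      ptr (green (hamiltonian s v (h (n + 1)) (w (n + 1))) z) α γ) atTop
      (𝓝 (if α = γ then stieltjes (ν α : Measure ℝ) z else 0)) := by
    intro α γ
    by_cases hαγ : α = γ
    · subst hαγ
      rw [if_pos rfl]
      refine (tendsto_stieltjes (hν α) hz).congr fun n => ?_
      exact stieltjes_dirProb_single _ α hz
    · rw [if_neg hαγ]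
      exact hoff z hzD hz α γ hαγ
  have e : stieltjes (mixture ν hu : Measure ℝ) z = ∑ α, ∑ γ, star (u α) * u γ *
      (if α = γ then stieltjes (ν α : Measure ℝ) z else 0) := by
    rw [stieltjes, integral_mixture ν hu fun α => integrable_kernel _ hz]
    refine Finset.sum_congr rfl fun α _ => ?_
    simp only [mul_ite, mul_zero, Finset.sum_ite_eq, Finset.mem_univ, if_true]
    rw [Complex.real_smul, Complex.star_def, Complex.conj_mul']
    push_cast
    rfl
  rw [e]
  simp only [stieltjes_dirProb _ hu hz]
  exact tendsto_finsetSum _ fun α _ => tendsto_finsetSum _ fun γ _ =>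
    (key α γ).const_mul _

theorem tendsto_ptr_udiag {H : ∀ n : ℕ, Matrix (Fin 2 × Fin (n + 1)) (Fin 2 × Fin (n + 1)) ℂ}
    (hH : ∀ n, (H n).IsHermitian) {ψ : ℝ → ℝ} (hψ : ∀ α, Integrable ψ (ν α : Measure ℝ))
    (h : ∀ (u : Fin 2 → ℂ) (hu : ∑ α, ‖u α‖ ^ 2 = 1),
      Tendsto (fun n => ∫ x, ψ x ∂(dirProb (hH n) hu : Measure ℝ)) atTop
        (𝓝 (∫ x, ψ x ∂(mixture ν hu : Measure ℝ)))) (α γ : Fin 2) :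
    Tendsto (fun n => ptr (udiag (hH n).eigenvectorUnitary
      fun k => ((ψ ((hH n).eigenvalues k) : ℝ) : ℂ)) α γ) atTop
      (𝓝 (Matrix.diagonal (fun α => ((∫ x, ψ x ∂(ν α : Measure ℝ) : ℝ) : ℂ)) α γ)) := by
  refine tendsto_of_polarization (M := fun n α γ => ptr (udiag (hH n).eigenvectorUnitary
      fun k => ((ψ ((hH n).eigenvalues k) : ℝ) : ℂ)) α γ) (fun u hu => ?_) α γ
  have h1 := h u hu
  rw [integral_mixture ν hu hψ] at h1
  refine ((Complex.continuous_ofReal.tendsto _).comp h1).congr fun n => ?_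
  exact ofReal_integral_dirMeasure _ _ u ψ

/-- The portmanteau theorem: the frontier of the interval consists of at most its two endpoints,
which are null for the limit. -/
theorem tendsto_integral_indicator {μ : ℕ → ProbabilityMeasure ℝ} {ρ : ProbabilityMeasure ℝ}
    (hμ : Tendsto μ atTop (𝓝 ρ)) (h0 : ∀ l, (ρ : Measure ℝ) {l} = 0) (a b : ℝ) :
    Tendsto (fun n => ∫ x, (Set.Ioo a b).indicator (fun _ => (1 : ℝ)) x ∂(μ n : Measure ℝ)) atTop
      (𝓝 (∫ x, (Set.Ioo a b).indicator (fun _ => (1 : ℝ)) x ∂(ρ : Measure ℝ))) := by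
  simp only [integral_indicator measurableSet_Ioo, integral_const, smul_eq_mul, mul_one,
    measureReal_restrict_apply_univ]
  refine (ENNReal.tendsto_toReal (measure_ne_top _ _)).comp
    (ProbabilityMeasure.tendsto_measure_of_null_frontier_of_tendsto' hμ ?_)
  rcases le_or_gt b a with hab | hab
  · simp [Set.Ioo_eq_empty_of_le hab]
  · rw [frontier_Ioo hab]
    exact measure_union_null (h0 a) (h0 b)

/-- Exponential moments of the directional measures converge. -/
theorem integrable_and_tendsto_exp (hu : ∑ α, ‖u α‖ ^ 2 = 1)
    (hC : ∀ᶠ n : ℕ in atTop, |s| + |v / √((n + 1 : ℕ) : ℝ)| * ‖w (n + 1)‖ ≤ C)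
    (hN : Tendsto (fun n => countingProb (hh (n + 1))) atTop (𝓝 ν₀)) {ρ : ProbabilityMeasure ℝ}
    (hρ : Tendsto (fun n => dirProb (hamiltonian_isHermitian s v (hh (n + 1)) (hw (n + 1))) hu)
      atTop (𝓝 ρ)) {β : ℝ} (hβ : Integrable (fun x => Real.exp (-β * x)) (ν₀ : Measure ℝ))
    (hβ' : Tendsto (fun n => ∫ x, Real.exp (-β * x) ∂(countingProb (hh (n + 1)) : Measure ℝ)) atTop
      (𝓝 (∫ x, Real.exp (-β * x) ∂(ν₀ : Measure ℝ)))) :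
    Integrable (fun x => Real.exp (-β * x)) (ρ : Measure ℝ) ∧
      Tendsto (fun n => ∫ x, Real.exp (-β * x)
        ∂(dirProb (hamiltonian_isHermitian s v (hh (n + 1)) (hw (n + 1))) hu : Measure ℝ)) atTop
        (𝓝 (∫ x, Real.exp (-β * x) ∂(ρ : Measure ℝ))) := by
  refine integrable_and_tendsto_integral hρ (by fun_prop) (fun x => (Real.exp_pos _).le)
    (fun n => integrable_dirMeasure _ _ _ _) fun ε hε => ?_
  -- A shift of the eigenvalue by at most `C` multiplies the exponential by at most `e^{|β| C}`. The
  -- excess `(e^{-βx} - K)⁺` is convex, so Jensen bounds its integral by that of `(G - K)⁺` for `h`,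
  -- and there convergence of the exponential moments gives smallness.
  set G : ℝ → ℝ := fun x => Real.exp (|β| * C) * Real.exp (-β * x) with hG
  have hGc : Continuous G := by fun_prop
  have hG0 : ∀ x, 0 ≤ G x := fun x => by positivity
  have hGi : Integrable G (ν₀ : Measure ℝ) := hβ.const_mul _
  have hGN : ∀ n, Integrable G (countingProb (hh (n + 1)) : Measure ℝ) := by
    intro n
    change Integrable G (countingMeasure (hh (n + 1)))
    refine Integrable.smul_measure (integrable_finsetSum_measure.2 fun _ _ =>
      integrable_dirac (by simp)) (by simp)
  have htail : Tendsto (fun K : ℝ => ∫ x, max (G x - K) 0 ∂(ν₀ : Measure ℝ)) atTop (𝓝 0) := by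
    have e : (0 : ℝ) = ∫ _ : ℝ, (0 : ℝ) ∂(ν₀ : Measure ℝ) := by simp
    nth_rewrite 2 [e]
    refine tendsto_integral_filter_of_dominated_convergence G ?_ ?_ hGi ?_
    · exact Eventually.of_forall fun K =>
        ((hGc.sub continuous_const).max continuous_const).aestronglyMeasurable
    · filter_upwards [eventually_ge_atTop 0] with K hK
      refine Eventually.of_forall fun x => ?_
      rw [Real.norm_of_nonneg (le_max_right _ _)]
      exact max_le (by linarith [hG0 x]) (hG0 x)
    · refine Eventually.of_forall fun x => tendsto_const_nhds.congr' ?_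
      filter_upwards [eventually_ge_atTop (G x)] with K hK
      rw [max_eq_right (by linarith)]
  obtain ⟨K, hK, hK0⟩ := ((htail.eventually_lt_const (show (0 : ℝ) < ε / 2 by positivity)).and
    (eventually_ge_atTop 0)).exists
  refine ⟨K, hK0, ?_⟩
  set φ : ℝ →ᵇ ℝ := BoundedContinuousFunction.ofNormedAddCommGroup (fun x => min (G x) K)
    (by fun_prop) K fun x => by
      rw [Real.norm_of_nonneg (le_min (hG0 x) hK0)]
      exact min_le_right _ _ with hφ
  have hsplit : ∀ x, max (G x - K) 0 = G x - φ x := by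
    intro x
    change max (G x - K) 0 = G x - min (G x) K
    rcases le_total (G x) K with h | h
    · rw [min_eq_left h, max_eq_right (by linarith), sub_self]
    · rw [min_eq_right h, max_eq_left (by linarith)]
  have hlim : Tendsto (fun n => ∫ x, max (G x - K) 0 ∂(countingProb (hh (n + 1)) : Measure ℝ)) atTop
      (𝓝 (∫ x, max (G x - K) 0 ∂(ν₀ : Measure ℝ))) := by
    simp only [hsplit]
    rw [integral_sub hGi (φ.integrable _)]
    have h1 : Tendsto (fun n => ∫ x, G x ∂(countingProb (hh (n + 1)) : Measure ℝ)) atTop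
        (𝓝 (∫ x, G x ∂(ν₀ : Measure ℝ))) := by
      simp only [hG, integral_const_mul]
      exact hβ'.const_mul _
    refine (h1.sub ((ProbabilityMeasure.tendsto_iff_forall_integral_tendsto.1 hN) φ)).congr
      fun n => ?_
    rw [integral_sub (hGN n) (φ.integrable _)]
  filter_upwards [hC, hlim.eventually_lt_const hK] with n hn1 hn2
  refine (integral_dirProb_le_of_convex (hh _) (hw _) hn1 hu (ψ' := fun x => max (G x - K) 0)
    (fun x => le_max_right _ _) ?_ ?_).trans (by linarith)
  · have hexp : ConvexOn ℝ Set.univ fun x : ℝ => Real.exp (-β * x) :=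
      convexOn_exp.comp_linearMap (LinearMap.mul ℝ ℝ (-β))
    exact (hexp.sub (concaveOn_const K convex_univ)).sup (convexOn_const 0 convex_univ)
  · intro x b hb
    have : Real.exp (-β * (x + b)) ≤ G x := by
      simp only [hG]
      rw [← Real.exp_add]
      refine Real.exp_le_exp.2 ?_
      have h1 : -β * b ≤ |β| * C :=
        (le_abs_self _).trans (by rw [abs_mul, abs_neg]; gcongr)
      linarith
    exact max_le_max (by linarith) le_rfl

end Limits

end SpinReservoir

end

noncomputable section

namespace SpinReservoir

open scoped Matrix.Norms.L2Operator

variable {n : ℕ}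

/-! ### The law of a GUE matrix -/

/-- The sign of `k - j`. -/
def ordSign (j k : Fin n) : ℝ := if j < k then 1 else if k < j then -1 else 0

/-- The Hermitian matrix with the given real parts (indices `j ≤ k`) and imaginary parts
(indices `(k, j)` with `j < k`) of its upper triangular entries, as a linear map. -/
def gueLinearMap : (Fin n × Fin n → ℝ) →ₗ[ℝ] Matrix (Fin n) (Fin n) ℂ where
  toFun x := Matrix.of fun j k =>
    (x (min j k, max j k) : ℂ) + ordSign j k * x (max j k, min j k) * Complex.I
  map_add' x y := by
    ext j k
    simp only [Matrix.of_apply, Pi.add_apply, Matrix.add_apply]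
    push_cast
    ring
  map_smul' c x := by
    ext j k
    simp only [Matrix.of_apply, Pi.smul_apply, Matrix.smul_apply, smul_eq_mul, RingHom.id_apply,
      Complex.real_smul]
    push_cast
    ring

/-- `gueLinearMap` as a continuous linear map. -/
def gueMatrix : (Fin n × Fin n → ℝ) →L[ℝ] Matrix (Fin n) (Fin n) ℂ :=
  LinearMap.toContinuousLinearMap gueLinearMap

theorem gueMatrix_apply (x : Fin n × Fin n → ℝ) (j k : Fin n) : gueMatrix x j k =
    (x (min j k, max j k) : ℂ) + ordSign j k * x (max j k, min j k) * Complex.I := rfl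

theorem gueMatrix_isHermitian (x : Fin n × Fin n → ℝ) : (gueMatrix x).IsHermitian := by
  ext j k
  have h : ordSign k j = -ordSign j k := by
    unfold ordSign
    split_ifs <;> first | omega | norm_num
  rw [Matrix.conjTranspose_apply, gueMatrix_apply, gueMatrix_apply, min_comm, max_comm, h]
  simp only [Complex.star_def, map_add, map_mul, Complex.conj_ofReal, Complex.conj_I]
  push_cast
  ring

/-- The independent coordinates of a Hermitian matrix. -/
def coords (M : Matrix (Fin n) (Fin n) ℂ) (p : Fin n × Fin n) : ℝ :=
  if p.1 ≤ p.2 then (M p.1 p.2).re else (M p.2 p.1).im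

theorem gueMatrix_coords {M : Matrix (Fin n) (Fin n) ℂ} (hM : M.IsHermitian) :
    gueMatrix (coords M) = M := by
  ext j k
  rw [gueMatrix_apply]
  have hjk : star (M k j) = M j k := hM.apply j k
  rcases lt_trichotomy j k with h | h | h
  · simp [coords, ordSign, h.le, h, h.not_ge, Complex.re_add_im]
  · subst h
    have : ((M j j).re : ℂ) = M j j := Complex.conj_eq_iff_re.1 hjk
    simp [coords, ordSign, this]
  · rw [← hjk]
    simp [coords, ordSign, h.le, h, h.not_ge, h.not_gt]
    apply Complex.ext <;> simp

/-- `μ` is a centered Gaussian measure under which `gueMatrix` has the covariance of a GUE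
matrix. -/
structure IsGUELaw (μ : Measure (Fin n × Fin n → ℝ)) : Prop where
  isGaussian : IsGaussian μ
  centered : ∀ L : StrongDual ℝ (Fin n × Fin n → ℝ), μ[L] = 0
  cov : ∀ i j k l, ∫ x, gueMatrix x i j * gueMatrix x k l ∂μ = if i = l ∧ j = k then 1 else 0

theorem integral_mul_of_hasLaw {Ω : Type*} [MeasurableSpace Ω] {P : Measure Ω}
    [IsProbabilityMeasure P] {ι : Type*} [DecidableEq ι] {X : ι → Ω → ℝ} {c : ι → NNReal}
    (hX : ∀ p, HasLaw (X p) (gaussianReal 0 (c p)) P) (hi : iIndepFun X P) (p q : ι) :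
    ∫ ω, X p ω * X q ω ∂P = if p = q then (c p : ℝ) else 0 := by
  have hm : ∀ p, ∫ ω, X p ω ∂P = 0 := fun p => by
    have := (hX p).integral_eq
    rw [integral_id_gaussianReal] at this
    exact this
  by_cases h : p = q
  · subst h
    rw [if_pos rfl]
    have h1 := (hX p).variance_eq
    rw [variance_id_gaussianReal, variance_of_integral_eq_zero (hX p).aemeasurable (hm p)] at h1
    simpa [sq] using h1
  · rw [if_neg h]
    have := (hi.indepFun h).integral_fun_mul_eq_mul_integral
      (hX p).aemeasurable.aestronglyMeasurable (hX q).aemeasurable.aestronglyMeasurable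
    rw [this, hm p, zero_mul]

theorem integrable_mul_of_isGaussian {ι : Type*} [Fintype ι] {μ : Measure (ι → ℝ)} [IsGaussian μ]
    (p q : ι) : Integrable (fun x : ι → ℝ => x p * x q) μ := by
  have h : ∀ p, MemLp (fun x : ι → ℝ => x p) 2 μ := fun p =>
    IsGaussian.memLp_dual μ (ContinuousLinearMap.proj (R := ℝ) (φ := fun _ : ι => ℝ) p) 2 (by simp)
  exact (h p).integrable_mul (h q)

theorem integral_gueMatrix_mul {μ : Measure (Fin n × Fin n → ℝ)} [IsGaussian μ]
    (h : ∀ p q : Fin n × Fin n, ∫ x, x p * x q ∂μ =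
      if p = q then (if p.1 = p.2 then 1 else 1 / 2) else 0) (i j k l : Fin n) :
    ∫ x, gueMatrix x i j * gueMatrix x k l ∂μ = if i = l ∧ j = k then 1 else 0 := by
  have hi : ∀ p q : Fin n × Fin n, Integrable (fun x : Fin n × Fin n → ℝ =>
      ((x p * x q : ℝ) : ℂ)) μ := fun p q => (integrable_mul_of_isGaussian p q).ofReal
  have e : ∀ x : Fin n × Fin n → ℝ, gueMatrix x i j * gueMatrix x k l =
      ((x (min i j, max i j) * x (min k l, max k l) : ℝ) : ℂ)
      + (ordSign k l * Complex.I) * ((x (min i j, max i j) * x (max k l, min k l) : ℝ) : ℂ)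
      + (ordSign i j * Complex.I) * ((x (max i j, min i j) * x (min k l, max k l) : ℝ) : ℂ)
      + (-(ordSign i j * ordSign k l))
        * ((x (max i j, min i j) * x (max k l, min k l) : ℝ) : ℂ) := by
    intro x
    rw [gueMatrix_apply, gueMatrix_apply]
    push_cast
    linear_combination ((ordSign i j : ℂ) * ordSign k l * x (max i j, min i j)
      * x (max k l, min k l)) * Complex.I_sq
  simp only [e]
  have h2 : ∀ (p q p' q' : Fin n × Fin n) (c : ℂ), Integrable (fun x : Fin n × Fin n → ℝ =>
      ((x p * x q : ℝ) : ℂ) + c * ((x p' * x q' : ℝ) : ℂ)) μ := fun p q p' q' c =>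
    (hi p q).add ((hi p' q').const_mul c)
  have h3 : ∀ (p q p' q' p'' q'' : Fin n × Fin n) (c c' : ℂ), Integrable
      (fun x : Fin n × Fin n → ℝ => ((x p * x q : ℝ) : ℂ) + c * ((x p' * x q' : ℝ) : ℂ)
        + c' * ((x p'' * x q'' : ℝ) : ℂ)) μ := fun p q p' q' p'' q'' c c' =>
    (h2 p q p' q' c).add ((hi p'' q'').const_mul c')
  rw [integral_add (h3 _ _ _ _ _ _ _ _) ((hi _ _).const_mul _),
    integral_add (h2 _ _ _ _ _) ((hi _ _).const_mul _),
    integral_add (hi _ _) ((hi _ _).const_mul _)]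
  have hc : ∀ p q : Fin n × Fin n, ∫ x : Fin n × Fin n → ℝ, ((x p * x q : ℝ) : ℂ) ∂μ =
      if p = q then (if p.1 = p.2 then 1 else 1 / 2) else 0 := fun p q => by
    refine (integral_ofReal (𝕜 := ℂ) (f := fun x : Fin n × Fin n → ℝ => x p * x q)).trans ?_
    rw [h]
    split_ifs <;> simp
  simp only [integral_const_mul, hc]
  -- Off the diagonal, the real and imaginary parts contribute `1/2` each. They cancel in the mean
  -- of `W_{jk}²` and add up to `1` in that of `W_{jk} W_{kj}`; on the diagonal the imaginary part
  -- is absent.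
  rcases lt_trichotomy i j with h1 | h1 | h1 <;> rcases lt_trichotomy k l with h2 | h2 | h2 <;>
    simp only [ordSign, h1, h2, min_eq_left_of_lt, min_eq_right_of_lt, max_eq_right_of_lt,
      max_eq_left_of_lt, if_true, Prod.mk.injEq, min_self, max_self, lt_irrefl, if_false,
      not_lt_of_gt, ne_of_lt, ne_of_gt] <;>
    split_ifs <;> first | omega | (push_cast; norm_num)

/-- Independence of the Gaussian coordinates makes them jointly Gaussian, and their variances give
the covariance of the matrix entries. -/
theorem IsGUE.isGUELaw {Ω : Type*} [MeasurableSpace Ω] {P : Measure Ω} [IsProbabilityMeasure P]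
    {w : Ω → Matrix (Fin n) (Fin n) ℂ} (hw : IsGUE P w) :
    AEMeasurable (fun ω => coords (w ω)) P ∧ IsGUELaw (P.map fun ω => coords (w ω)) := by
  have hX : ∀ p : Fin n × Fin n, HasLaw (fun ω => coords (w ω) p)
      (gaussianReal 0 (if p.1 = p.2 then 1 else 1 / 2)) P := by
    intro p
    rcases lt_trichotomy p.1 p.2 with h | h | h
    · simpa [coords, h.le, h.ne] using hw.hasLaw_re p.1 p.2 h
    · obtain ⟨j, k⟩ := p
      obtain rfl : j = k := h
      simpa [coords] using hw.hasLaw_diag j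
    · simpa [coords, h.not_ge, h.ne'] using hw.hasLaw_im p.2 p.1 h
  have hm : AEMeasurable (fun ω => coords (w ω)) P :=
    aemeasurable_pi_lambda _ fun p => (hX p).aemeasurable
  have hi : iIndepFun (fun p ω => coords (w ω) p) P := hw.indep
  have hg : IsGaussian (P.map fun ω => coords (w ω)) :=
    (hi.hasGaussianLaw fun p => (hX p).hasGaussianLaw).isGaussian_map
  refine ⟨hm, hg, fun L => ?_, integral_gueMatrix_mul fun p q => ?_⟩
  · have hL : ∃ c : Fin n × Fin n → ℝ, ∀ x, L x = ∑ p, x p * c p :=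
      ⟨_, fun x => LinearMap.pi_apply_eq_sum_univ L.toLinearMap x⟩
    obtain ⟨c, hL⟩ := hL
    rw [integral_map hm L.continuous.aestronglyMeasurable]
    simp only [hL]
    rw [integral_finsetSum _ fun p _ =>
      ((hX p).hasGaussianLaw.integrable).mul_const _]
    refine Finset.sum_eq_zero fun p _ => ?_
    rw [integral_mul_const, (hX p).integral_eq, integral_id_gaussianReal, zero_mul]
  · rw [integral_map hm (by fun_prop)]
    rw [integral_mul_of_hasLaw hX hi p q]
    split_ifs <;> norm_num

end SpinReservoir

end

noncomputable section

namespace SpinReservoir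

open scoped Matrix.Norms.L2Operator

variable {n : ℕ}

/-! ### Contractions with respect to the GUE -/

theorem mul_pauliX_kronecker_mul_apply (A B : Matrix (Fin 2 × Fin n) (Fin 2 × Fin n) ℂ)
    (M : Matrix (Fin n) (Fin n) ℂ) (p q : Fin 2 × Fin n) :
    (A * (pauliX ⊗ₖ M) * B) p q
      = ∑ β, ∑ l, ∑ m, M l m * (A p (β, l) * B (opp β, m) q) := by
  simp only [Matrix.mul_apply, Fintype.sum_prod_type, Matrix.kronecker_apply, Fin.sum_univ_two,
    pauliX, opp, Matrix.of_apply, Matrix.cons_val_zero, Matrix.cons_val_one]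
  simp only [zero_mul, mul_zero, one_mul, Finset.sum_const_zero, zero_add, add_zero, if_true,
    one_ne_zero, if_false, Fin.isValue, Finset.sum_mul]
  rw [add_comm]
  congr 1 <;>
  · rw [Finset.sum_comm]
    exact Finset.sum_congr rfl fun l _ => Finset.sum_congr rfl fun m _ => by ring

theorem integrable_gueMatrix_mul {μ : Measure (Fin n × Fin n → ℝ)} [IsGaussian μ]
    (i j k l : Fin n) : Integrable (fun x => gueMatrix x i j * gueMatrix x k l) μ := by
  have h : ∀ i j : Fin n, MemLp (fun x : Fin n × Fin n → ℝ => gueMatrix x i j) 2 μ := by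
    intro i j
    have := ((LinearMap.toContinuousLinearMap (Matrix.entryLinearMap ℝ ℂ i j)).comp
      gueMatrix).comp_memLp' (IsGaussian.memLp_id μ 2 (by simp))
    exact this
  exact (h i j).integrable_mul (h k l)

/-- The covariance `E W_{jk} W_{lm} = δ_{jm} δ_{kl}` leaves one term for each spin index, and `σˣ`
flips the spin. -/
theorem IsGUELaw.integral_mul_contraction {μ : Measure (Fin n × Fin n → ℝ)} (hμ : IsGUELaw μ)
    (A B : Matrix (Fin 2 × Fin n) (Fin 2 × Fin n) ℂ) (p q : Fin 2 × Fin n) (j k : Fin n) :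
    ∫ y, gueMatrix y j k * (A * (pauliX ⊗ₖ gueMatrix y) * B) p q ∂μ
      = ∑ β, A p (β, k) * B (opp β, j) q := by
  have := hμ.isGaussian
  have hi : ∀ β l m, Integrable (fun y => gueMatrix y j k * gueMatrix y l m
      * (A p (β, l) * B (opp β, m) q)) μ := fun β l m =>
    (integrable_gueMatrix_mul j k l m).mul_const _
  simp only [mul_pauliX_kronecker_mul_apply, Finset.mul_sum, ← mul_assoc (gueMatrix _ j k)]
  rw [integral_finsetSum _ fun β _ => integrable_finsetSum _ fun l _ =>
    integrable_finsetSum _ fun m _ => hi β l m]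
  refine Finset.sum_congr rfl fun β _ => ?_
  rw [integral_finsetSum _ fun l _ => integrable_finsetSum _ fun m _ => hi β l m]
  simp only [integral_finsetSum _ fun m _ => hi β _ m, integral_mul_const, hμ.cov]
  rw [Finset.sum_eq_single k]
  · rw [Finset.sum_eq_single j]
    · simp
    · intro m _ hm; simp [hm.symm]
    · simp
  · intro l _ hl; simp [hl.symm]
  · simp

/-- Conjugation exchanges the indices of the Hermitian matrix, so in the squared modulus the
covariance pairs each entry with itself only. -/
theorem IsGUELaw.lintegral_norm_sq {μ : Measure (Fin n × Fin n → ℝ)} (hμ : IsGUELaw μ)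
    (K : Fin n → Fin n → ℂ) :
    ∫⁻ y, ‖∑ l, ∑ m, gueMatrix y l m * K l m‖ₑ ^ 2 ∂μ
      = ENNReal.ofReal (∑ l, ∑ m, ‖K l m‖ ^ 2) := by
  have := hμ.isGaussian
  have hi : ∀ l m k i, Integrable (fun y => gueMatrix y l m * gueMatrix y k i
      * (K l m * star (K i k))) μ := fun l m k i => (integrable_gueMatrix_mul l m k i).mul_const _
  have e : ∀ y, ((‖∑ l, ∑ m, gueMatrix y l m * K l m‖ ^ 2 : ℝ) : ℂ) =
      ∑ l, ∑ m, ∑ k, ∑ i, gueMatrix y l m * gueMatrix y k i * (K l m * star (K i k)) := by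
    intro y
    have hy : ∀ i k, star (gueMatrix y i k) = gueMatrix y k i := fun i k =>
      (gueMatrix_isHermitian y).apply k i
    have h2 : star (∑ l, ∑ m, gueMatrix y l m * K l m)
        = ∑ k, ∑ i, gueMatrix y k i * star (K i k) := by
      simp only [star_sum, star_mul', hy]
      exact Finset.sum_comm
    rw [← Complex.normSq_eq_norm_sq, ← Complex.mul_conj, ← Complex.star_def, h2]
    simp only [Finset.sum_mul]
    simp only [Finset.mul_sum]
    refine Finset.sum_congr rfl fun l _ => ?_
    refine Finset.sum_congr rfl fun m _ => Finset.sum_congr rfl fun k _ =>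
      Finset.sum_congr rfl fun i _ => by ring
  have hI : Integrable (fun y => ((‖∑ l, ∑ m, gueMatrix y l m * K l m‖ ^ 2 : ℝ) : ℂ)) μ := by
    simp only [e]
    exact integrable_finsetSum _ fun l _ => integrable_finsetSum _ fun m _ =>
      integrable_finsetSum _ fun k _ => integrable_finsetSum _ fun i _ => hi l m k i
  have hI' : Integrable (fun y => ‖∑ l, ∑ m, gueMatrix y l m * K l m‖ ^ 2) μ := hI.re
  have hval : ∫ y, ‖∑ l, ∑ m, gueMatrix y l m * K l m‖ ^ 2 ∂μ = ∑ l, ∑ m, ‖K l m‖ ^ 2 := by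
    have h1 : ((∫ y, ‖∑ l, ∑ m, gueMatrix y l m * K l m‖ ^ 2 ∂μ : ℝ) : ℂ)
        = ((∑ l, ∑ m, ‖K l m‖ ^ 2 : ℝ) : ℂ) := by
      refine (integral_ofReal (𝕜 := ℂ)
        (f := fun y => ‖∑ l, ∑ m, gueMatrix y l m * K l m‖ ^ 2)).symm.trans ?_
      refine (integral_congr_ae (Eventually.of_forall e)).trans ?_
      simp only [integral_finsetSum _ fun l _ => integrable_finsetSum _ fun m _ =>
        integrable_finsetSum _ fun k _ => integrable_finsetSum _ fun i _ => hi l m k i]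
      push_cast
      refine Finset.sum_congr rfl fun l _ => ?_
      rw [integral_finsetSum _ fun m _ =>
        integrable_finsetSum _ fun k _ => integrable_finsetSum _ fun i _ => hi l m k i]
      refine Finset.sum_congr rfl fun m _ => ?_
      rw [integral_finsetSum _ fun k _ => integrable_finsetSum _ fun i _ => hi l m k i]
      simp only [integral_finsetSum _ fun i _ => hi l m _ i, integral_mul_const, hμ.cov]
      rw [Finset.sum_eq_single m]
      · rw [Finset.sum_eq_single l]
        · rw [if_pos ⟨rfl, rfl⟩, one_mul, Complex.star_def, Complex.mul_conj']
        · intro i _ h; simp [h.symm]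
        · simp
      · intro k _ h; simp [h.symm]
      · simp
    exact_mod_cast h1
  rw [← hval, ofReal_integral_eq_lintegral_ofReal hI'
    (Eventually.of_forall fun y => by positivity)]
  refine lintegral_congr fun y => ?_
  rw [ENNReal.ofReal_pow (norm_nonneg _), ofReal_norm]

/-! ### The derivative of the resolvent -/

/-- The perturbation `σˣ ⊗ W(x)` as a continuous linear map. -/
def pert : (Fin n × Fin n → ℝ) →L[ℝ] Matrix (Fin 2 × Fin n) (Fin 2 × Fin n) ℂ :=
  LinearMap.toContinuousLinearMap
    { toFun := fun x => pauliX ⊗ₖ gueMatrix x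
      map_add' := fun x y => by rw [map_add, Matrix.kronecker_add]
      map_smul' := fun c x => by rw [map_smul, Matrix.kronecker_smul]; rfl }

theorem pert_apply (x : Fin n × Fin n → ℝ) : pert x = pauliX ⊗ₖ gueMatrix x := rfl

variable (s v : ℝ) (h : Matrix (Fin n) (Fin n) ℂ) (z : ℂ)

/-- The resolvent of the Hamiltonian as a function of the Gaussian coordinates. -/
def greenAt (x : Fin n × Fin n → ℝ) : Matrix (Fin 2 × Fin n) (Fin 2 × Fin n) ℂ :=
  green (hamiltonian s v h (gueMatrix x)) z

variable {h z}

theorem hamiltonian_gueMatrix_isHermitian (hh : h.IsHermitian) (x : Fin n × Fin n → ℝ) :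
    (hamiltonian s v h (gueMatrix x)).IsHermitian :=
  hamiltonian_isHermitian s v hh (gueMatrix_isHermitian x)

theorem norm_greenAt_le (hh : h.IsHermitian) (hz : z.im ≠ 0) (x : Fin n × Fin n → ℝ) :
    ‖greenAt s v h z x‖ ≤ |z.im|⁻¹ :=
  norm_green_le (hamiltonian_gueMatrix_isHermitian s v hh x) hz

theorem hasFDerivAt_greenAt (hh : h.IsHermitian) (hz : z.im ≠ 0) (x : Fin n × Fin n → ℝ) :
    HasFDerivAt (greenAt s v h z)
      (-(ContinuousLinearMap.mulLeftRight ℝ (Matrix (Fin 2 × Fin n) (Fin 2 × Fin n) ℂ)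
        (greenAt s v h z x) (greenAt s v h z x)).comp ((v / √(n : ℝ)) • pert)) x := by
  have hu := isUnit_sub_smul (hamiltonian_gueMatrix_isHermitian s v hh x) hz
  have h1 : HasFDerivAt (fun x => hamiltonian s v h (gueMatrix x)
      - z • (1 : Matrix (Fin 2 × Fin n) (Fin 2 × Fin n) ℂ)) ((v / √(n : ℝ)) • pert) x := by
    refine HasFDerivAt.sub_const _ ?_
    exact (((v / √(n : ℝ)) • pert).hasFDerivAt).const_add
      ((s : ℂ) • (pauliZ ⊗ₖ (1 : Matrix (Fin n) (Fin n) ℂ))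
        + (1 : Matrix (Fin 2) (Fin 2) ℂ) ⊗ₖ h)
  have h2 := hasFDerivAt_ringInverse (𝕜 := ℝ) hu.unit
  have h3 : ((hu.unit⁻¹ : (Matrix (Fin 2 × Fin n) (Fin 2 × Fin n) ℂ)ˣ) :
      Matrix (Fin 2 × Fin n) (Fin 2 × Fin n) ℂ) = greenAt s v h z x := by
    rw [← Ring.inverse_unit, hu.unit_spec, ← Matrix.nonsing_inv_eq_ringInverse]
    rfl
  rw [h3] at h2
  have h4 := h2.comp x h1
  refine h4.congr_of_eventuallyEq (Eventually.of_forall fun y => ?_)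
  simp only [Function.comp, ← Matrix.nonsing_inv_eq_ringInverse]
  rfl

variable (z h) in
/-- The derivative of `Λ ∘ greenAt`. -/
def greenDeriv (Λ : Matrix (Fin 2 × Fin n) (Fin 2 × Fin n) ℂ →L[ℝ] ℂ) (x : Fin n × Fin n → ℝ) :
    (Fin n × Fin n → ℝ) →L[ℝ] ℂ :=
  Λ.comp (-(ContinuousLinearMap.mulLeftRight ℝ (Matrix (Fin 2 × Fin n) (Fin 2 × Fin n) ℂ)
        (greenAt s v h z x) (greenAt s v h z x)).comp ((v / √(n : ℝ)) • pert))

theorem greenDeriv_apply (Λ : Matrix (Fin 2 × Fin n) (Fin 2 × Fin n) ℂ →L[ℝ] ℂ)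
    (x y : Fin n × Fin n → ℝ) : greenDeriv s v h z Λ x y =
      -((v / √(n : ℝ) : ℝ) : ℂ) *
        Λ (greenAt s v h z x * (pauliX ⊗ₖ gueMatrix y) * greenAt s v h z x) := by
  simp only [greenDeriv, ContinuousLinearMap.comp_apply, neg_apply,
    smul_apply, ContinuousLinearMap.mulLeftRight_apply, pert_apply, map_neg,
    map_smul, Complex.real_smul, neg_mul]

variable {s v}

theorem hasFDerivAt_comp_greenAt (hh : h.IsHermitian) (hz : z.im ≠ 0)
    (Λ : Matrix (Fin 2 × Fin n) (Fin 2 × Fin n) ℂ →L[ℝ] ℂ) (x : Fin n × Fin n → ℝ) :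
    HasFDerivAt (fun x => Λ (greenAt s v h z x)) (greenDeriv s v h z Λ x) x :=
  Λ.hasFDerivAt.comp x (hasFDerivAt_greenAt s v hh hz x)

theorem continuous_greenAt (hh : h.IsHermitian) (hz : z.im ≠ 0) :
    Continuous (greenAt s v h z) :=
  continuous_iff_continuousAt.2 fun x => (hasFDerivAt_greenAt s v hh hz x).continuousAt

theorem continuous_greenDeriv (hh : h.IsHermitian) (hz : z.im ≠ 0)
    (Λ : Matrix (Fin 2 × Fin n) (Fin 2 × Fin n) ℂ →L[ℝ] ℂ) :
    Continuous (greenDeriv s v h z Λ) := by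
  have hc := continuous_greenAt (s := s) (v := v) hh hz
  refine continuous_const.clm_comp (Continuous.neg (Continuous.clm_comp ?_ continuous_const))
  exact ((ContinuousLinearMap.mulLeftRight ℝ _).continuous.comp hc).clm_apply hc

theorem norm_comp_greenAt_le (hh : h.IsHermitian) (hz : z.im ≠ 0)
    (Λ : Matrix (Fin 2 × Fin n) (Fin 2 × Fin n) ℂ →L[ℝ] ℂ) (x : Fin n × Fin n → ℝ) :
    ‖Λ (greenAt s v h z x)‖ ≤ ‖Λ‖ * |z.im|⁻¹ :=
  (Λ.le_opNorm _).trans (by gcongr; exact norm_greenAt_le s v hh hz x)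

theorem norm_greenDeriv_le (hh : h.IsHermitian) (hz : z.im ≠ 0)
    (Λ : Matrix (Fin 2 × Fin n) (Fin 2 × Fin n) ℂ →L[ℝ] ℂ) (x : Fin n × Fin n → ℝ) :
    ‖greenDeriv s v h z Λ x‖ ≤ ‖Λ‖ * (|z.im|⁻¹ * |z.im|⁻¹ * ‖(v / √(n : ℝ)) •
      (pert : _ →L[ℝ] Matrix (Fin 2 × Fin n) (Fin 2 × Fin n) ℂ)‖) := by
  refine (ContinuousLinearMap.opNorm_comp_le _ _).trans ?_
  gcongr
  rw [norm_neg]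
  refine (ContinuousLinearMap.opNorm_comp_le _ _).trans ?_
  gcongr
  refine (ContinuousLinearMap.opNorm_mulLeftRight_apply_apply_le ℝ _ _ _).trans ?_
  gcongr <;> exact norm_greenAt_le s v hh hz x

/-! ### Concentration -/

/-- The partial trace as a continuous linear functional. -/
def ptrCLM (α γ : Fin 2) : Matrix (Fin 2 × Fin n) (Fin 2 × Fin n) ℂ →L[ℝ] ℂ :=
  LinearMap.toContinuousLinearMap
    { toFun := fun X => ptr X α γ
      map_add' := fun X Y => by simp [ptr, Finset.sum_add_distrib, mul_add]
      map_smul' := fun c X => by simp [ptr, ← Finset.mul_sum]; ring }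

theorem ptrCLM_apply (α γ : Fin 2) (X : Matrix (Fin 2 × Fin n) (Fin 2 × Fin n) ℂ) :
    ptrCLM α γ X = ptr X α γ := rfl

/-- The Hilbert–Schmidt norm is at most the operator norm squared for each of the `2n` columns; the
other factor `2` comes from the sum over the spin. -/
theorem sum_norm_sq_le (T : Matrix (Fin 2 × Fin n) (Fin 2 × Fin n) ℂ) :
    ∑ l, ∑ m, ‖∑ β, T (opp β, m) (β, l)‖ ^ 2 ≤ 4 * n * ‖T‖ ^ 2 := by
  have h1 : ∀ l m, ‖∑ β, T (opp β, m) (β, l)‖ ^ 2 ≤ 2 * ∑ β, ∑ α, ‖T (α, m) (β, l)‖ ^ 2 := by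
    intro l m
    have h2 : ‖∑ β, T (opp β, m) (β, l)‖ ≤ ∑ β, ‖T (opp β, m) (β, l)‖ := norm_sum_le _ _
    refine (pow_le_pow_left₀ (norm_nonneg _) h2 2).trans ?_
    refine (sq_sum_le_card_mul_sum_sq).trans ?_
    simp only [Finset.card_univ, Fintype.card_fin, Nat.cast_ofNat]
    gcongr with β _
    exact Finset.single_le_sum (f := fun α => ‖T (α, m) (β, l)‖ ^ 2)
      (fun _ _ => by positivity) (Finset.mem_univ (opp β))
  calc ∑ l, ∑ m, ‖∑ β, T (opp β, m) (β, l)‖ ^ 2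
      ≤ ∑ l, ∑ m, 2 * ∑ β, ∑ α, ‖T (α, m) (β, l)‖ ^ 2 :=
        Finset.sum_le_sum fun l _ => Finset.sum_le_sum fun m _ => h1 l m
    _ = 2 * ∑ q, ∑ p, ‖T p q‖ ^ 2 := by
        simp only [← Finset.mul_sum]
        rw [Fintype.sum_prod_type_right]
        congr 1
        refine Finset.sum_congr rfl fun l _ => ?_
        rw [Finset.sum_comm]
        refine Finset.sum_congr rfl fun β _ => ?_
        rw [Fintype.sum_prod_type_right]
    _ ≤ 2 * ∑ _q : Fin 2 × Fin n, ‖T‖ ^ 2 := by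
        gcongr with q _
        exact sum_norm_sq_col_le T q
    _ = 4 * n * ‖T‖ ^ 2 := by
        simp
        ring

/-- Cyclicity of the trace, with a matrix unit inserted to select the block; it displays the
derivative of a partial trace as a linear form in the entries of `M`. -/
theorem ptr_mul_pauliX_kronecker_mul (A B : Matrix (Fin 2 × Fin n) (Fin 2 × Fin n) ℂ)
    (M : Matrix (Fin n) (Fin n) ℂ) (α γ : Fin 2) : ptr (A * (pauliX ⊗ₖ M) * B) α γ =
      (n : ℂ)⁻¹ * ∑ l, ∑ m, M l m * ∑ β,
        (B * ((Matrix.single γ α (1 : ℂ)) ⊗ₖ (1 : Matrix (Fin n) (Fin n) ℂ)) * A) (opp β, m) (β, l) := by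
  have hQ : ∀ p q, (B * ((Matrix.single γ α (1 : ℂ)) ⊗ₖ (1 : Matrix (Fin n) (Fin n) ℂ)) * A) p q
      = ∑ j, B p (γ, j) * A (α, j) q := by
    intro p q
    simp only [Matrix.mul_apply, Fintype.sum_prod_type, Matrix.kronecker_apply, Matrix.single_apply,
      Matrix.one_apply, mul_ite, mul_one, mul_zero]
    simp [Finset.sum_ite_eq, Finset.sum_ite_eq', ite_and, Finset.sum_ite_irrel]
  rw [ptr]
  congr 1
  simp only [hQ, mul_pauliX_kronecker_mul_apply, Finset.mul_sum]
  rw [Finset.sum_comm]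
  conv_lhs => enter [2, β]; rw [Finset.sum_comm]; enter [2, l]; rw [Finset.sum_comm]
  rw [Finset.sum_comm]
  refine Finset.sum_congr rfl fun l _ => ?_
  rw [Finset.sum_comm]
  refine Finset.sum_congr rfl fun m _ => Finset.sum_congr rfl fun β _ =>
    Finset.sum_congr rfl fun j _ => by ring

theorem norm_single_kronecker_le (γ α : Fin 2) :
    ‖(Matrix.single γ α (1 : ℂ)) ⊗ₖ (1 : Matrix (Fin n) (Fin n) ℂ)‖ ≤ 1 := by
  refine (norm_kronecker_le (Equiv.swap γ α) (c := fun a => if a = γ then 1 else 0)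
    (fun a b => ?_) (fun a => by split_ifs <;> simp) _).trans ?_
  · rw [Matrix.single_apply]
    by_cases h : a = γ
    · subst h; simp [eq_comm]
    · simp [h, Ne.symm h]
  · rw [← Matrix.diagonal_one, Matrix.l2_opNorm_diagonal]
    exact (pi_norm_le_iff_of_nonneg zero_le_one).2 fun i => by simp

/-- The derivative is a linear form in the Gaussian entries with prefactor `v n^{-1/2} n⁻¹` and
coefficients whose squares sum to at most `4n ‖T‖²`. The Poincaré inequality therefore gives order
`n⁻²`, which is summable. -/
theorem IsGUELaw.variance_le {μ : Measure (Fin n × Fin n → ℝ)} (hμ : IsGUELaw μ)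
    (hh : h.IsHermitian) (hz : z.im ≠ 0) (hn : n ≠ 0) (α γ : Fin 2) :
    ∫⁻ x, ‖ptr (greenAt s v h z x) α γ - ∫ y, ptr (greenAt s v h z y) α γ ∂μ‖ₑ ^ 2 ∂μ
      ≤ ENNReal.ofReal ((Real.pi * |v| * |z.im|⁻¹ ^ 2 * (n : ℝ)⁻¹) ^ 2) := by
  have := hμ.isGaussian
  have hn' : (n : ℝ) ≠ 0 := by exact_mod_cast hn
  refine (gaussian_poincare hμ.centered (F := fun x => ptrCLM α γ (greenAt s v h z x))
    (hasFDerivAt_comp_greenAt hh hz _) (continuous_greenDeriv hh hz _)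
    -- The three factors are the coupling squared, the square of the normalization of the partial
    -- trace, and the bound `4n ‖T‖²` with `‖T‖ ≤ |Im z|⁻²`.
    (norm_comp_greenAt_le hh hz _) (K := ENNReal.ofReal ((v / √(n : ℝ)) ^ 2 * (n : ℝ)⁻¹ ^ 2
      * (4 * n * (|z.im|⁻¹ ^ 2) ^ 2))) fun x => ?_).trans ?_
  · set G := greenAt s v h z x
    set T := G * ((Matrix.single γ α (1 : ℂ)) ⊗ₖ (1 : Matrix (Fin n) (Fin n) ℂ)) * G with hT
    have hTn : ‖T‖ ≤ |z.im|⁻¹ ^ 2 := by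
      have hG := norm_greenAt_le s v hh hz x
      calc ‖T‖ ≤ ‖G‖ * ‖(Matrix.single γ α (1 : ℂ)) ⊗ₖ (1 : Matrix (Fin n) (Fin n) ℂ)‖ * ‖G‖ :=
            (norm_mul_le _ _).trans (by gcongr; exact norm_mul_le _ _)
        _ ≤ |z.im|⁻¹ * 1 * |z.im|⁻¹ := by
            gcongr
            exact norm_single_kronecker_le γ α
        _ = _ := by ring
    have e : ∀ y, greenDeriv s v h z (ptrCLM α γ) x y
        = (-((v / √(n : ℝ) : ℝ) : ℂ) * (n : ℂ)⁻¹) *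
          ∑ l, ∑ m, gueMatrix y l m * ∑ β, T (opp β, m) (β, l) := by
      intro y
      rw [greenDeriv_apply, ptrCLM_apply, ptr_mul_pauliX_kronecker_mul]
      exact (mul_assoc _ _ _).symm
    simp only [e, enorm_mul, mul_pow]
    rw [lintegral_const_mul' _ _ (by finiteness), hμ.lintegral_norm_sq]
    rw [mul_assoc, ENNReal.ofReal_mul (by positivity), ENNReal.ofReal_mul (by positivity),
      ← mul_assoc]
    gcongr
    · rw [enorm_neg, ← ofReal_norm, Complex.norm_real, ← ENNReal.ofReal_pow (norm_nonneg _),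
        Real.norm_eq_abs, sq_abs]
    · rw [← ofReal_norm, norm_inv, Complex.norm_natCast,
        ← ENNReal.ofReal_pow (by positivity)]
    · refine (sum_norm_sq_le T).trans ?_
      gcongr
  · rw [← ENNReal.ofReal_pow (by positivity), ← ENNReal.ofReal_mul (by positivity)]
    refine ENNReal.ofReal_le_ofReal (le_of_eq ?_)
    rw [div_pow v, Real.sq_sqrt (Nat.cast_nonneg n)]
    simp only [mul_pow, sq_abs]
    field_simp
    ring

end SpinReservoir

end

noncomputable section

namespace SpinReservoir

open scoped Matrix.Norms.L2Operator

variable {n : ℕ}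

/-! ### The symmetry `w ↦ -w` -/

theorem pauliZ_mul_self : pauliZ * pauliZ = 1 := by
  ext i j; fin_cases i <;> fin_cases j <;> simp [pauliZ]

theorem pauliZ_mul_pauliX_mul_pauliZ : pauliZ * pauliX * pauliZ = -pauliX := by
  ext i j; fin_cases i <;> fin_cases j <;> simp [pauliZ, pauliX]

theorem pauliZ_kronecker_mul_apply (Y : Matrix (Fin 2 × Fin n) (Fin 2 × Fin n) ℂ) (α : Fin 2)
    (j : Fin n) (q : Fin 2 × Fin n) :
    ((pauliZ ⊗ₖ (1 : Matrix (Fin n) (Fin n) ℂ)) * Y) (α, j) q = sgn α * Y (α, j) q := by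
  simp only [Matrix.mul_apply, Fintype.sum_prod_type, Matrix.kronecker_apply, Matrix.one_apply]
  fin_cases α <;> simp [pauliZ, sgn, Fin.sum_univ_two]

theorem mul_pauliZ_kronecker_apply (Y : Matrix (Fin 2 × Fin n) (Fin 2 × Fin n) ℂ) (γ : Fin 2)
    (j : Fin n) (p : Fin 2 × Fin n) :
    (Y * (pauliZ ⊗ₖ (1 : Matrix (Fin n) (Fin n) ℂ))) p (γ, j) = sgn γ * Y p (γ, j) := by
  simp only [Matrix.mul_apply, Fintype.sum_prod_type, Matrix.kronecker_apply, Matrix.one_apply]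
  fin_cases γ <;> simp [pauliZ, sgn, Fin.sum_univ_two]

variable {s v : ℝ} {h : Matrix (Fin n) (Fin n) ℂ} {z : ℂ}

theorem hamiltonian_neg (w : Matrix (Fin n) (Fin n) ℂ) : hamiltonian s v h (-w) =
    (pauliZ ⊗ₖ (1 : Matrix (Fin n) (Fin n) ℂ)) * hamiltonian s v h w *
      (pauliZ ⊗ₖ (1 : Matrix (Fin n) (Fin n) ℂ)) := by
  have e1 : pauliX ⊗ₖ (-w) = (-pauliX) ⊗ₖ w := by
    ext p q
    simp
  simp only [hamiltonian, mul_add, add_mul, Matrix.mul_smul, Matrix.smul_mul,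
    ← Matrix.mul_kronecker_mul, pauliZ_mul_self, pauliZ_mul_pauliX_mul_pauliZ, one_mul, mul_one, e1]

theorem greenAt_neg (hh : h.IsHermitian) (hz : z.im ≠ 0) (x : Fin n × Fin n → ℝ) :
    greenAt s v h z (-x) = (pauliZ ⊗ₖ (1 : Matrix (Fin n) (Fin n) ℂ)) * greenAt s v h z x *
      (pauliZ ⊗ₖ (1 : Matrix (Fin n) (Fin n) ℂ)) := by
  set Z : Matrix (Fin 2 × Fin n) (Fin 2 × Fin n) ℂ := pauliZ ⊗ₖ (1 : Matrix (Fin n) (Fin n) ℂ)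
    with hZ
  have hZZ : Z * Z = 1 := by
    rw [hZ, ← Matrix.mul_kronecker_mul, pauliZ_mul_self, one_mul, Matrix.one_kronecker_one]
  refine Matrix.inv_eq_right_inv ?_
  rw [map_neg, hamiltonian_neg, ← hZ]
  set H := hamiltonian s v h (gueMatrix x)
  have e : Z * H * Z - z • (1 : Matrix (Fin 2 × Fin n) (Fin 2 × Fin n) ℂ)
      = Z * (H - z • (1 : Matrix (Fin 2 × Fin n) (Fin 2 × Fin n) ℂ)) * Z := by
    rw [mul_sub, sub_mul, Matrix.mul_smul, Matrix.smul_mul, mul_one, hZZ]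
  have h1 := mul_green (hamiltonian_gueMatrix_isHermitian s v hh x) hz
  rw [e]
  calc Z * (H - z • 1) * Z * (Z * greenAt s v h z x * Z)
      = Z * ((H - z • 1) * (Z * Z) * greenAt s v h z x) * Z := by noncomm_ring
    _ = 1 := by rw [hZZ, mul_one, greenAt, h1, mul_one, hZZ]

/-- Reflection is the rotation by the angle `π`. -/
theorem integral_comp_neg_of_centered {E : Type*} [NormedAddCommGroup E] [NormedSpace ℝ E]
    [MeasurableSpace E] [BorelSpace E] [SecondCountableTopology E] [CompleteSpace E]
    {μ : Measure E} [IsGaussian μ] (hμ : ∀ L : StrongDual ℝ E, μ[L] = 0) {F : E → ℂ}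
    (hF : Continuous F) : ∫ x, F (-x) ∂μ = ∫ x, F x ∂μ := by
  have h := integral_rotation hμ Real.pi (f := fun q : E × E => F q.1) (by fun_prop)
  simp only [Real.cos_pi, Real.sin_pi, neg_smul, one_smul, zero_smul, add_zero] at h
  have e : ∀ G : E → ℂ, ∫ q : E × E, G q.1 ∂(μ.prod μ) = ∫ x, G x ∂μ := fun G => by
    rw [integral_fun_fst]; simp
  rwa [e fun x => F (-x), e F] at h

theorem continuous_ptr_greenAt (hh : h.IsHermitian) (hz : z.im ≠ 0) (α γ : Fin 2) :
    Continuous fun x => ptr (greenAt s v h z x) α γ :=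
  (ptrCLM α γ).continuous.comp (continuous_greenAt hh hz)

/-- Under `w ↦ -w`, which preserves the law, the resolvent is conjugated by `σᶻ ⊗ 1`, and this flips
the sign of the off-diagonal blocks. -/
theorem IsGUELaw.integral_ptr_eq_zero {μ : Measure (Fin n × Fin n → ℝ)} (hμ : IsGUELaw μ)
    (hh : h.IsHermitian) (hz : z.im ≠ 0) {α γ : Fin 2} (hαγ : α ≠ γ) :
    ∫ x, ptr (greenAt s v h z x) α γ ∂μ = 0 := by
  have := hμ.isGaussian
  have h1 := integral_comp_neg_of_centered hμ.centered
    (continuous_ptr_greenAt (s := s) (v := v) hh hz α γ)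
  have h2 : ∀ x, ptr (greenAt s v h z (-x)) α γ = -ptr (greenAt s v h z x) α γ := by
    intro x
    have h3 : (sgn α : ℂ) * sgn γ = -1 := by
      fin_cases α <;> fin_cases γ <;> simp [sgn] at hαγ ⊢
    rw [greenAt_neg hh hz, ptr, ptr, ← mul_neg, ← Finset.sum_neg_distrib]
    congr 1
    refine Finset.sum_congr rfl fun j _ => ?_
    rw [mul_pauliZ_kronecker_apply, pauliZ_kronecker_mul_apply]
    linear_combination greenAt s v h z x (α, j) (γ, j) * h3
  simp only [h2, integral_neg] at h1
  exact self_eq_neg.1 h1.symm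

/-! ### The Schwinger–Dyson equation -/

theorem IsGUELaw.integral_mul_comp_greenAt {μ : Measure (Fin n × Fin n → ℝ)}
    (hμ : IsGUELaw μ) (hh : h.IsHermitian) (hz : z.im ≠ 0) (L : (Fin n × Fin n → ℝ) →L[ℝ] ℂ)
    (Λ : Matrix (Fin 2 × Fin n) (Fin 2 × Fin n) ℂ →L[ℝ] ℂ) :
    ∫ x, L x * Λ (greenAt s v h z x) ∂μ = -((v / √(n : ℝ) : ℝ) : ℂ) * ∫ x, ∫ y, L y *
      Λ (greenAt s v h z x * (pauliX ⊗ₖ gueMatrix y) * greenAt s v h z x) ∂μ ∂μ := by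
  have := hμ.isGaussian
  obtain ⟨C', hC'⟩ : ∃ C', ∀ x, ‖greenDeriv s v h z Λ x‖ ≤ C' := ⟨_, norm_greenDeriv_le hh hz Λ⟩
  have h1 := gaussian_integral_mul hμ.centered L (hasFDerivAt_comp_greenAt hh hz Λ)
    (continuous_greenDeriv (s := s) (v := v) hh hz Λ) (norm_comp_greenAt_le hh hz Λ) hC'
  have hint : Integrable (fun r : (Fin n × Fin n → ℝ) × (Fin n × Fin n → ℝ) =>
      L r.2 * greenDeriv s v h z Λ r.1 r.2) (μ.prod μ) := by
    have h2 : Integrable (fun r : (Fin n × Fin n → ℝ) × (Fin n × Fin n → ℝ) =>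
        ‖L‖ * C' * ‖r.2‖ ^ 2) (μ.prod μ) :=
      (((IsGaussian.memLp_two_id (μ := μ)).integrable_norm_pow (by norm_num)).comp_snd μ).const_mul _
    refine h2.mono' ?_ (Eventually.of_forall fun r => ?_)
    · refine Continuous.aestronglyMeasurable ?_
      exact (L.continuous.comp continuous_snd).mul
        (((continuous_greenDeriv hh hz Λ).comp continuous_fst).clm_apply continuous_snd)
    · rw [norm_mul]
      calc ‖L r.2‖ * ‖greenDeriv s v h z Λ r.1 r.2‖ ≤ (‖L‖ * ‖r.2‖) * (C' * ‖r.2‖) := by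
            gcongr
            · exact L.le_opNorm _
            · exact ((greenDeriv s v h z Λ r.1).le_opNorm _).trans
                (mul_le_mul_of_nonneg_right (hC' _) (norm_nonneg _))
        _ = _ := by ring
  rw [h1, integral_prod _ hint, ← integral_const_mul]
  congr 1
  funext x
  rw [← integral_const_mul]
  congr 1
  funext y
  rw [greenDeriv_apply]
  ring

theorem IsGUELaw.integral_gueMatrix_mul_greenAt {μ : Measure (Fin n × Fin n → ℝ)}
    (hμ : IsGUELaw μ) (hh : h.IsHermitian) (hz : z.im ≠ 0) (l m : Fin n) (p q : Fin 2 × Fin n) :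
    ∫ x, gueMatrix x l m * greenAt s v h z x p q ∂μ = -((v / √(n : ℝ) : ℝ) : ℂ) *
      ∫ x, ∑ β, greenAt s v h z x p (β, m) * greenAt s v h z x (opp β, l) q ∂μ := by
  simp only [← hμ.integral_mul_contraction]
  exact hμ.integral_mul_comp_greenAt hh hz
    ((LinearMap.toContinuousLinearMap (Matrix.entryLinearMap ℝ ℂ l m)).comp gueMatrix)
    (LinearMap.toContinuousLinearMap (Matrix.entryLinearMap ℝ ℂ p q))

theorem one_kronecker_mul_apply (R : Matrix (Fin n) (Fin n) ℂ)
    (Y : Matrix (Fin 2 × Fin n) (Fin 2 × Fin n) ℂ) (α : Fin 2) (i : Fin n) (q : Fin 2 × Fin n) :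
    (((1 : Matrix (Fin 2) (Fin 2) ℂ) ⊗ₖ R) * Y) (α, i) q = ∑ l, R i l * Y (α, l) q := by
  simp only [Matrix.mul_apply, Fintype.sum_prod_type, Matrix.kronecker_apply, Matrix.one_apply]
  rw [Finset.sum_eq_single α]
  · simp
  · intro b _ hb; simp [hb.symm]
  · simp

theorem ptr_one_kronecker_mul_pauliX_mul (R M : Matrix (Fin n) (Fin n) ℂ)
    (Y : Matrix (Fin 2 × Fin n) (Fin 2 × Fin n) ℂ) (α : Fin 2) :
    ptr (((1 : Matrix (Fin 2) (Fin 2) ℂ) ⊗ₖ R) * (pauliX ⊗ₖ M) * Y) α α =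
      (n : ℂ)⁻¹ * ∑ i, ∑ l, ∑ m, R i l * (M l m * Y (opp α, m) (α, i)) := by
  rw [ptr]
  congr 1
  refine Finset.sum_congr rfl fun i _ => ?_
  rw [mul_pauliX_kronecker_mul_apply, Finset.sum_eq_single α]
  · simp only [Matrix.kronecker_apply, Matrix.one_apply_eq, one_mul]
    exact Finset.sum_congr rfl fun l _ => Finset.sum_congr rfl fun m _ => by ring
  · intro β _ hβ; simp [Matrix.one_apply_ne hβ.symm]
  · simp

theorem continuous_ptr_mul_greenAt (hh : h.IsHermitian) (hz : z.im ≠ 0)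
    (A : Matrix (Fin 2 × Fin n) (Fin 2 × Fin n) ℂ) (α γ : Fin 2) :
    Continuous fun x => ptr (A * greenAt s v h z x) α γ :=
  (ptrCLM α γ).continuous.comp (continuous_const.mul (continuous_greenAt hh hz))

theorem norm_ptr_mul_greenAt_le (hh : h.IsHermitian) (hz : z.im ≠ 0)
    (A : Matrix (Fin 2 × Fin n) (Fin 2 × Fin n) ℂ) (α γ : Fin 2) (x : Fin n × Fin n → ℝ) :
    ‖ptr (A * greenAt s v h z x) α γ‖ ≤ ‖A‖ * |z.im|⁻¹ :=
  (norm_ptr_le _ _ _).trans ((norm_mul_le _ _).trans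
    (by gcongr; exact norm_greenAt_le s v hh hz x))

theorem norm_ptr_greenAt_le (hh : h.IsHermitian) (hz : z.im ≠ 0) (α γ : Fin 2)
    (x : Fin n × Fin n → ℝ) : ‖ptr (greenAt s v h z x) α γ‖ ≤ |z.im|⁻¹ :=
  (norm_ptr_le _ _ _).trans (norm_greenAt_le s v hh hz x)

theorem integrable_of_bound {E : Type*} [TopologicalSpace E] [MeasurableSpace E] [BorelSpace E]
    {μ : Measure E} [IsFiniteMeasure μ] {F : E → ℂ} (hF : Continuous F) {C : ℝ}
    (hC : ∀ x, ‖F x‖ ≤ C) : Integrable F μ :=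
  Integrable.of_bound hF.measurable.aestronglyMeasurable C (Eventually.of_forall hC)

/-- Contracting `W_{lm}` with the resolvent separates the sum over `m` from the sums over `i` and
`l`. Each closes up into a partial trace; two normalizations appear where one was present, which
accounts for the factor `n`. -/
theorem IsGUELaw.integral_ptr_mul_pauliX_mul {μ : Measure (Fin n × Fin n → ℝ)}
    (hμ : IsGUELaw μ) (hn : n ≠ 0) (hh : h.IsHermitian) (hz : z.im ≠ 0)
    (R : Matrix (Fin n) (Fin n) ℂ) (α : Fin 2) :
    Integrable (fun x => ptr (((1 : Matrix (Fin 2) (Fin 2) ℂ) ⊗ₖ R) * (pauliX ⊗ₖ gueMatrix x)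
      * greenAt s v h z x) α α) μ ∧
    ∫ x, ptr (((1 : Matrix (Fin 2) (Fin 2) ℂ) ⊗ₖ R) * (pauliX ⊗ₖ gueMatrix x)
      * greenAt s v h z x) α α ∂μ = -((v / √(n : ℝ) : ℝ) : ℂ) * n *
      ∫ x, ∑ β, ptr (greenAt s v h z x) (opp α) β *
        ptr (((1 : Matrix (Fin 2) (Fin 2) ℂ) ⊗ₖ R) * greenAt s v h z x) (opp β) α ∂μ := by
  have := hμ.isGaussian
  have hn' : (n : ℂ) ≠ 0 := by exact_mod_cast hn
  have hent : ∀ (p q : Fin 2 × Fin n), Continuous fun x => greenAt s v h z x p q := fun p q =>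
    (LinearMap.toContinuousLinearMap (Matrix.entryLinearMap ℝ ℂ p q)).continuous.comp
      (continuous_greenAt hh hz)
  have hentb : ∀ (p q : Fin 2 × Fin n) x, ‖greenAt s v h z x p q‖ ≤ |z.im|⁻¹ := fun p q x =>
    (norm_entry_le _ _ _).trans (norm_greenAt_le s v hh hz x)
  have hi : ∀ i l m, Integrable (fun x => R i l * (gueMatrix x l m *
      greenAt s v h z x (opp α, m) (α, i))) μ := by
    intro i l m
    refine Integrable.const_mul ?_ _
    set L : (Fin n × Fin n → ℝ) →L[ℝ] ℂ :=
      (LinearMap.toContinuousLinearMap (Matrix.entryLinearMap ℝ ℂ l m)).comp gueMatrix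
    have h1 : Integrable (fun x => L x) μ :=
      L.integrable_comp ((IsGaussian.memLp_two_id (μ := μ)).integrable (by norm_num))
    exact h1.mul_bdd (c := |z.im|⁻¹) (hent _ _).measurable.aestronglyMeasurable
      (Eventually.of_forall (hentb _ _))
  simp only [ptr_one_kronecker_mul_pauliX_mul]
  refine ⟨(integrable_finsetSum _ fun i _ => integrable_finsetSum _ fun l _ =>
    integrable_finsetSum _ fun m _ => hi i l m).const_mul _, ?_⟩
  rw [integral_const_mul, integral_finsetSum _ fun i _ => integrable_finsetSum _ fun l _ =>
    integrable_finsetSum _ fun m _ => hi i l m]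
  simp only [integral_finsetSum _ fun l _ => integrable_finsetSum _ fun m _ => hi _ l m,
    integral_finsetSum _ fun m _ => hi _ _ m, integral_const_mul,
    hμ.integral_gueMatrix_mul_greenAt hh hz]
  have hi2 : ∀ l m i, Integrable (fun x => ∑ β, greenAt s v h z x (opp α, m) (β, m) *
      greenAt s v h z x (opp β, l) (α, i)) μ := fun l m i =>
    integrable_finsetSum _ fun β _ => integrable_of_bound ((hent _ _).mul (hent _ _))
      (C := |z.im|⁻¹ * |z.im|⁻¹) fun x => by
        rw [norm_mul]
        gcongr <;> exact hentb _ _ _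
  have e : ∀ x, ∑ β, ptr (greenAt s v h z x) (opp α) β *
      ptr (((1 : Matrix (Fin 2) (Fin 2) ℂ) ⊗ₖ R) * greenAt s v h z x) (opp β) α =
      (n : ℂ)⁻¹ * (n : ℂ)⁻¹ * ∑ i, ∑ l, ∑ m, R i l * ∑ β, greenAt s v h z x (opp α, m) (β, m) *
        greenAt s v h z x (opp β, l) (α, i) := by
    intro x
    simp only [ptr, one_kronecker_mul_apply]
    have e1 : ∀ β : Fin 2, ((n : ℂ)⁻¹ * ∑ m, greenAt s v h z x (opp α, m) (β, m)) *
        ((n : ℂ)⁻¹ * ∑ i, ∑ l, R i l * greenAt s v h z x (opp β, l) (α, i)) =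
        (n : ℂ)⁻¹ * (n : ℂ)⁻¹ * ∑ i, ∑ l, ∑ m, R i l * (greenAt s v h z x (opp α, m) (β, m) *
          greenAt s v h z x (opp β, l) (α, i)) := by
      intro β
      rw [mul_mul_mul_comm]
      congr 1
      rw [Finset.mul_sum]
      refine Finset.sum_congr rfl fun i _ => ?_
      rw [Finset.mul_sum]
      refine Finset.sum_congr rfl fun l _ => ?_
      rw [Finset.sum_mul]
      exact Finset.sum_congr rfl fun m _ => by ring
    rw [Finset.sum_congr rfl fun β _ => e1 β, ← Finset.mul_sum]
    congr 1
    rw [Finset.sum_comm]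
    refine Finset.sum_congr rfl fun i _ => ?_
    rw [Finset.sum_comm]
    refine Finset.sum_congr rfl fun l _ => ?_
    rw [Finset.sum_comm]
    refine Finset.sum_congr rfl fun m _ => ?_
    rw [Finset.mul_sum]
  simp only [e]
  rw [integral_const_mul, integral_finsetSum _ fun i _ => integrable_finsetSum _ fun l _ =>
    integrable_finsetSum _ fun m _ => (hi2 l m i).const_mul _]
  simp only [integral_finsetSum _ fun l _ => integrable_finsetSum _ fun m _ =>
    (hi2 l m _).const_mul _, integral_finsetSum _ fun m _ => (hi2 _ m _).const_mul _,
    integral_const_mul]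
  have e3 : ∀ X : ℂ, -((v / √(n : ℝ) : ℝ) : ℂ) * n * ((n : ℂ)⁻¹ * (n : ℂ)⁻¹ * X)
      = (n : ℂ)⁻¹ * (-((v / √(n : ℝ) : ℝ) : ℂ) * X) := fun X => by
    field_simp
  rw [e3]
  congr 1
  simp only [Finset.mul_sum]
  refine Finset.sum_congr rfl fun i _ => Finset.sum_congr rfl fun l _ =>
    Finset.sum_congr rfl fun m _ => ?_
  ring

end SpinReservoir

end

noncomputable section

namespace SpinReservoir

open scoped Matrix.Norms.L2Operator

variable {n : ℕ} {s v : ℝ} {h : Matrix (Fin n) (Fin n) ℂ} {z : ℂ}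

/-! ### The approximate functional equation for the mean resolvent -/

theorem integral_norm_le_of_lintegral_sq_le {E : Type*} [TopologicalSpace E] [MeasurableSpace E]
    [BorelSpace E] {μ : Measure E} [IsProbabilityMeasure μ] {Y : E → ℂ} (hY : Continuous Y) {C K : ℝ}
    (hC : ∀ x, ‖Y x‖ ≤ C) (hK : 0 ≤ K) (hYK : ∫⁻ x, ‖Y x‖ₑ ^ 2 ∂μ ≤ ENNReal.ofReal (K ^ 2)) :
    ∫ x, ‖Y x‖ ∂μ ≤ K := by
  have h1 : Integrable (fun x => ‖Y x‖) μ := (integrable_of_bound hY hC).norm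
  have h2 : Integrable (fun x => ‖Y x‖ ^ 2) μ := by
    refine Integrable.of_bound (hY.norm.pow 2).measurable.aestronglyMeasurable (C ^ 2)
      (Eventually.of_forall fun x => ?_)
    rw [Real.norm_of_nonneg (by positivity)]
    exact pow_le_pow_left₀ (norm_nonneg _) (hC x) 2
  have h3 := integral_mul_sq_le (ν := μ) (f := fun x => ‖Y x‖) (g := fun _ => 1) h2
    (integrable_const _) (by simpa using h1)
  have h4 : ∫ x, ‖Y x‖ ^ 2 ∂μ ≤ K ^ 2 := by
    rw [integral_eq_lintegral_of_nonneg_ae (Eventually.of_forall fun x => by positivity)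
      h2.aestronglyMeasurable]
    refine ENNReal.toReal_le_of_le_ofReal (by positivity) (le_trans (le_of_eq ?_) hYK)
    refine lintegral_congr fun x => ?_
    rw [ENNReal.ofReal_pow (norm_nonneg _), ofReal_norm]
  simp only [mul_one, one_pow, integral_const, smul_eq_mul, probReal_univ] at h3
  exact le_of_sq_le_sq (h3.trans h4) hK

theorem stieltjes_countingMeasure (hh : h.IsHermitian) {ζ : ℂ} (hζ : ζ.im ≠ 0) (α : Fin 2) :
    stieltjes (countingMeasure hh) ζ = ptr ((1 : Matrix (Fin 2) (Fin 2) ℂ) ⊗ₖ green h ζ) α α := by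
  have h1 : ptr ((1 : Matrix (Fin 2) (Fin 2) ℂ) ⊗ₖ green h ζ) α α
      = (n : ℂ)⁻¹ * (green h ζ).trace := by
    simp [ptr, Matrix.trace]
  rw [h1, green_eq_udiag (eq_udiag hh) hζ, trace_udiag, stieltjes, countingMeasure,
    integral_smul_measure, integral_finsetSum_measure fun k _ => integrable_dirac (by simp)]
  simp

theorem norm_one_kronecker_le (M : Matrix (Fin n) (Fin n) ℂ) :
    ‖(1 : Matrix (Fin 2) (Fin 2) ℂ) ⊗ₖ M‖ ≤ ‖M‖ :=
  norm_kronecker_le (Equiv.refl _) (c := fun _ => 1)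
    (fun α γ => by simp [Matrix.one_apply, eq_comm]) (fun _ => by simp) M

/-- A diagonal partial trace is the transform of the spectral measure in a coordinate direction. For
`n = 0` the trace is an empty sum, hence the weak inequality. -/
theorem ptr_green_im_mul_nonneg {H : Matrix (Fin 2 × Fin n) (Fin 2 × Fin n) ℂ}
    (hH : H.IsHermitian) (hz : z.im ≠ 0) (γ : Fin 2) : 0 ≤ (ptr (green H z) γ γ).im * z.im := by
  cases n with
  | zero => simp [ptr]
  | succ m =>
    rw [← stieltjes_dirProb_single hH γ hz]
    exact (stieltjes_im_mul_pos _ hz).le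

theorem integral_ptr_greenAt_im_mul_nonneg {μ : Measure (Fin n × Fin n → ℝ)}
    [IsProbabilityMeasure μ] (hh : h.IsHermitian) (hz : z.im ≠ 0) (γ : Fin 2) :
    0 ≤ (∫ x, ptr (greenAt s v h z x) γ γ ∂μ).im * z.im := by
  have hi : Integrable (fun x => ptr (greenAt s v h z x) γ γ) μ :=
    integrable_of_bound (continuous_ptr_greenAt hh hz γ γ) (norm_ptr_greenAt_le hh hz γ γ)
  have e : (∫ x, ptr (greenAt s v h z x) γ γ ∂μ).im = ∫ x, (ptr (greenAt s v h z x) γ γ).im ∂μ :=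
    (Complex.imCLM.integral_comp_comm hi).symm
  rw [e, ← integral_mul_const]
  exact integral_nonneg fun x =>
    ptr_green_im_mul_nonneg (hamiltonian_gueMatrix_isHermitian s v hh x) hz γ

theorem sum_eq_opp_add (F : Fin 2 → ℂ) (α : Fin 2) : ∑ β, F β = F (opp α) + F α := by
  fin_cases α <;> simp [opp, Fin.sum_univ_two, add_comm]

theorem opp_ne (α : Fin 2) : opp α ≠ α := by fin_cases α <;> simp [opp]

/-- The resolvent equation, with the self-energy subtracted. -/
theorem ptr_one_kronecker_green (hh : h.IsHermitian) (hz : z.im ≠ 0) (α : Fin 2) (f : ℂ)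
    (hf : 0 ≤ f.im * z.im) (x : Fin n × Fin n → ℝ) :
    ptr ((1 : Matrix (Fin 2) (Fin 2) ℂ) ⊗ₖ green h (subordinate s v α z f)) α α =
      ptr (greenAt s v h z x) α α
      + (v : ℂ) ^ 2 * f * ptr (((1 : Matrix (Fin 2) (Fin 2) ℂ) ⊗ₖ
          green h (subordinate s v α z f)) * greenAt s v h z x) α α
      + ((v / √(n : ℝ) : ℝ) : ℂ) * ptr (((1 : Matrix (Fin 2) (Fin 2) ℂ) ⊗ₖ
          green h (subordinate s v α z f)) * (pauliX ⊗ₖ gueMatrix x) * greenAt s v h z x) α α := by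
  set ζ := subordinate s v α z f with hζ
  have hζ0 : ζ.im ≠ 0 := subordinate_im_ne_zero s v α hz hf
  set J := (1 : Matrix (Fin 2) (Fin 2) ℂ) ⊗ₖ green h ζ with hJ
  set Z : Matrix (Fin 2 × Fin n) (Fin 2 × Fin n) ℂ := pauliZ ⊗ₖ (1 : Matrix (Fin n) (Fin n) ℂ)
    with hZ
  set G := greenAt s v h z x
  set X := pauliX ⊗ₖ gueMatrix x
  set c : ℂ := ((v / √(n : ℝ) : ℝ) : ℂ)
  have h1 : (hamiltonian s v h (gueMatrix x) - z • (1 : Matrix _ _ ℂ)) * G = 1 :=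
    mul_green (hamiltonian_gueMatrix_isHermitian s v hh x) hz
  have h2 : J * ((1 : Matrix (Fin 2) (Fin 2) ℂ) ⊗ₖ h) = 1 + ζ • J := by
    have h3 := green_mul hh hζ0
    rw [mul_sub, sub_eq_iff_eq_add, Matrix.mul_smul, mul_one] at h3
    rw [hJ, ← Matrix.mul_kronecker_mul, h3, one_mul, Matrix.kronecker_add,
      Matrix.one_kronecker_one, Matrix.kronecker_smul]
  have h4 : J * Z = Z * J := by
    rw [hJ, hZ, ← Matrix.mul_kronecker_mul, ← Matrix.mul_kronecker_mul]
    simp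
  have h5 : J = G + (s : ℂ) • (Z * (J * G)) + (ζ - z) • (J * G) + c • (J * X * G) := by
    calc J = J * ((hamiltonian s v h (gueMatrix x) - z • (1 : Matrix _ _ ℂ)) * G) := by
          rw [h1, mul_one]
      _ = (J * ((1 : Matrix (Fin 2) (Fin 2) ℂ) ⊗ₖ h) + (s : ℂ) • (J * Z) + c • (J * X)
            - z • J) * G := by
          rw [← mul_assoc]
          congr 1
          simp only [hamiltonian, mul_sub, mul_add, Matrix.mul_smul, mul_one]
          abel
      _ = _ := by
          rw [h2, h4]
          simp only [add_mul, sub_mul, Matrix.smul_mul, one_mul, sub_smul, mul_assoc]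
          abel
  have hlin : ∀ (a : ℂ) (Y : Matrix (Fin 2 × Fin n) (Fin 2 × Fin n) ℂ),
      ptr (a • Y) α α = a * ptr Y α α := by
    intro a Y
    simp only [ptr, Matrix.smul_apply, smul_eq_mul, ← Finset.mul_sum]
    ring
  have hadd : ∀ (Y Y' : Matrix (Fin 2 × Fin n) (Fin 2 × Fin n) ℂ),
      ptr (Y + Y') α α = ptr Y α α + ptr Y' α α := fun Y Y' => map_add (ptrCLM α α) Y Y'
  have hZp : ∀ Y : Matrix (Fin 2 × Fin n) (Fin 2 × Fin n) ℂ,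
      ptr (Z * Y) α α = sgn α * ptr Y α α := by
    intro Y
    simp only [ptr, hZ, pauliZ_kronecker_mul_apply, ← Finset.mul_sum]
    ring
  have h6 := congrArg (fun Y => ptr Y α α) h5
  simp only [hadd, hlin, hZp] at h6
  rw [h6, hζ, subordinate]
  ring

/-- Let `J` be the resolvent of `1 ⊗ h` at the argument shifted by `v² f`, where `f` is the mean
trace of opposite sign. Integration by parts produces `-v² g_{-α,-α}` times the trace of `J G`,
which the shift cancels up to the fluctuation `g_{-α,-α} - f`, and a term with the off-diagonal
`g_{-α,α}`, whose mean is zero. Both have first absolute moment of order `1/n` by the variance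
bound. -/
theorem IsGUELaw.norm_sub_stieltjes_le {μ : Measure (Fin n × Fin n → ℝ)} (hμ : IsGUELaw μ)
    (hn : n ≠ 0) (hh : h.IsHermitian) (hz : z.im ≠ 0) (α : Fin 2) :
    ‖∫ x, ptr (greenAt s v h z x) α α ∂μ - stieltjes (countingMeasure hh)
      (subordinate s v α z (∫ x, ptr (greenAt s v h z x) (opp α) (opp α) ∂μ))‖
      ≤ v ^ 2 * (2 * (|z.im|⁻¹ ^ 2 * (Real.pi * |v| * |z.im|⁻¹ ^ 2 * (n : ℝ)⁻¹))) := by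
  have := hμ.isGaussian
  have hn' : (n : ℂ) ≠ 0 := by exact_mod_cast hn
  set f := ∫ x, ptr (greenAt s v h z x) (opp α) (opp α) ∂μ with hfdef
  have hf : 0 ≤ f.im * z.im := integral_ptr_greenAt_im_mul_nonneg hh hz (opp α)
  clear_value f
  have hζ0 := subordinate_im_ne_zero s v α hz hf
  rw [stieltjes_countingMeasure hh hζ0 α]
  set J := (1 : Matrix (Fin 2) (Fin 2) ℂ) ⊗ₖ green h (subordinate s v α z f) with hJ
  have hJn : ‖J‖ ≤ |z.im|⁻¹ := (norm_one_kronecker_le _).trans ((norm_green_le hh hζ0).trans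
    (inv_anti₀ (abs_pos.2 hz) (abs_im_le_subordinate_im s v α hf)))
  set c : ℂ := ((v / √(n : ℝ) : ℝ) : ℂ) with hc
  have hcc : c * c * n = (v : ℂ) ^ 2 := by
    have : (v / √(n : ℝ)) * (v / √(n : ℝ)) * n = v ^ 2 := by
      have hn0 : (n : ℝ) ≠ 0 := by exact_mod_cast hn
      rw [div_mul_div_comm, Real.mul_self_sqrt (Nat.cast_nonneg n)]
      field_simp
    rw [hc, ← Complex.ofReal_mul, ← Complex.ofReal_natCast, ← Complex.ofReal_mul, this]
    push_cast; rfl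
  obtain ⟨hXi, hX⟩ := hμ.integral_ptr_mul_pauliX_mul (s := s) (v := v) hn hh hz
    (green h (subordinate s v α z f)) α
  rw [← hJ, ← hc] at hX
  rw [← hJ] at hXi
  have hg : ∀ a b, Continuous fun x => ptr (greenAt s v h z x) a b := continuous_ptr_greenAt hh hz
  have hgb := norm_ptr_greenAt_le (s := s) (v := v) hh hz
  have hp : ∀ a b, Continuous fun x => ptr (J * greenAt s v h z x) a b :=
    continuous_ptr_mul_greenAt hh hz J
  have hpb : ∀ a b x, ‖ptr (J * greenAt s v h z x) a b‖ ≤ |z.im|⁻¹ ^ 2 := fun a b x =>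
    (norm_ptr_mul_greenAt_le hh hz J a b x).trans (by rw [sq]; gcongr)
  have hgi : ∀ a b, Integrable (fun x => ptr (greenAt s v h z x) a b) μ := fun a b =>
    integrable_of_bound (hg a b) (hgb a b)
  have hpi : ∀ a b, Integrable (fun x => ptr (J * greenAt s v h z x) a b) μ := fun a b =>
    integrable_of_bound (hp a b) (hpb a b)
  have hgpi : ∀ a b c d, Integrable (fun x => ptr (greenAt s v h z x) a b *
      ptr (J * greenAt s v h z x) c d) μ := fun a b c d =>
    integrable_of_bound ((hg a b).mul (hp c d)) (C := |z.im|⁻¹ * |z.im|⁻¹ ^ 2) fun x => by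
      rw [norm_mul]
      exact mul_le_mul (hgb a b x) (hpb c d x) (norm_nonneg _) (by positivity)
  have hpt : ptr J α α = ∫ x, ptr (greenAt s v h z x) α α ∂μ
      + (v : ℂ) ^ 2 * f * ∫ x, ptr (J * greenAt s v h z x) α α ∂μ
      + c * ∫ x, ptr (J * (pauliX ⊗ₖ gueMatrix x) * greenAt s v h z x) α α ∂μ := by
    rw [← integral_const_mul, ← integral_const_mul, ← integral_add (hgi _ _)
      ((hpi _ _).const_mul _), ← integral_add _ (hXi.const_mul _)]
    · simp only [hJ, hc, ← ptr_one_kronecker_green hh hz α f hf]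
      simp
    · exact (hgi _ _).add ((hpi _ _).const_mul _)
  have hopp : opp (opp α) = α := opp_opp α
  -- The two terms are `β = -α` and `β = α` of the integration by parts formula, where `v² n / n =
  -- v²`.
  have hkey : ∫ x, ptr (greenAt s v h z x) α α ∂μ - ptr J α α = (v : ℂ) ^ 2 *
      ∫ x, ((ptr (greenAt s v h z x) (opp α) (opp α) - f) * ptr (J * greenAt s v h z x) α α
        + ptr (greenAt s v h z x) (opp α) α * ptr (J * greenAt s v h z x) (opp α) α) ∂μ := by
    have e1 : ∫ x, ((ptr (greenAt s v h z x) (opp α) (opp α) - f)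
        * ptr (J * greenAt s v h z x) α α
        + ptr (greenAt s v h z x) (opp α) α * ptr (J * greenAt s v h z x) (opp α) α) ∂μ
        = ∫ x, ∑ β, ptr (greenAt s v h z x) (opp α) β *
          ptr (J * greenAt s v h z x) (opp β) α ∂μ
          - f * ∫ x, ptr (J * greenAt s v h z x) α α ∂μ := by
      rw [← integral_const_mul, ← integral_sub _ ((hpi _ _).const_mul _)]
      · refine integral_congr_ae (Eventually.of_forall fun x => ?_)
        simp only [sum_eq_opp_add _ α, hopp]
        ring
      · exact integrable_finsetSum _ fun β _ => hgpi _ _ _ _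
    rw [e1, hpt, hX]
    linear_combination (∫ x, ∑ β, ptr (greenAt s v h z x) (opp α) β *
          ptr (J * greenAt s v h z x) (opp β) α ∂μ) * hcc
  rw [hkey, norm_mul, norm_pow, Complex.norm_real, Real.norm_eq_abs, sq_abs]
  refine mul_le_mul_of_nonneg_left ?_ (sq_nonneg v)
  set K := Real.pi * |v| * |z.im|⁻¹ ^ 2 * (n : ℝ)⁻¹ with hK
  have hK0 : 0 ≤ K := by positivity
  have hb1 : ∫ x, ‖ptr (greenAt s v h z x) (opp α) (opp α) - f‖ ∂μ ≤ K := by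
    refine integral_norm_le_of_lintegral_sq_le ((hg _ _).sub continuous_const)
      (C := |z.im|⁻¹ + ‖f‖) (fun x => (norm_sub_le _ _).trans (by gcongr; exact hgb _ _ x)) hK0 ?_
    rw [hfdef]
    exact hμ.variance_le hh hz hn (opp α) (opp α)
  have hb2 : ∫ x, ‖ptr (greenAt s v h z x) (opp α) α‖ ∂μ ≤ K := by
    refine integral_norm_le_of_lintegral_sq_le (hg _ _) (hgb _ _) hK0 ?_
    have := hμ.variance_le (s := s) (v := v) hh hz hn (opp α) α
    rw [hμ.integral_ptr_eq_zero hh hz (opp_ne α)] at this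
    simpa only [sub_zero] using this
  have hi1 : Integrable (fun x => ‖ptr (greenAt s v h z x) (opp α) (opp α) - f‖) μ :=
    ((hgi _ _).sub (integrable_const _)).norm
  have hi2 : Integrable (fun x => ‖ptr (greenAt s v h z x) (opp α) α‖) μ := (hgi _ _).norm
  refine (norm_integral_le_of_norm_le ((hi1.add hi2).const_mul (|z.im|⁻¹ ^ 2))
    (Eventually.of_forall fun x => ?_)).trans ?_
  · refine (norm_add_le _ _).trans ?_
    rw [norm_mul, norm_mul, Pi.add_apply, mul_add, mul_comm (|z.im|⁻¹ ^ 2),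
      mul_comm (|z.im|⁻¹ ^ 2)]
    gcongr <;> exact hpb _ _ x
  · rw [integral_const_mul]
    simp only [Pi.add_apply]
    rw [integral_add hi1 hi2]
    have : 0 ≤ |z.im|⁻¹ ^ 2 := by positivity
    nlinarith

end SpinReservoir

end

noncomputable section

namespace SpinReservoir

open scoped Matrix.Norms.L2Operator

variable {n : ℕ}

/-! ### The operator norm of a GUE matrix -/

/-- The quadratic form of a matrix. -/
def quadForm (W : Matrix (Fin n) (Fin n) ℂ) (u : EuclideanSpace ℂ (Fin n)) : ℝ :=
  (∑ l, ∑ m, W l m * (star (u l) * u m)).re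

theorem quadForm_eq_inner (W : Matrix (Fin n) (Fin n) ℂ) (u : EuclideanSpace ℂ (Fin n)) :
    quadForm W u = (inner ℂ u (Matrix.toEuclideanCLM (𝕜 := ℂ) W u)).re := by
  rw [quadForm, PiLp.inner_apply]
  congr 1
  refine Finset.sum_congr rfl fun l _ => ?_
  rw [Matrix.ofLp_toEuclideanCLM, RCLike.inner_apply, Matrix.mulVec, dotProduct, Finset.sum_mul]
  refine Finset.sum_congr rfl fun m _ => ?_
  rw [Complex.star_def]
  ring

/-- Take a unit eigenvector `u₀` for the eigenvalue `a` of largest modulus. At `u₀ + d` with `‖d‖ ≤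
1/4` the form is `a (1 + 2 Re⟨u₀, d⟩)`, of modulus at least `|a|/2`, up to an error of at most
`|a|/16`; hence `7/16`. -/
theorem exists_le_abs_quadForm (hn : n ≠ 0) {W : Matrix (Fin n) (Fin n) ℂ} (hW : W.IsHermitian) :
    ∃ u₀ : EuclideanSpace ℂ (Fin n), ‖u₀‖ = 1 ∧
      ∀ u, ‖u - u₀‖ ≤ 1 / 4 → 7 / 16 * ‖W‖ ≤ |quadForm W u| := by
  have : Nonempty (Fin n) := ⟨⟨0, Nat.pos_of_ne_zero hn⟩⟩
  obtain ⟨k, hk⟩ := Finite.exists_max fun k => |hW.eigenvalues k|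
  have hnorm : ‖W‖ ≤ |hW.eigenvalues k| := by
    rw [congrArg norm (eq_udiag hW)]
    refine norm_udiag_le _ (abs_nonneg _) fun j => ?_
    rw [Complex.norm_real]
    exact hk j
  set T := Matrix.toEuclideanCLM (𝕜 := ℂ) W with hT
  have hTn : ‖T‖ = ‖W‖ := Matrix.l2_opNorm_toEuclideanCLM W
  set u₀ := hW.eigenvectorBasis k with hu₀
  have hu : ‖u₀‖ = 1 := hW.eigenvectorBasis.orthonormal.1 k
  set a := hW.eigenvalues k
  have hTu : T u₀ = (a : ℂ) • u₀ := by
    have := hW.mulVec_eigenvectorBasis k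
    ext i
    rw [hT, Matrix.ofLp_toEuclideanCLM, this]
    simp
    rfl
  have hsymm : ∀ x y, inner ℂ (T x) y = inner ℂ x (T y) :=
    Matrix.isSymmetric_toEuclideanLin_iff.2 hW
  refine ⟨u₀, hu, fun u hd => ?_⟩
  set d := u - u₀ with hdef
  have hud : u = u₀ + d := by rw [hdef]; abel
  have h1 : inner ℂ u₀ u₀ = (1 : ℂ) := by
    rw [inner_self_eq_norm_sq_to_K, hu]; simp
  have h2 : |(inner ℂ u₀ d : ℂ).re| ≤ 1 / 4 :=
    (Complex.abs_re_le_norm _).trans ((norm_inner_le_norm _ _).trans (by rw [hu, one_mul]; exact hd))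
  have h3 : |(inner ℂ d (T d) : ℂ).re| ≤ |a| * (1 / 16) := by
    refine (Complex.abs_re_le_norm _).trans ((norm_inner_le_norm _ _).trans ?_)
    have h4 : ‖T d‖ ≤ |a| * (1 / 4) :=
      (T.le_opNorm d).trans (mul_le_mul (hTn.le.trans hnorm) hd (norm_nonneg _) (abs_nonneg _))
    calc ‖d‖ * ‖T d‖ ≤ 1 / 4 * (|a| * (1 / 4)) := by gcongr
      _ = _ := by ring
  have h5 : quadForm W u = a * (1 + 2 * (inner ℂ u₀ d : ℂ).re) + (inner ℂ d (T d) : ℂ).re := by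
    have h6 : (inner ℂ d u₀ : ℂ).re = (inner ℂ u₀ d : ℂ).re := by
      rw [← inner_conj_symm, Complex.conj_re]
    rw [quadForm_eq_inner, ← hT, hud, map_add, inner_add_left, inner_add_right, inner_add_right,
      ← hsymm u₀ d, hTu, inner_smul_left, inner_smul_right, inner_smul_right, h1,
      Complex.conj_ofReal]
    simp only [Complex.add_re, Complex.re_ofReal_mul, Complex.one_re, h6]
    ring
  rw [h5]
  have h7 : |a| * (1 / 2) ≤ |a * (1 + 2 * (inner ℂ u₀ d : ℂ).re)| := by
    rw [abs_mul]
    gcongr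
    refine le_trans ?_ (le_abs_self _)
    linarith [(abs_le.1 h2).1]
  have h8 := abs_sub_abs_le_abs_add (a * (1 + 2 * (inner ℂ u₀ d : ℂ).re)) (inner ℂ d (T d) : ℂ).re
  nlinarith [norm_nonneg W]

/-- The quadratic form of `gueMatrix` at `u`, as a continuous linear functional. -/
def quadFormCLM (u : EuclideanSpace ℂ (Fin n)) : StrongDual ℝ (Fin n × Fin n → ℝ) :=
  (LinearMap.toContinuousLinearMap
    { toFun := fun W => quadForm W u
      map_add' := fun W W' => by
        simp only [quadForm, Matrix.add_apply, add_mul, Finset.sum_add_distrib, Complex.add_re]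
      map_smul' := fun c W => by
        simp only [quadForm, Matrix.smul_apply, Complex.real_smul, mul_assoc, ← Finset.mul_sum,
          Complex.re_ofReal_mul, RingHom.id_apply, smul_eq_mul] }).comp gueMatrix

theorem quadFormCLM_apply (u : EuclideanSpace ℂ (Fin n)) (x : Fin n × Fin n → ℝ) :
    quadFormCLM u x = quadForm (gueMatrix x) u := rfl

/-- The form is the real part of a linear form in the entries with coefficients `ū_l u_m`, whose
squared moduli sum to `‖u‖⁴`. -/
theorem IsGUELaw.variance_quadForm_le {μ : Measure (Fin n × Fin n → ℝ)} (hμ : IsGUELaw μ)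
    (u : EuclideanSpace ℂ (Fin n)) : Var[quadFormCLM u; μ] ≤ ‖u‖ ^ 4 := by
  have := hμ.isGaussian
  rw [variance_of_integral_eq_zero (quadFormCLM u).continuous.measurable.aemeasurable
    (hμ.centered _), integral_eq_lintegral_of_nonneg_ae (f := fun x => quadFormCLM u x ^ 2)
    (Eventually.of_forall fun x => sq_nonneg _)
    ((quadFormCLM u).continuous.pow 2).measurable.aestronglyMeasurable]
  refine ENNReal.toReal_le_of_le_ofReal (by positivity) ?_
  have h1 := hμ.lintegral_norm_sq fun l m => star (u l) * u m
  have h2 : ∑ l, ∑ m, ‖star (u l) * u m‖ ^ 2 = ‖u‖ ^ 4 := by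
    have h3 : ‖u‖ ^ 4 = (∑ l, ‖u l‖ ^ 2) * ∑ m, ‖u m‖ ^ 2 := by
      rw [← EuclideanSpace.norm_sq_eq]; ring
    rw [h3, Finset.sum_mul_sum]
    simp only [norm_mul, norm_star, mul_pow]
  rw [h2] at h1
  rw [← h1]
  refine lintegral_mono fun x => ?_
  rw [← ofReal_norm, ← ENNReal.ofReal_pow (norm_nonneg _)]
  refine ENNReal.ofReal_le_ofReal ?_
  rw [← sq_abs]
  exact pow_le_pow_left₀ (abs_nonneg _) (Complex.abs_re_le_norm _) 2

theorem IsGUELaw.lintegral_exp_le {μ : Measure (Fin n × Fin n → ℝ)} (hμ : IsGUELaw μ)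
    (u : EuclideanSpace ℂ (Fin n)) (t : ℝ) :
    ∫⁻ x, ENNReal.ofReal (Real.exp (t * quadFormCLM u x)) ∂μ
      ≤ ENNReal.ofReal (Real.exp (‖u‖ ^ 4 * t ^ 2 / 2)) := by
  have := hμ.isGaussian
  have hmap := IsGaussian.map_eq_gaussianReal (μ := μ) (quadFormCLM u)
  rw [hμ.centered] at hmap
  have hi : Integrable (fun x => Real.exp (t * quadFormCLM u x)) μ := by
    have h := integrable_exp_mul_gaussianReal (μ := 0)
      (v := Var[quadFormCLM u; μ].toNNReal) t
    rw [← hmap] at h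
    exact (integrable_map_measure (g := fun y => Real.exp (t * y)) (by fun_prop)
      (by fun_prop)).1 h
  rw [← ofReal_integral_eq_lintegral_ofReal hi (Eventually.of_forall fun x => (Real.exp_pos _).le)]
  refine ENNReal.ofReal_le_ofReal ?_
  have h := mgf_gaussianReal hmap t
  rw [mgf] at h
  rw [h, zero_mul, zero_add, Real.coe_toNNReal _ (variance_nonneg _ _)]
  refine Real.exp_le_exp.2 ?_
  have := hμ.variance_quadForm_le u
  gcongr

/-- A volume argument in place of a net: the integrand is large on a ball of radius `1/4` around the
top eigenvector, and that ball lies in the fixed ball of radius `5/4`. Averaging over the latter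
before taking the expectation costs the volume ratio `5^{2n} = 25^n`, the real dimension being `2n`.
Both signs of `t` appear because the top eigenvalue may be negative. -/
theorem IsGUELaw.lintegral_exp_norm_le {μ : Measure (Fin n × Fin n → ℝ)} (hμ : IsGUELaw μ)
    (hn : n ≠ 0) {t : ℝ} (ht : 0 ≤ t) :
    ∫⁻ x, ENNReal.ofReal (Real.exp (t * (7 / 16 * ‖gueMatrix x‖))) ∂μ
      ≤ ENNReal.ofReal (25 ^ n * (2 * Real.exp (2 * t ^ 2))) := by
  have := hμ.isGaussian
  set ρ : Measure (EuclideanSpace ℂ (Fin n)) := Measure.addHaar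
  set S := Metric.ball (0 : EuclideanSpace ℂ (Fin n)) (5 / 4)
  set Φ : (Fin n × Fin n → ℝ) → EuclideanSpace ℂ (Fin n) → ℝ≥0∞ := fun x u =>
    ENNReal.ofReal (Real.exp (t * quadFormCLM u x)) +
      ENNReal.ofReal (Real.exp (-t * quadFormCLM u x)) with hΦ
  have hcont : Continuous (Function.uncurry Φ) := by
    have h1 : Continuous fun r : (Fin n × Fin n → ℝ) × EuclideanSpace ℂ (Fin n) =>
        quadFormCLM r.2 r.1 := by
      simp only [quadFormCLM_apply, quadForm]
      refine Complex.continuous_re.comp (continuous_finsetSum _ fun l _ =>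
        continuous_finsetSum _ fun m _ => Continuous.mul ?_ (by fun_prop))
      exact ((LinearMap.toContinuousLinearMap (Matrix.entryLinearMap ℝ ℂ l m)).comp
        gueMatrix).continuous.comp continuous_fst
    exact (ENNReal.continuous_ofReal.comp (by fun_prop)).add
      (ENNReal.continuous_ofReal.comp (by fun_prop))
  set b := ρ (Metric.ball 0 (1 / 4)) with hb
  have hb0 : b ≠ 0 := (Metric.measure_ball_pos ρ 0 (by norm_num)).ne'
  have hbt : b ≠ ∞ := measure_ball_lt_top.ne
  have hS : ρ S = ENNReal.ofReal (25 ^ n) * b := by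
    have h1 := Measure.addHaar_ball_mul_of_pos ρ 0 (r := 5) (by norm_num) (1 / 4)
    have h2 : Module.finrank ℝ (EuclideanSpace ℂ (Fin n)) = 2 * n := by
      rw [finrank_real_of_complex]; simp
    rw [h2, pow_mul] at h1
    norm_num at h1
    rw [ENNReal.ofReal_pow (by norm_num), ENNReal.ofReal_ofNat]
    exact h1
  have hlow : ∀ x, b * ENNReal.ofReal (Real.exp (t * (7 / 16 * ‖gueMatrix x‖)))
      ≤ ∫⁻ u in S, Φ x u ∂ρ := by
    intro x
    obtain ⟨u₀, hu₀, hle⟩ := exists_le_abs_quadForm hn (gueMatrix_isHermitian x)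
    have hsub : Metric.ball u₀ (1 / 4) ⊆ S := by
      refine Metric.ball_subset_ball' ?_
      rw [dist_zero_right, hu₀]; norm_num
    have hball : ρ (Metric.ball u₀ (1 / 4)) = b := Measure.addHaar_ball_center ρ u₀ _
    calc b * ENNReal.ofReal (Real.exp (t * (7 / 16 * ‖gueMatrix x‖)))
        = ∫⁻ _u in Metric.ball u₀ (1 / 4),
            ENNReal.ofReal (Real.exp (t * (7 / 16 * ‖gueMatrix x‖))) ∂ρ := by
          rw [setLIntegral_const, hball, mul_comm]
      _ ≤ ∫⁻ u in Metric.ball u₀ (1 / 4), Φ x u ∂ρ := by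
          refine setLIntegral_mono' measurableSet_ball fun u hu => ?_
          have h1 := hle u (by rw [← dist_eq_norm]; exact (Metric.mem_ball.1 hu).le)
          rw [← quadFormCLM_apply] at h1
          rcases le_abs'.1 h1 with h2 | h2
          · refine le_trans (ENNReal.ofReal_le_ofReal (Real.exp_le_exp.2 ?_)) le_add_self
            nlinarith
          · refine le_trans (ENNReal.ofReal_le_ofReal (Real.exp_le_exp.2 ?_)) le_self_add
            gcongr
      _ ≤ ∫⁻ u in S, Φ x u ∂ρ := lintegral_mono_set hsub
  have hup : ∀ u ∈ S, ∫⁻ x, Φ x u ∂μ ≤ ENNReal.ofReal (2 * Real.exp (2 * t ^ 2)) := by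
    intro u hu
    have hu' : ‖u‖ ≤ 5 / 4 := (mem_ball_zero_iff.1 hu).le
    have h4 : ‖u‖ ^ 4 * t ^ 2 / 2 ≤ 2 * t ^ 2 := by
      have : ‖u‖ ^ 4 ≤ (5 / 4) ^ 4 := pow_le_pow_left₀ (norm_nonneg _) hu' 4
      nlinarith [sq_nonneg t]
    have h5 : ∀ r : ℝ, r ^ 2 = t ^ 2 →
        ∫⁻ x, ENNReal.ofReal (Real.exp (r * quadFormCLM u x)) ∂μ
          ≤ ENNReal.ofReal (Real.exp (2 * t ^ 2)) := fun r hr => by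
      refine (hμ.lintegral_exp_le u r).trans (ENNReal.ofReal_le_ofReal (Real.exp_le_exp.2 ?_))
      rw [hr]; exact h4
    simp only [hΦ]
    rw [lintegral_add_left (by fun_prop), two_mul, ENNReal.ofReal_add (by positivity)
      (by positivity)]
    exact add_le_add (h5 t rfl) (h5 (-t) (by ring))
  have hmain : b * ∫⁻ x, ENNReal.ofReal (Real.exp (t * (7 / 16 * ‖gueMatrix x‖))) ∂μ
      ≤ b * ENNReal.ofReal (25 ^ n * (2 * Real.exp (2 * t ^ 2))) := by
    calc b * ∫⁻ x, ENNReal.ofReal (Real.exp (t * (7 / 16 * ‖gueMatrix x‖))) ∂μ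
        = ∫⁻ x, b * ENNReal.ofReal (Real.exp (t * (7 / 16 * ‖gueMatrix x‖))) ∂μ :=
          (lintegral_const_mul' _ _ hbt).symm
      _ ≤ ∫⁻ x, ∫⁻ u in S, Φ x u ∂ρ ∂μ := lintegral_mono hlow
      _ = ∫⁻ u in S, ∫⁻ x, Φ x u ∂μ ∂ρ := lintegral_lintegral_swap hcont.measurable.aemeasurable
      _ ≤ ∫⁻ _u in S, ENNReal.ofReal (2 * Real.exp (2 * t ^ 2)) ∂ρ :=
          setLIntegral_mono' measurableSet_ball hup
      _ = b * ENNReal.ofReal (25 ^ n * (2 * Real.exp (2 * t ^ 2))) := by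
          rw [setLIntegral_const, hS, ENNReal.ofReal_mul (p := 25 ^ n) (by positivity)]
          ring
  exact (ENNReal.mul_le_mul_iff_right hb0 hbt).1 hmain

/-- Markov's inequality for the exponential moment at `t = √n`. The level `16 √n` makes the exponent
`7n`, against `25^n e^{2n}`, and `e⁵ ≥ 50` leaves `2^{-n}`. -/
theorem IsGUELaw.measure_norm_ge_le {μ : Measure (Fin n × Fin n → ℝ)} (hμ : IsGUELaw μ)
    (hn : n ≠ 0) : μ {x | 16 * √(n : ℝ) ≤ ‖gueMatrix x‖} ≤ ENNReal.ofReal (2 * (1 / 2) ^ n) := by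
  have hn0 : 0 ≤ √(n : ℝ) := Real.sqrt_nonneg _
  have hsq : √(n : ℝ) ^ 2 = n := Real.sq_sqrt (Nat.cast_nonneg n)
  have h1 := hμ.lintegral_exp_norm_le hn hn0
  rw [hsq] at h1
  have hc0 : ENNReal.ofReal (Real.exp (7 * n)) ≠ 0 := by simp [Real.exp_pos]
  have h2 : ENNReal.ofReal (Real.exp (7 * n)) * μ {x | 16 * √(n : ℝ) ≤ ‖gueMatrix x‖}
      ≤ ∫⁻ x, ENNReal.ofReal (Real.exp (√(n : ℝ) * (7 / 16 * ‖gueMatrix x‖))) ∂μ := by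
    refine le_trans ?_ (mul_meas_ge_le_lintegral₀ ?_ (ENNReal.ofReal (Real.exp (7 * n))))
    swap
    · exact (ENNReal.continuous_ofReal.comp (by fun_prop)).measurable.aemeasurable
    refine mul_le_mul_right (measure_mono fun x hx => ENNReal.ofReal_le_ofReal
      (Real.exp_le_exp.2 ?_)) _
    rw [Set.mem_ofPred_eq] at hx
    calc (7 * n : ℝ) = √(n : ℝ) * (7 / 16 * (16 * √(n : ℝ))) := by linear_combination -7 * hsq
      _ ≤ _ := by gcongr
  have h3 : (25 : ℝ) ^ n * (2 * Real.exp (2 * n)) ≤ Real.exp (7 * n) * (2 * (1 / 2) ^ n) := by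
    have h4 : (50 : ℝ) ≤ Real.exp 5 := by
      have : Real.exp 5 = Real.exp 1 ^ 5 := by rw [← Real.exp_nat_mul]; norm_num
      rw [this]
      have h5 : (2.7 : ℝ) ≤ Real.exp 1 := by linarith [Real.exp_one_gt_d9]
      calc (50 : ℝ) ≤ 2.7 ^ 5 := by norm_num
        _ ≤ _ := by gcongr
    have h6 : Real.exp (7 * n) = Real.exp 5 ^ n * Real.exp (2 * n) := by
      rw [← Real.exp_nat_mul, ← Real.exp_add]; ring_nf
    have h7 : (25 : ℝ) ^ n = 50 ^ n * (1 / 2) ^ n := by rw [← mul_pow]; norm_num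
    rw [h6, h7]
    have h8 : (50 : ℝ) ^ n ≤ Real.exp 5 ^ n := by gcongr
    calc (50 : ℝ) ^ n * (1 / 2) ^ n * (2 * Real.exp (2 * n))
        ≤ Real.exp 5 ^ n * (1 / 2) ^ n * (2 * Real.exp (2 * n)) := by gcongr
      _ = _ := by ring
  have h9 := h2.trans (h1.trans (ENNReal.ofReal_le_ofReal h3))
  rw [ENNReal.ofReal_mul (Real.exp_pos _).le] at h9
  exact (ENNReal.mul_le_mul_iff_right hc0 ENNReal.ofReal_ne_top).1 h9

end SpinReservoir

end

noncomputable section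

namespace SpinReservoir

open scoped Matrix.Norms.L2Operator

/-! ### Almost sure convergence -/

/-- The sum of the squared moduli has finite expectation, so it is almost surely finite. Nothing is
asked of the joint law of the `Y n`. -/
theorem ae_tendsto_zero_of_tsum_ne_top {Ω : Type*} [MeasurableSpace Ω] {P : Measure Ω}
    {Y : ℕ → Ω → ℂ} (hY : ∀ n, AEMeasurable (Y n) P) (h : ∑' n, ∫⁻ ω, ‖Y n ω‖ₑ ^ 2 ∂P ≠ ∞) :
    ∀ᵐ ω ∂P, Tendsto (fun n => Y n ω) atTop (𝓝 0) := by
  rw [← lintegral_tsum fun n => (hY n).enorm.pow_const 2] at h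
  have hm : AEMeasurable (fun ω => ∑' n, ‖Y n ω‖ₑ ^ 2) P :=
    AEMeasurable.tsum fun n => (hY n).enorm.pow_const 2
  filter_upwards [ae_lt_top' hm h] with ω hω
  have h1 := ENNReal.tendsto_atTop_zero_of_tsum_ne_top hω.ne
  have h2 : Tendsto (fun n => ‖Y n ω‖ ^ 2) atTop (𝓝 0) := by
    have := (ENNReal.tendsto_toReal ENNReal.zero_ne_top).comp h1
    refine this.congr fun n => ?_
    simp
  rw [tendsto_zero_iff_norm_tendsto_zero]
  have h3 := (Real.continuous_sqrt.tendsto 0).comp h2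
  rw [Real.sqrt_zero] at h3
  refine h3.congr fun n => ?_
  simp [Real.sqrt_sq (norm_nonneg _)]

theorem greenAt_coords {n : ℕ} (s v : ℝ) (h : Matrix (Fin n) (Fin n) ℂ)
    {M : Matrix (Fin n) (Fin n) ℂ} (hM : M.IsHermitian) (z : ℂ) :
    greenAt s v h z (coords M) = green (hamiltonian s v h M) z := by
  rw [greenAt, gueMatrix_coords hM]

section Random

variable {Ω : Type*} [MeasurableSpace Ω] {P : Measure Ω} [IsProbabilityMeasure P] {s v : ℝ}
  {h : ∀ n : ℕ, Matrix (Fin n) (Fin n) ℂ} {w : ∀ n : ℕ, Ω → Matrix (Fin n) (Fin n) ℂ}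

/-- Borel–Cantelli with the geometric bound on the probabilities. -/
theorem ae_eventually_norm_le (hw : ∀ n, IsGUE P (w n)) :
    ∀ᵐ ω ∂P, ∀ᶠ n : ℕ in atTop,
      |s| + |v / √((n + 1 : ℕ) : ℝ)| * ‖w (n + 1) ω‖ ≤ |s| + |v| * 16 := by
  have h1 : ∀ n : ℕ, P {ω | 16 * √((n + 1 : ℕ) : ℝ) ≤ ‖w (n + 1) ω‖}
      ≤ ENNReal.ofReal (2 * (1 / 2) ^ (n + 1)) := by
    intro n
    obtain ⟨hm, hl⟩ := (hw (n + 1)).isGUELaw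
    refine le_trans (le_of_eq ?_) (hl.measure_norm_ge_le n.succ_ne_zero)
    rw [Measure.map_apply_of_aemeasurable hm]
    · congr 1
      ext ω
      simp [gueMatrix_coords ((hw (n + 1)).isHermitian ω)]
    · exact (isClosed_le continuous_const gueMatrix.continuous.norm).measurableSet
  have h2 : ∑' n : ℕ, P {ω | 16 * √((n + 1 : ℕ) : ℝ) ≤ ‖w (n + 1) ω‖} ≠ ∞ := by
    refine ne_top_of_le_ne_top ?_ (ENNReal.tsum_le_tsum h1)
    have hs : Summable fun n : ℕ => 2 * (1 / 2 : ℝ) ^ (n + 1) :=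
      ((summable_nat_add_iff 1).2 summable_geometric_two).mul_left 2
    exact hs.tsum_ofReal_ne_top
  filter_upwards [ae_eventually_notMem h2] with ω hω
  filter_upwards [hω] with n hn
  have hn' : ‖w (n + 1) ω‖ ≤ 16 * √((n + 1 : ℕ) : ℝ) := (not_le.1 hn).le
  have hp : 0 < √((n + 1 : ℕ) : ℝ) := Real.sqrt_pos.2 (by positivity)
  rw [abs_div, abs_of_pos hp]
  refine add_le_add le_rfl ?_
  calc |v| / √((n + 1 : ℕ) : ℝ) * ‖w (n + 1) ω‖
      ≤ |v| / √((n + 1 : ℕ) : ℝ) * (16 * √((n + 1 : ℕ) : ℝ)) := by gcongr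
    _ = |v| * 16 := by field_simp

variable (P s v h w) in
/-- The expectation of the normalized partial trace of the resolvent. -/
def meanGreen (z : ℂ) (n : ℕ) (α γ : Fin 2) : ℂ :=
  ∫ x, ptr (greenAt s v (h n) z x) α γ ∂(P.map fun ω => coords (w n ω))

theorem ae_tendsto_sub_meanGreen (hh : ∀ n, (h n).IsHermitian) (hw : ∀ n, IsGUE P (w n)) {z : ℂ}
    (hz : z.im ≠ 0) (α γ : Fin 2) :
    ∀ᵐ ω ∂P, Tendsto (fun n : ℕ =>
      ptr (green (hamiltonian s v (h (n + 1)) (w (n + 1) ω)) z) α γ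
        - meanGreen P s v h w z (n + 1) α γ) atTop (𝓝 0) := by
  have hc : ∀ n, Continuous fun x => ptr (greenAt s v (h n) z x) α γ
      - meanGreen P s v h w z n α γ := fun n =>
    (continuous_ptr_greenAt (hh n) hz α γ).sub continuous_const
  have e : ∀ (n : ℕ) ω, ptr (green (hamiltonian s v (h n) (w n ω)) z) α γ
      - meanGreen P s v h w z n α γ = ptr (greenAt s v (h n) z (coords (w n ω))) α γ
      - meanGreen P s v h w z n α γ := fun n ω => by
    rw [greenAt_coords s v (h n) ((hw n).isHermitian ω)]
  simp only [e]
  refine ae_tendsto_zero_of_tsum_ne_top (fun n =>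
    (hc (n + 1)).measurable.comp_aemeasurable (hw (n + 1)).isGUELaw.1) ?_
  have h1 : ∀ n : ℕ, ∫⁻ ω, ‖ptr (greenAt s v (h (n + 1)) z (coords (w (n + 1) ω))) α γ
      - meanGreen P s v h w z (n + 1) α γ‖ₑ ^ 2 ∂P ≤
      ENNReal.ofReal ((Real.pi * |v| * |z.im|⁻¹ ^ 2) ^ 2 * (((n + 1 : ℕ) : ℝ) ^ 2)⁻¹) := by
    intro n
    obtain ⟨hm, hl⟩ := (hw (n + 1)).isGUELaw
    have : ∫⁻ x, ‖ptr (greenAt s v (h (n + 1)) z x) α γ - meanGreen P s v h w z (n + 1) α γ‖ₑ ^ 2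
        ∂(P.map fun ω => coords (w (n + 1) ω)) ≤ _ :=
      hl.variance_le (s := s) (v := v) (hh (n + 1)) hz n.succ_ne_zero α γ
    rw [lintegral_map' ((hc (n + 1)).measurable.enorm.pow_const 2).aemeasurable hm] at this
    refine this.trans (le_of_eq ?_)
    rw [mul_pow _ (((n + 1 : ℕ) : ℝ)⁻¹), inv_pow ((n + 1 : ℕ) : ℝ)]
  refine ne_top_of_le_ne_top ?_ (ENNReal.tsum_le_tsum h1)
  have hs : Summable fun n : ℕ => (((n + 1 : ℕ) : ℝ) ^ 2)⁻¹ :=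
    (summable_nat_add_iff 1).2 (Real.summable_nat_pow_inv.2 one_lt_two)
  exact (hs.mul_left _).tsum_ofReal_ne_top

theorem meanGreen_eq_zero (hh : ∀ n, (h n).IsHermitian) (hw : ∀ n, IsGUE P (w n)) {z : ℂ}
    (hz : z.im ≠ 0) (n : ℕ) {α γ : Fin 2} (hαγ : α ≠ γ) : meanGreen P s v h w z n α γ = 0 :=
  (hw n).isGUELaw.2.integral_ptr_eq_zero (hh n) hz hαγ

theorem meanGreen_im_mul_nonneg (hh : ∀ n, (h n).IsHermitian) (hw : ∀ n, IsGUE P (w n)) {z : ℂ}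
    (hz : z.im ≠ 0) (n : ℕ) (α : Fin 2) : 0 ≤ (meanGreen P s v h w z n α α).im * z.im := by
  have := (hw n).isGUELaw.2.isGaussian
  exact integral_ptr_greenAt_im_mul_nonneg (hh n) hz α

theorem tendsto_meanGreen_sub (hh : ∀ n, (h n).IsHermitian) (hw : ∀ n, IsGUE P (w n)) {z : ℂ}
    (hz : z.im ≠ 0) (α : Fin 2) :
    Tendsto (fun n : ℕ => meanGreen P s v h w z (n + 1) α α -
      stieltjes (countingProb (hh (n + 1)) : Measure ℝ)
        (subordinate s v α z (meanGreen P s v h w z (n + 1) (opp α) (opp α)))) atTop (𝓝 0) := by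
  have hlim : Tendsto (fun n : ℕ => v ^ 2 * (2 * (|z.im|⁻¹ ^ 2 *
      (Real.pi * |v| * |z.im|⁻¹ ^ 2 * ((n + 1 : ℕ) : ℝ)⁻¹)))) atTop (𝓝 0) := by
    have h1 : Tendsto (fun n : ℕ => ((n + 1 : ℕ) : ℝ)⁻¹) atTop (𝓝 0) :=
      (tendsto_inv_atTop_nhds_zero_nat (𝕜 := ℝ)).comp (tendsto_add_atTop_nat 1)
    have := (((h1.const_mul (Real.pi * |v| * |z.im|⁻¹ ^ 2)).const_mul (|z.im|⁻¹ ^ 2)).const_mul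
      2).const_mul (v ^ 2)
    simpa only [mul_zero] using this
  refine squeeze_zero_norm (fun n => ?_) hlim
  exact (hw (n + 1)).isGUELaw.2.norm_sub_stieltjes_le n.succ_ne_zero (hh (n + 1)) hz α

end Random

/-! ### The limit along a typical realization -/

/-- A realization for which the resolvents and the norms behave as they do almost surely. -/
structure IsTypical (s v C : ℝ) (h w : ∀ n : ℕ, Matrix (Fin n) (Fin n) ℂ)
    (m : ℂ → ℕ → Fin 2 → Fin 2 → ℂ) (D : Set ℂ) : Prop where
  norm_le : ∀ᶠ n : ℕ in atTop, |s| + |v / √((n + 1 : ℕ) : ℝ)| * ‖w (n + 1)‖ ≤ C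
  tendsto : ∀ z ∈ D, z.im ≠ 0 → ∀ α γ, Tendsto (fun n : ℕ =>
    ptr (green (hamiltonian s v (h (n + 1)) (w (n + 1))) z) α γ - m z (n + 1) α γ) atTop (𝓝 0)

/-- Countability of `D` keeps the union of the exceptional sets null, so that one null set serves
all test functions at once. -/
theorem ae_isTypical {Ω : Type*} [MeasurableSpace Ω] {P : Measure Ω} [IsProbabilityMeasure P]
    {s v : ℝ} {h : ∀ n : ℕ, Matrix (Fin n) (Fin n) ℂ} {w : ∀ n : ℕ, Ω → Matrix (Fin n) (Fin n) ℂ}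
    (hh : ∀ n, (h n).IsHermitian) (hw : ∀ n, IsGUE P (w n)) {D : Set ℂ} (hD : D.Countable) :
    ∀ᵐ ω ∂P, IsTypical s v (|s| + |v| * 16) h (fun n => w n ω) (meanGreen P s v h w) D := by
  have h1 : ∀ᵐ ω ∂P, ∀ z ∈ D, z.im ≠ 0 → ∀ α γ, Tendsto (fun n : ℕ =>
      ptr (green (hamiltonian s v (h (n + 1)) (w (n + 1) ω)) z) α γ
        - meanGreen P s v h w z (n + 1) α γ) atTop (𝓝 0) := by
    refine (ae_ball_iff hD).2 fun z _ => ?_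
    by_cases hz : z.im ≠ 0
    · filter_upwards [ae_all_iff.2 fun α => ae_all_iff.2 fun γ =>
        ae_tendsto_sub_meanGreen (s := s) (v := v) hh hw hz α γ] with ω hω _
      exact hω
    · exact Eventually.of_forall fun ω hz' => absurd hz' hz
  filter_upwards [h1, ae_eventually_norm_le (s := s) (v := v) hw] with ω h1 h2
  exact ⟨h2, h1⟩

section Typical

variable {s v C : ℝ} {h w : ∀ n : ℕ, Matrix (Fin n) (Fin n) ℂ} (hh : ∀ n, (h n).IsHermitian)
  (hw : ∀ n, (w n).IsHermitian) {m : ℂ → ℕ → Fin 2 → Fin 2 → ℂ} {D : Set ℂ}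

/-- The approximate equation for the means passes to the realization: replacing the mean by the
realized trace inside the argument costs at most a multiple of their difference, by the uniform
Lipschitz bound. -/
theorem IsTypical.isApproxSolution (ht : IsTypical s v C h w m D)
    (hm : ∀ z, z.im ≠ 0 → ∀ n α, 0 ≤ (m z n α α).im * z.im)
    (hm' : ∀ z, z.im ≠ 0 → ∀ α, Tendsto (fun n : ℕ => m z (n + 1) α α -
      stieltjes (countingProb (hh (n + 1)) : Measure ℝ)
        (subordinate s v α z (m z (n + 1) (opp α) (opp α)))) atTop (𝓝 0)) :
    IsApproxSolution s v (fun n => countingProb (hh (n + 1)))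
      (fun n α => dirProb (hamiltonian_isHermitian s v (hh (n + 1)) (hw (n + 1)))
        (sum_norm_sq_single α)) D := by
  intro α z hzD hz
  simp only [stieltjes_dirProb_single _ _ hz]
  set g : ℕ → Fin 2 → ℂ := fun n α =>
    ptr (green (hamiltonian s v (h (n + 1)) (w (n + 1))) z) α α
  have h3 : Tendsto (fun n : ℕ => stieltjes (countingProb (hh (n + 1)) : Measure ℝ)
      (subordinate s v α z (m z (n + 1) (opp α) (opp α)))
      - stieltjes (countingProb (hh (n + 1)) : Measure ℝ)
        (subordinate s v α z (g n (opp α)))) atTop (𝓝 0) := by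
    have h4 : Tendsto (fun n : ℕ => v ^ 2 * ‖g n (opp α) - m z (n + 1) (opp α) (opp α)‖ *
        (|z.im|⁻¹ * |z.im|⁻¹)) atTop (𝓝 0) := by
      have := tendsto_zero_iff_norm_tendsto_zero.1 (ht.tendsto z hzD hz (opp α) (opp α))
      simpa only [mul_zero, zero_mul] using
        (this.const_mul (v ^ 2)).mul_const (|z.im|⁻¹ * |z.im|⁻¹)
    refine squeeze_zero_norm (fun n => ?_) h4
    have hg : 0 ≤ (g n (opp α)).im * z.im :=
      ptr_green_im_mul_nonneg (hamiltonian_isHermitian s v (hh (n + 1)) (hw (n + 1))) hz _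
    have hm0 := hm z hz (n + 1) (opp α)
    refine (norm_stieltjes_sub_le _ (subordinate_im_ne_zero s v α hz hm0)
      (subordinate_im_ne_zero s v α hz hg)).trans ?_
    have e : subordinate s v α z (m z (n + 1) (opp α) (opp α)) - subordinate s v α z (g n (opp α))
        = (v : ℂ) ^ 2 * -(g n (opp α) - m z (n + 1) (opp α) (opp α)) := by
      unfold subordinate; ring
    rw [e, norm_mul, norm_neg, norm_pow, Complex.norm_real, Real.norm_eq_abs, sq_abs]
    have hz' := abs_pos.2 hz
    exact mul_le_mul_of_nonneg_left (mul_le_mul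
      (inv_anti₀ hz' (abs_im_le_subordinate_im s v α hm0))
      (inv_anti₀ hz' (abs_im_le_subordinate_im s v α hg)) (by positivity) (by positivity))
      (by positivity)
  have h5 := ((ht.tendsto z hzD hz α α).add (hm' z hz α)).add h3
  rw [add_zero, add_zero] at h5
  refine h5.congr fun n => ?_
  ring

end Typical

theorem tendsto_ratio {A : ℕ → Matrix (Fin 2) (Fin 2) ℂ} {I : Fin 2 → ℝ}
    (hA : ∀ α γ, Tendsto (fun n => A n α γ) atTop
      (𝓝 (Matrix.diagonal (fun α => (I α : ℂ)) α γ))) (hI : 0 < ∑ δ, I δ) :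
    Tendsto (fun n => (Matrix.of fun α γ => A n α γ / ∑ δ, A n δ δ : Matrix (Fin 2) (Fin 2) ℂ))
      atTop (𝓝 (Matrix.diagonal fun α => ((I α / ∑ δ, I δ : ℝ) : ℂ))) := by
  have hden : Tendsto (fun n => ∑ δ, A n δ δ) atTop (𝓝 ((∑ δ, I δ : ℝ) : ℂ)) := by
    rw [Complex.ofReal_sum]
    refine tendsto_finsetSum _ fun δ _ => ?_
    simpa using hA δ δ
  refine tendsto_pi_nhds.2 fun α => tendsto_pi_nhds.2 fun γ => ?_
  have h := (hA α γ).div hden (by exact_mod_cast hI.ne')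
  have e : Matrix.diagonal (fun α => (I α : ℂ)) α γ / ((∑ δ, I δ : ℝ) : ℂ)
      = Matrix.diagonal (fun α => ((I α / ∑ δ, I δ : ℝ) : ℂ)) α γ := by
    by_cases hαγ : α = γ
    · subst hαγ; simp
    · simp [hαγ]
  rw [e] at h
  exact h

end SpinReservoir

end

noncomputable section

namespace SpinReservoir

open scoped Matrix.Norms.L2Operator

/-! ### Consequences of the convergence of the directional measures -/

section Consequences

variable {s v C : ℝ} {h w : ∀ n : ℕ, Matrix (Fin n) (Fin n) ℂ} (hh : ∀ n, (h n).IsHermitian)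
  (hw : ∀ n, (w n).IsHermitian) {ν₀ : ProbabilityMeasure ℝ} {ν : Fin 2 → ProbabilityMeasure ℝ}

/-- Coordinate directions converge by uniqueness of the solution; general directions follow because
the off-diagonal traces approach their means, which are zero. -/
theorem IsTypical.tendsto_mixture {m : ℂ → ℕ → Fin 2 → Fin 2 → ℂ} {D : Set ℂ}
    (ht : IsTypical s v C h w m D)
    (hN : Tendsto (fun n => countingProb (hh (n + 1))) atTop (𝓝 ν₀)) (hD : Dense D)
    (ha : IsApproxSolution s v (fun n => countingProb (hh (n + 1)))
      (fun n α => dirProb (hamiltonian_isHermitian s v (hh (n + 1)) (hw (n + 1)))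
        (sum_norm_sq_single α)) D)
    (hm : ∀ z, z.im ≠ 0 → ∀ n α γ, α ≠ γ → m z n α γ = 0)
    (hsol : ∀ z : ℂ, z.im ≠ 0 → IsSolutionAt s v ν₀ z fun α => stieltjes (ν α) z)
    {u : Fin 2 → ℂ} (hu : ∑ α, ‖u α‖ ^ 2 = 1) :
    Tendsto (fun n => dirProb (hamiltonian_isHermitian s v (hh (n + 1)) (hw (n + 1))) hu) atTop
      (𝓝 (mixture ν hu)) := by
  refine tendsto_dirProb hh hw hu ht.norm_le hN hD
    (ha.tendsto hN hD (fun α => tailsVanish_dirProb hh hw _ ht.norm_le hN) hsol)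
    fun z hzD hz α γ hαγ => ?_
  refine (ht.tendsto z hzD hz α γ).congr fun n => ?_
  rw [hm z hz _ α γ hαγ, sub_zero]

theorem mixture_single (ν : Fin 2 → ProbabilityMeasure ℝ) (α : Fin 2) :
    mixture ν (sum_norm_sq_single α) = ν α := by
  refine Subtype.ext ?_
  change ∑ γ, ENNReal.ofReal (‖(Pi.single α 1 : Fin 2 → ℂ) γ‖ ^ 2) • (ν γ : Measure ℝ) = ν α
  fin_cases α <;> simp [Fin.sum_univ_two]

/-- All directional spectral measures of the Hamiltonians converge to the mixtures of `ν`. -/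
def ConvergesTo (s v : ℝ) {h w : ∀ n : ℕ, Matrix (Fin n) (Fin n) ℂ} (hh : ∀ n, (h n).IsHermitian)
    (hw : ∀ n, (w n).IsHermitian) (ν : Fin 2 → ProbabilityMeasure ℝ) : Prop :=
  ∀ (u : Fin 2 → ℂ) (hu : ∑ α, ‖u α‖ ^ 2 = 1), Tendsto
    (fun n => dirProb (hamiltonian_isHermitian s v (hh (n + 1)) (hw (n + 1))) hu) atTop
      (𝓝 (mixture ν hu))

variable {hh hw}

theorem tendsto_spectralIntegral {ψ : ℝ → ℝ} (hψ : ∀ α, Integrable ψ (ν α : Measure ℝ))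
    (h' : ∀ (u : Fin 2 → ℂ) (hu : ∑ α, ‖u α‖ ^ 2 = 1), Tendsto (fun n => ∫ x, ψ x
      ∂(dirProb (hamiltonian_isHermitian s v (hh (n + 1)) (hw (n + 1))) hu : Measure ℝ)) atTop
        (𝓝 (∫ x, ψ x ∂(mixture ν hu : Measure ℝ)))) (α γ : Fin 2) :
    Tendsto (fun n => spectralIntegral (hamiltonian s v (h n) (w n)) ψ α γ) atTop
      (𝓝 (Matrix.diagonal (fun α => ((∫ x, ψ x ∂(ν α : Measure ℝ) : ℝ) : ℂ)) α γ)) := by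
  refine (tendsto_add_atTop_iff_nat 1).1 ?_
  refine (tendsto_ptr_udiag (fun n => hamiltonian_isHermitian s v (hh (n + 1)) (hw (n + 1))) hψ h'
    α γ).congr fun n => ?_
  rw [spectralIntegral_apply]

theorem ConvergesTo.tendsto_spectralIntegral_bounded (hlim : ConvergesTo s v hh hw ν)
    (φ : ℝ →ᵇ ℝ) : Tendsto (fun n => spectralIntegral (hamiltonian s v (h n) (w n)) φ) atTop
      (𝓝 (Matrix.diagonal fun α => ((∫ x, φ x ∂(ν α : Measure ℝ) : ℝ) : ℂ))) :=
  tendsto_pi_nhds.2 fun α => tendsto_pi_nhds.2 fun γ =>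
    tendsto_spectralIntegral (hh := hh) (hw := hw) (fun _ => φ.integrable _)
      (fun u hu => ProbabilityMeasure.tendsto_iff_forall_integral_tendsto.1 (hlim u hu) φ) α γ

theorem ConvergesTo.tendsto_reducedMicrocanonical (hlim : ConvergesTo s v hh hw ν)
    (h0 : ∀ α l, (ν α : Measure ℝ) {l} = 0) (ε lam : ℝ)
    (hpos : 0 < ∑ δ, smoothedLimit ε lam (ν δ : Measure ℝ)) :
    Tendsto (fun n => reducedMicrocanonical ε lam (hamiltonian s v (h n) (w n))) atTop
      (𝓝 (Matrix.diagonal fun α => ((smoothedLimit ε lam (ν α : Measure ℝ) /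
        ∑ δ, smoothedLimit ε lam (ν δ : Measure ℝ) : ℝ) : ℂ))) := by
  refine tendsto_ratio (A := fun n α γ => smoothedDensity ε lam (hamiltonian s v (h n) (w n)) α γ)
    (fun α γ => (tendsto_add_atTop_iff_nat 1).1 ?_) hpos
  have h1 := (tendsto_ptr_udiag (ν := ν)
    (fun n => hamiltonian_isHermitian s v (hh (n + 1)) (hw (n + 1)))
    (ψ := (Set.Ioo (lam - ε) (lam + ε)).indicator fun _ => (1 : ℝ))
    (fun α => (integrable_const 1).indicator measurableSet_Ioo)
    (fun u hu => tendsto_integral_indicator (hlim u hu)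
      (fun l => mixture_apply_eq_zero ν hu fun α => h0 α l) _ _) α γ).const_mul
    ((2 * ε : ℝ) : ℂ)⁻¹
  have e : ((2 * ε : ℝ) : ℂ)⁻¹ * Matrix.diagonal (fun α =>
      ((∫ x, (Set.Ioo (lam - ε) (lam + ε)).indicator (fun _ => (1 : ℝ)) x ∂(ν α : Measure ℝ) : ℝ)
        : ℂ)) α γ = Matrix.diagonal (fun α => (smoothedLimit ε lam (ν α : Measure ℝ) : ℂ)) α γ := by
    by_cases hαγ : α = γ
    · subst hαγ
      rw [Matrix.diagonal_apply_eq, Matrix.diagonal_apply_eq, integral_indicator measurableSet_Ioo,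
        smoothedLimit]
      simp
    · simp [hαγ]
  rw [e] at h1
  refine h1.congr fun n => ?_
  rw [smoothedDensity_apply]

theorem ConvergesTo.canonical {ν : Fin 2 → ProbabilityMeasure ℝ} (hlim : ConvergesTo s v hh hw ν)
    (hC : ∀ᶠ n : ℕ in atTop, |s| + |v / √((n + 1 : ℕ) : ℝ)| * ‖w (n + 1)‖ ≤ C)
    (hN : Tendsto (fun n => countingProb (hh (n + 1))) atTop (𝓝 ν₀)) {β : ℝ}
    (hβ : Integrable (fun x => Real.exp (-β * x)) (ν₀ : Measure ℝ))
    (hβ' : Tendsto (fun n => ∫ x, Real.exp (-β * x) ∂(countingProb (hh (n + 1)) : Measure ℝ)) atTop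
      (𝓝 (∫ x, Real.exp (-β * x) ∂(ν₀ : Measure ℝ)))) :
    (∀ α, Integrable (fun x => Real.exp (-β * x)) (ν α : Measure ℝ)) ∧
      Tendsto (fun n => reducedCanonical β (hamiltonian s v (h n) (w n))) atTop
        (𝓝 (Matrix.diagonal fun α => (((∫ x, Real.exp (-β * x) ∂(ν α : Measure ℝ)) /
          ∑ δ, ∫ x, Real.exp (-β * x) ∂(ν δ : Measure ℝ) : ℝ) : ℂ))) := by
  have hi : ∀ α, Integrable (fun x => Real.exp (-β * x)) (ν α : Measure ℝ) := fun α => by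
    rw [← mixture_single ν α]
    exact (integrable_and_tendsto_exp hh hw _ hC hN (hlim _ (sum_norm_sq_single α)) hβ hβ').1
  refine ⟨hi, tendsto_ratio
    (A := fun n α γ => spectralIntegral (hamiltonian s v (h n) (w n)) (fun x => Real.exp (-β * x))
      α γ) (tendsto_spectralIntegral (hh := hh) (hw := hw) hi fun u hu =>
        (integrable_and_tendsto_exp hh hw hu hC hN (hlim u hu) hβ hβ').2) ?_⟩
  exact Finset.sum_pos (fun δ _ => integral_exp_pos (hi δ)) Finset.univ_nonempty

end Consequences

end SpinReservoir

end

/-! ### The theorem -/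

theorem theoremt {Ω : Type*} [MeasurableSpace Ω] (P : Measure Ω) [IsProbabilityMeasure P]
    (s v : ℝ) (hs : 0 < s) (hv : 0 < v)
    (h : ∀ n : ℕ, Matrix (Fin n) (Fin n) ℂ) (hh : ∀ n, (h n).IsHermitian)
    (ν₀ : Measure ℝ) [IsProbabilityMeasure ν₀]
    (hν₀ : ∀ φ : ℝ →ᵇ ℝ, Tendsto (fun n => ∫ x, φ x ∂(SpinReservoir.countingMeasure (hh n))) atTop
      (𝓝 (∫ x, φ x ∂ν₀)))
    (w : ∀ n : ℕ, Ω → Matrix (Fin n) (Fin n) ℂ) (hw : ∀ n, SpinReservoir.IsGUE P (w n)) :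
    ∃ ν : Fin 2 → Measure ℝ,
      -- (i) almost sure weak convergence of the matrix spectral measures
      (∀ᵐ ω ∂P, ∀ φ : ℝ →ᵇ ℝ,
        Tendsto (fun n => SpinReservoir.spectralIntegral
            (SpinReservoir.hamiltonian s v (h n) (w n ω)) φ) atTop
          (𝓝 (Matrix.diagonal fun α => ((∫ x, φ x ∂(ν α) : ℝ) : ℂ)))) ∧
      -- (ii) the Stieltjes transforms are the unique solution of the functional equations
      SpinReservoir.IsNevanlinnaSolution s v ν₀ (fun α => SpinReservoir.stieltjes (ν α)) ∧
      (∀ g : Fin 2 → ℂ → ℂ, SpinReservoir.IsNevanlinnaSolution s v ν₀ g →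
        ∀ α z, z.im ≠ 0 → g α z = SpinReservoir.stieltjes (ν α) z) ∧
      -- (iii) unit mass, and the bound for the densities
      (∀ α, IsProbabilityMeasure (ν α)) ∧
      (ν₀ ≪ volume → essSup (ν₀.rnDeriv volume) volume < ∞ →
        ∀ α, ν α ≪ volume ∧
          ∀ᵐ x, (ν α).rnDeriv volume x ≤ essSup (ν₀.rnDeriv volume) volume) ∧
      -- (iv) the reduced microcanonical distribution
      (∀ ε : ℝ, 0 < ε → ∀ lam : ℝ, 0 < ∑ δ, SpinReservoir.smoothedLimit ε lam (ν δ) →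
        ∀ᵐ ω ∂P, Tendsto (fun n => SpinReservoir.reducedMicrocanonical ε lam
            (SpinReservoir.hamiltonian s v (h n) (w n ω))) atTop
          (𝓝 (Matrix.diagonal fun α => ((SpinReservoir.smoothedLimit ε lam (ν α) /
            ∑ δ, SpinReservoir.smoothedLimit ε lam (ν δ) : ℝ) : ℂ)))) ∧
      -- (iv) the reduced canonical distribution
      (∀ β : ℝ, Integrable (fun x => Real.exp (-β * x)) ν₀ →
        Tendsto (fun n => ∫ x, Real.exp (-β * x) ∂(SpinReservoir.countingMeasure (hh n))) atTop
          (𝓝 (∫ x, Real.exp (-β * x) ∂ν₀)) →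
        (∀ α, Integrable (fun x => Real.exp (-β * x)) (ν α)) ∧
        ∀ᵐ ω ∂P, Tendsto (fun n => SpinReservoir.reducedCanonical β
            (SpinReservoir.hamiltonian s v (h n) (w n ω))) atTop
          (𝓝 (Matrix.diagonal fun α => (((∫ x, Real.exp (-β * x) ∂(ν α)) /
            ∑ δ, ∫ x, Real.exp (-β * x) ∂(ν δ) : ℝ) : ℂ)))) := by
  -- The index is shifted by one because for `n = 0` the counting measure is the zero measure.
  set N : ℕ → ProbabilityMeasure ℝ := fun n => SpinReservoir.countingProb (hh (n + 1)) with hNdef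
  set ν₀P : ProbabilityMeasure ℝ := ⟨ν₀, inferInstance⟩
  have hN : Tendsto N atTop (𝓝 ν₀P) :=
    ProbabilityMeasure.tendsto_iff_forall_integral_tendsto.2 fun φ =>
      (tendsto_add_atTop_iff_nat 1).2 (hν₀ φ)
  obtain ⟨D, hDc, hD⟩ := TopologicalSpace.exists_countable_dense ℂ
  have htyp := SpinReservoir.ae_isTypical (s := s) (v := v) hh hw hDc
  have hH : ∀ ω n, (w n ω).IsHermitian := fun ω n => (hw n).isHermitian ω
  have happrox : ∀ ω, SpinReservoir.IsTypical s v (|s| + |v| * 16) h (fun n => w n ω)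
      (SpinReservoir.meanGreen P s v h w) D → SpinReservoir.IsApproxSolution s v N
      (fun n α => SpinReservoir.dirProb (SpinReservoir.hamiltonian_isHermitian s v (hh (n + 1))
        (hH ω (n + 1))) (SpinReservoir.sum_norm_sq_single α)) D := fun ω ht =>
    ht.isApproxSolution hh (hH ω)
      (fun z hz n α => SpinReservoir.meanGreen_im_mul_nonneg hh hw hz n α)
      (fun z hz α => SpinReservoir.tendsto_meanGreen_sub hh hw hz α)
  -- One typical realization suffices to produce the limit measures. They are fixed here once, and
  -- uniqueness forces every other typical realization to converge to them.
  obtain ⟨ν, hsol⟩ : ∃ ν : Fin 2 → ProbabilityMeasure ℝ, ∀ z : ℂ, z.im ≠ 0 →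
      SpinReservoir.IsSolutionAt s v ν₀ z fun α => SpinReservoir.stieltjes (ν α) z := by
    obtain ⟨ω, ht⟩ := htyp.exists
    obtain ⟨ρ, -, -, h⟩ := (happrox ω ht).exists_isSolutionAt hN hD
      (fun α => SpinReservoir.tailsVanish_dirProb hh (hH ω) _ ht.norm_le hN) tendsto_id
    exact ⟨ρ, h⟩
  have hconv : ∀ ω, SpinReservoir.IsTypical s v (|s| + |v| * 16) h (fun n => w n ω)
      (SpinReservoir.meanGreen P s v h w) D → SpinReservoir.ConvergesTo s v hh (hH ω) ν :=
    fun ω ht u hu => ht.tendsto_mixture hh (hH ω) hN hD (happrox ω ht)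
      (fun z hz n α γ hαγ => SpinReservoir.meanGreen_eq_zero hh hw hz n hαγ) hsol hu
  refine ⟨fun α => ν α, ?_, ⟨fun α => SpinReservoir.analyticOnNhd_stieltjes _,
    fun α z hz => SpinReservoir.stieltjes_im_mul_pos _ hz, fun α z hz => ?_⟩, fun g hg α z hz => ?_,
    fun α => inferInstance, fun hac hM α => SpinReservoir.density_bound hsol hac hM α,
    fun ε _ lam hpos => ?_, fun β hβ hβ' => ?_⟩
  · filter_upwards [htyp] with ω ht φ
    exact (hconv ω ht).tendsto_spectralIntegral_bounded φ
  · rw [SpinReservoir.integral_eq_stieltjes]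
    exact (hsol z hz).eq α
  · exact congrFun ((hg.isSolutionAt hz).unique (hsol z hz) hz) α
  · filter_upwards [htyp] with ω ht
    exact (hconv ω ht).tendsto_reducedMicrocanonical
      (SpinReservoir.measure_singleton_eq_zero hv.ne' hsol) ε lam hpos
  · have key : ∀ ω, SpinReservoir.IsTypical s v (|s| + |v| * 16) h (fun n => w n ω)
        (SpinReservoir.meanGreen P s v h w) D → _ := fun ω ht =>
      (hconv ω ht).canonical ht.norm_le hN hβ ((tendsto_add_atTop_iff_nat 1).2 hβ')
    -- Finiteness of the exponential moments of `ν` does not involve `ω`; any typical realization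
    -- yields it.
    obtain ⟨ω, ht⟩ := htyp.exists
    refine ⟨(key ω ht).1, ?_⟩
    filter_upwards [htyp] with ω ht
    exact (key ω ht).2
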